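/- Let $M$ be a smooth four-dimensional manifold, $f:\mathbb R\to\mathbb R$ a smooth function, $Q_a$ a fixed smooth one-form on $M$, $g_{ab}$ a smooth Lorentzian metric of signature $(-+++)$, $\Gamma^c{}_{ab}$ a smooth symmetric linear connection (with covariant derivative $\nabla$) and $\Lambda_c{}^{ab}=\Lambda_c{}^{ba}$ a smooth tensor field (Lagrange multiplier). Write $\{{}^c_{ab}\}$ for the Christoffel symbols of $g$, $R_{ab}=\partial_c\Gamma^c{}_{ab}-\partial_b\Gamma^c{}_{ac}+\Gamma^c{}_{cd}\Gamma^d{}_{ab}-\Gamma^c{}_{bd}\Gamma^d{}_{ac}$ for the Ricci tensor of $\Gamma$, $R=g^{ab}R_{ab}$, $f=f(R)$, $f'=f'(R)$, $\square=g^{ab}\nabla_a\nabla_b$, $\nabla^cQ_c=g^{cd}\nabla_cQ_d$, and assume $f'(R)>0$ on $M$. Call $(g,\Gamma,\Lambda)$ stationary if the first variation of the constrained action $$S=\int d^4x\,\sqrt{-g}\,\Bigl\{f\bigl(g^{ab}R_{ab}(\Gamma)\bigr)+\Lambda_c{}^{ab}\Bigl[\Gamma^c{}_{ab}-\{{}^c_{ab}\}-\tfrac12g^{cd}\bigl(Q_bg_{ad}+Q_ag_{db}-Q_dg_{ab}\bigr)\Bigr]\Bigr\}$$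 vanishes in every chart for all independent smooth variations of $g$, $\Gamma$, $\Lambda$ (symmetric in the same index pairs) supported in compact subsets of the chart, with $Q$ held fixed. Put $$\widetilde g_{ab}=f'g_{ab},\quad \varphi=\ln f',\quad \widetilde Q_a=Q_a-\nabla_a\ln f',\quad V=\tfrac12(f')^{-2}\bigl(Rf'(R)-f(R)\bigr),$$ let $\widetilde\nabla$ be the Weyl connection of $(\widetilde g,\widetilde Q)$ (the symmetric connection with $\widetilde\nabla_c\widetilde g_{ab}=-\widetilde Q_c\widetilde g_{ab}$), $\widetilde R_{ab}$ its Ricci tensor, $\widetilde R=\widetilde g^{ab}\widetilde R_{ab}$ and $\widetilde G_{ab}=\widetilde R_{(ab)}-\tfrac12\widetilde R\,\widetilde g_{ab}$. Then: 1. $(g,\Gamma,\Lambda)$ is stationary if and only if $\Gamma$ is the Weyl connection of $(g,Q)$, i.e. $\Gamma^c{}_{ab}=\{{}^c_{ab}\}+\tfrac12g^{cd}(Q_bg_{ad}+Q_ag_{db}-Q_dg_{ab})$, $$\Lambda_c{}^{ab}=\delta_c^{(b}\bigl(Q^{a)}f'-\nabla^{a)}f'\bigr)-g^{ab}\bigl(Q_cf'-\nabla_cf'\bigr),$$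 and $$f'R_{(ab)}-\tfrac12fg_{ab}-\nabla_a\nabla_bf'+g_{ab}\square f'=-2Q_{(a}\nabla_{b)}f'-f'\nabla_{(a}Q_{b)}+f'Q_aQ_b+g_{ab}\bigl(2Q_c\nabla^cf'-Q^2f'+f'\nabla^cQ_c\bigr).$$ 2. Equivalently, $(g,\Gamma,\Lambda)$ is stationary if and only if $\Gamma$ and $\Lambda$ are as in 1 and, in the conformal frame, Einstein's equations $$\widetilde G_{ab}=\widetilde M_{ab}(\widetilde Q)-\widetilde g_{ab}V,\qquad \widetilde M_{ab}(\widetilde Q)=\widetilde Q_a\widetilde Q_b-\widetilde\nabla_{(a}\widetilde Q_{b)}+\widetilde g_{ab}\bigl(\widetilde\nabla^c\widetilde Q_c-\widetilde Q^2\bigr)$$ hold, indices being raised with $\widetilde g$. Moreover $\widetilde\nabla=\nabla$ whenever $\Gamma$ is the Weyl connection of $(g,Q)$. 3. If $f''$ vanishes nowhere, $V$ is a function of $\varphi$: $V=V(\varphi)$, obtained by expressing $R$ through $\varphi$ with the inverse function of $f'$. 4. (Riemannian conformal frame.) If $\widetilde Q=0$, then $(g,\Gamma,\Lambda)$ is stationary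 if and only if $\Gamma$ is the Levi-Civita connection of $\widetilde g$, $\Lambda=0$, and $G_{ab}[\widetilde g]=-\widetilde g_{ab}V$, where $G_{ab}[\widetilde g]$ is the Einstein tensor of $\widetilde g$. 5. (Vanishing Weyl one-form: the standard conformal equivalence.) If $Q=0$, then $(g,\Gamma,\Lambda)$ is stationary if and only if $\Gamma$ is the Levi-Civita connection of $g$, $\Lambda$ is as in 1, and $f'R_{ab}-\tfrac12fg_{ab}-\nabla_a\nabla_bf'+g_{ab}\square f'=0$ (with $R_{ab}=R_{(ab)}$); equivalently, if and only if $\Gamma$ is the Levi-Civita connection of $g$, $\Lambda$ is as in 1, and $$G_{ab}[\widetilde g]=\tfrac32\Bigl(\nabla_a\varphi\nabla_b\varphi-\tfrac12\widetilde g_{ab}\,\widetilde g^{cd}\nabla_c\varphi\nabla_d\varphi\Bigr)-\widetilde g_{ab}V.$$ -/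

import Mathlib

open scoped Manifold ContDiff

namespace WeylFR

noncomputable section

/-- The model space `ℝ⁴` of coordinates `x⁰, x¹, x², x³`; its volume is `d⁴Ω`. -/
abbrev Coord : Type := EuclideanSpace ℝ (Fin 4)

/-! ### Component calculus in one coordinate system

All functions below are component functions on `ℝ⁴`; only their values on the open set on which the
coordinates are defined matter. -/

/-- Components `η_a` of a one-form. -/
abbrev Comp₁ : Type := Coord → Fin 4 → ℝ

/-- Components `T_ab` of a twice covariant tensor. -/
abbrev Comp₂ : Type := Coord → Matrix (Fin 4) (Fin 4) ℝ

/-- Three-index components: `Γ x c a b` is `Γ^c_ab` and `Λ x c a b` is `Λ_c^ab`. -/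
abbrev Comp₃ : Type := Coord → Fin 4 → Fin 4 → Fin 4 → ℝ

/-- The partial derivative `∂_a u`. -/
def pd (a : Fin 4) (u : Coord → ℝ) (x : Coord) : ℝ :=
  fderiv ℝ u x (EuclideanSpace.single a 1)

/-- The differential `∂_a u` as a one-form. -/
def grad (u : Coord → ℝ) : Comp₁ := fun x a => pd a u x

/-- The Christoffel symbols of `g`,
`{c; a b} = ½ g^cd (∂_b g_ad + ∂_a g_db - ∂_d g_ab)`. -/
def christoffel (g : Comp₂) : Comp₃ := fun x c a b =>
  (1 / 2) * ∑ d, (g x)⁻¹ c d *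
    (pd b (fun y => g y a d) x + pd a (fun y => g y d b) x - pd d (fun y => g y a b) x)

/-- The difference tensor of Weyl geometry,
`C^c_ab = ½ g^cd (Q_b g_ad + Q_a g_db - Q_d g_ab)`. -/
def weylDifference (g : Comp₂) (Q : Comp₁) : Comp₃ := fun x c a b =>
  (1 / 2) * ∑ d, (g x)⁻¹ c d * (Q x b * g x a d + Q x a * g x d b - Q x d * g x a b)

/-- The Weyl connection of `(g, Q)`: the symmetric connection with `∇_c g_ab = - Q_c g_ab`. -/
def weylConnection (g : Comp₂) (Q : Comp₁) : Comp₃ := fun x c a b =>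
  christoffel g x c a b + weylDifference g Q x c a b

/-- The Ricci tensor
`R_ab = ∂_c Γ^c_ab - ∂_b Γ^c_ac + Γ^c_cd Γ^d_ab - Γ^c_bd Γ^d_ac` of a symmetric connection. -/
def ricci (Γ : Comp₃) : Comp₂ := fun x a b =>
  (∑ c, (pd c (fun y => Γ y c a b) x - pd b (fun y => Γ y c a c) x)) +
    ∑ c, ∑ d, (Γ x c c d * Γ x d a b - Γ x c b d * Γ x d a c)

/-- The scalar curvature `R = g^ab R_ab(Γ)`, with metric and connection independent. -/
def scalarCurvature (g : Comp₂) (Γ : Comp₃) (x : Coord) : ℝ :=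
  ∑ a, ∑ b, (g x)⁻¹ a b * ricci Γ x a b

/-- The symmetric part `T_(ab)`. -/
def symPart (T : Comp₂) : Comp₂ := fun x a b => (1 / 2) * (T x a b + T x b a)

/-- The Einstein tensor `G_ab = R_(ab) - ½ R g_ab` of a metric and a symmetric connection. -/
def einstein (g : Comp₂) (Γ : Comp₃) : Comp₂ := fun x a b =>
  symPart (ricci Γ) x a b - (1 / 2) * scalarCurvature g Γ x * g x a b

/-- The covariant derivative `∇_a η_b = ∂_a η_b - Γ^c_ab η_c` of a one-form. -/
def covDeriv (Γ : Comp₃) (η : Comp₁) : Comp₂ := fun x a b =>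
  pd a (fun y => η y b) x - ∑ c, Γ x c a b * η x c

/-- The second covariant derivative `∇_a ∇_b u` of a scalar. -/
def hessian (Γ : Comp₃) (u : Coord → ℝ) : Comp₂ := covDeriv Γ (grad u)

/-- The full contraction `g^ab T_ab`. -/
def contract (g T : Comp₂) (x : Coord) : ℝ := ∑ a, ∑ b, (g x)⁻¹ a b * T x a b

/-- The scalar product `g^ab η_a ξ_b` of two one-forms. -/
def inner₁ (g : Comp₂) (η ξ : Comp₁) (x : Coord) : ℝ := ∑ a, ∑ b, (g x)⁻¹ a b * η x a * ξ x b

/-! ### The constrained action -/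

/-- The constrained first-order Lagrangian density
`√(-g) [ f(g^ab R_ab(Γ)) + Λ_c^ab (Γ^c_ab - {c; a b} - C^c_ab) ]`,
`C` being the difference tensor of Weyl geometry. -/
def lagrangianDensity (f : ℝ → ℝ) (Q : Comp₁) (g : Comp₂) (Γ Λ : Comp₃) (x : Coord) : ℝ :=
  √(-(g x).det) *
    (f (scalarCurvature g Γ x) +
      ∑ c, ∑ a, ∑ b, Λ x c a b * (Γ x c a b - christoffel g x c a b - weylDifference g Q x c a b))

/-- The action over a coordinate region `K`. -/
def constrainedAction (f : ℝ → ℝ) (Q : Comp₁) (K : Set Coord) (g : Comp₂) (Γ Λ : Comp₃) : ℝ :=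
  ∫ x in K, lagrangianDensity f Q g Γ Λ x

/-- A smooth variation of the metric, the connection and the multipliers which vanishes outside
`K`. -/
structure IsVariation (K : Set Coord) (h : Comp₂) (γ μ : Comp₃) : Prop where
  smooth_metric : ∀ a b, ContDiff ℝ ∞ fun x => h x a b
  smooth_connection : ∀ c a b, ContDiff ℝ ∞ fun x => γ x c a b
  smooth_multiplier : ∀ c a b, ContDiff ℝ ∞ fun x => μ x c a b
  symm_metric : ∀ x a b, h x a b = h x b a
  symm_connection : ∀ x c a b, γ x c a b = γ x c b a
  symm_multiplier : ∀ x c a b, μ x c a b = μ x c b a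
  vanish_metric : ∀ x ∉ K, ∀ a b, h x a b = 0
  vanish_connection : ∀ x ∉ K, ∀ c a b, γ x c a b = 0
  vanish_multiplier : ∀ x ∉ K, ∀ c a b, μ x c a b = 0

/-! ### Fields on a four-dimensional manifold

A geometric object is given by its components in every chart of the smooth structure, subject to
the transformation law for its type. -/

section Fields

variable (M : Type*) [TopologicalSpace M] [ChartedSpace Coord M]

/-- The charts of the smooth structure of `M`. -/
def charts : Set (OpenPartialHomeomorph M Coord) := IsManifold.maximalAtlas (𝓡 4) ∞ M

variable {M}

/-- The domain, in the coordinates `e`, of the coordinate change from `e` to `e'`. -/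
def overlap (e e' : OpenPartialHomeomorph M Coord) : Set Coord := (e.symm.trans e').source

/-- The coordinate `y^k` of the chart `e'` as a function of the coordinates of `e`. -/
def transition (e e' : OpenPartialHomeomorph M Coord) (k : Fin 4) (x : Coord) : ℝ :=
  e' (e.symm x) k

/-- The Jacobian `∂y^k / ∂x^a` of the coordinate change from `e` to `e'`. -/
def jacobian (e e' : OpenPartialHomeomorph M Coord) (x : Coord) (k a : Fin 4) : ℝ :=
  pd a (transition e e' k) x

variable (M)

/-- A smooth one-form. -/
structure OneForm where
  comp : OpenPartialHomeomorph M Coord → Comp₁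
  smooth : ∀ e ∈ charts M, ∀ a, ContDiffOn ℝ ∞ (fun x => comp e x a) e.target
  transform : ∀ e ∈ charts M, ∀ e' ∈ charts M, ∀ x ∈ overlap e e', ∀ a,
    comp e x a = ∑ k, jacobian e e' x k a * comp e' (e' (e.symm x)) k

/-- Symmetric with signature `(- + + +)`. -/
def IsLorentzian (A : Matrix (Fin 4) (Fin 4) ℝ) : Prop :=
  ∃ P : Matrix (Fin 4) (Fin 4) ℝ, IsUnit P.det ∧
    P.transpose * A * P = Matrix.diagonal ![-1, 1, 1, 1]

/-- A smooth Lorentzian metric `g_ab`. -/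
structure LorentzMetric where
  comp : OpenPartialHomeomorph M Coord → Comp₂
  smooth : ∀ e ∈ charts M, ∀ a b, ContDiffOn ℝ ∞ (fun x => comp e x a b) e.target
  lorentzian : ∀ e ∈ charts M, ∀ x ∈ e.target, IsLorentzian (comp e x)
  transform : ∀ e ∈ charts M, ∀ e' ∈ charts M, ∀ x ∈ overlap e e', ∀ a b,
    comp e x a b =
      ∑ k, ∑ l, jacobian e e' x k a * jacobian e e' x l b * comp e' (e' (e.symm x)) k l

/-- A smooth symmetric (torsion-free) linear connection `Γ^c_ab`. -/
structure SymmetricConnection where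
  comp : OpenPartialHomeomorph M Coord → Comp₃
  smooth : ∀ e ∈ charts M, ∀ c a b, ContDiffOn ℝ ∞ (fun x => comp e x c a b) e.target
  symm : ∀ e ∈ charts M, ∀ x ∈ e.target, ∀ c a b, comp e x c a b = comp e x c b a
  transform : ∀ e ∈ charts M, ∀ e' ∈ charts M, ∀ x ∈ overlap e e', ∀ k a b,
    ∑ c, jacobian e e' x k c * comp e x c a b =
      pd a (fun y => jacobian e e' y k b) x +
        ∑ i, ∑ j, jacobian e e' x i a * jacobian e e' x j b * comp e' (e' (e.symm x)) k i j

/-- A smooth field of Lagrange multipliers: a tensor `Λ_c^ab` symmetric in its upper indices. -/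
structure Multiplier where
  comp : OpenPartialHomeomorph M Coord → Comp₃
  smooth : ∀ e ∈ charts M, ∀ c a b, ContDiffOn ℝ ∞ (fun x => comp e x c a b) e.target
  symm : ∀ e ∈ charts M, ∀ x ∈ e.target, ∀ c a b, comp e x c a b = comp e x c b a
  transform : ∀ e ∈ charts M, ∀ e' ∈ charts M, ∀ x ∈ overlap e e', ∀ c i j,
    ∑ a, ∑ b, jacobian e e' x i a * jacobian e e' x j b * comp e x c a b =
      ∑ k, jacobian e e' x k c * comp e' (e' (e.symm x)) k i j

variable {M}

/-- `(g, Γ, Λ)` is a stationary point of the constrained action with Lagrangian `f(R)` and fixed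
Weyl one-form `Q`: for every chart, every compact region `K` of coordinates and all independent
variations `δg_ab`, `δΓ^c_ab`, `δΛ_c^ab` supported in `K`, the first variation of the action
vanishes. -/
def IsStationaryPoint (f : ℝ → ℝ) (Q : OneForm M) (g : LorentzMetric M) (Γ : SymmetricConnection M)
    (Λ : Multiplier M) : Prop :=
  ∀ e ∈ charts M, ∀ K : Set Coord, IsCompact K → K ⊆ e.target →
    ∀ (h : Comp₂) (γ μ : Comp₃), IsVariation K h γ μ →
      HasDerivAt
        (fun ε : ℝ => constrainedAction f (Q.comp e) K (fun x => g.comp e x + ε • h x)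
          (fun x => Γ.comp e x + ε • γ x) (fun x => Λ.comp e x + ε • μ x)) 0 0

/-- The identity `lhs = rhs` between component functions in every chart and at every point. -/
def TensorEq₁ (lhs rhs : OpenPartialHomeomorph M Coord → Comp₁) : Prop :=
  ∀ e ∈ charts M, ∀ x ∈ e.target, ∀ a, lhs e x a = rhs e x a

/-- The identity `lhs = rhs` between component functions in every chart and at every point. -/
def TensorEq₂ (lhs rhs : OpenPartialHomeomorph M Coord → Comp₂) : Prop :=
  ∀ e ∈ charts M, ∀ x ∈ e.target, ∀ a b, lhs e x a b = rhs e x a b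

/-- The identity `lhs = rhs` between component functions in every chart and at every point. -/
def TensorEq₃ (lhs rhs : OpenPartialHomeomorph M Coord → Comp₃) : Prop :=
  ∀ e ∈ charts M, ∀ x ∈ e.target, ∀ c a b, lhs e x c a b = rhs e x c a b

end Fields

/-! ### The objects of the field equations -/

/-- The function `f'(R)`, with `R = g^ab R_ab(Γ)`. -/
def fPrime (f : ℝ → ℝ) (g : Comp₂) (Γ : Comp₃) (x : Coord) : ℝ := deriv f (scalarCurvature g Γ x)

/-- The Lagrange multipliers
`δ_c^(b P^a) - g^ab P_c` with `P_c = Q_c f' - ∇_c f'`. -/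
def multiplierValue (f : ℝ → ℝ) (Q : Comp₁) (g : Comp₂) (Γ : Comp₃) : Comp₃ := fun x c a b =>
  let P : Fin 4 → ℝ := fun d => Q x d * fPrime f g Γ x - grad (fPrime f g Γ) x d
  let Pup : Fin 4 → ℝ := fun a => ∑ d, (g x)⁻¹ a d * P d
  (1 / 2) * ((if c = b then Pup a else 0) + (if c = a then Pup b else 0)) - (g x)⁻¹ a b * P c

/-- `f' R_(ab) - ½ f g_ab - ∇_a ∇_b f' + g_ab □ f'`, with `□ = g^cd ∇_c ∇_d`. -/
def fieldOperator (f : ℝ → ℝ) (g : Comp₂) (Γ : Comp₃) : Comp₂ := fun x a b =>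
  fPrime f g Γ x * symPart (ricci Γ) x a b - (1 / 2) * f (scalarCurvature g Γ x) * g x a b
    - hessian Γ (fPrime f g Γ) x a b + g x a b * contract g (hessian Γ (fPrime f g Γ)) x

/-- The source
`M_ab = - 2 Q_(a ∇_b) f' - f' ∇_(a Q_b) + f' Q_a Q_b
  + g_ab (2 Q_c ∇^c f' - Q² f' + f' ∇^c Q_c)`. -/
def weylSource (f : ℝ → ℝ) (Q : Comp₁) (g : Comp₂) (Γ : Comp₃) : Comp₂ := fun x a b =>
  -(Q x a * grad (fPrime f g Γ) x b + Q x b * grad (fPrime f g Γ) x a)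
    - fPrime f g Γ x * symPart (covDeriv Γ Q) x a b
    + fPrime f g Γ x * Q x a * Q x b
    + g x a b * (2 * inner₁ g Q (grad (fPrime f g Γ)) x - inner₁ g Q Q x * fPrime f g Γ x
        + fPrime f g Γ x * contract g (covDeriv Γ Q) x)

/-- The conformally related metric `g̃_ab = f' g_ab`. -/
def conformalMetric (f : ℝ → ℝ) (g : Comp₂) (Γ : Comp₃) : Comp₂ := fun x => fPrime f g Γ x • g x

/-- The scalar field `φ = ln f'`. -/
def scalarField (f : ℝ → ℝ) (g : Comp₂) (Γ : Comp₃) (x : Coord) : ℝ := Real.log (fPrime f g Γ x)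

/-- The transformed Weyl one-form `Q̃_a = Q_a - ∇_a (ln f')`. -/
def conformalOneForm (f : ℝ → ℝ) (Q : Comp₁) (g : Comp₂) (Γ : Comp₃) : Comp₁ := fun x a =>
  Q x a - grad (scalarField f g Γ) x a

/-- The source `M̃_ab(Q̃) = Q̃_a Q̃_b - ∇̃_(a Q̃_b) + g̃_ab (∇̃^c Q̃_c - Q̃²)` built from a metric, a
connection and a one-form (to be used with the transformed ones). -/
def conformalSource (g : Comp₂) (Γ : Comp₃) (Q : Comp₁) : Comp₂ := fun x a b =>
  Q x a * Q x b - symPart (covDeriv Γ Q) x a b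
    + g x a b * (contract g (covDeriv Γ Q) x - inner₁ g Q Q x)

/-- The potential `½ (f'(R))⁻² (R f'(R) - f(R))` as a function of the scalar curvature. -/
def potential (f : ℝ → ℝ) (R : ℝ) : ℝ := (1 / 2) * ((deriv f R) ^ 2)⁻¹ * (R * deriv f R - f R)

/-- The potential `V(φ)` as a function of `φ = ln f'`: `R` is replaced by `φ` through the inverse
function of `f'`. -/
def scalarPotential (f : ℝ → ℝ) (φ : ℝ) : ℝ :=
  potential f (Function.invFun (deriv f) (Real.exp φ))

/-- The stress-energy tensor of the standard conformal equivalence,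
`(3/2) (∇_a φ ∇_b φ - ½ g_ab g^cd ∇_c φ ∇_d φ)`, i.e. that of a minimally coupled massless scalar
`√(3/2) φ`. -/
def kineticSource (g : Comp₂) (φ : Coord → ℝ) : Comp₂ := fun x a b =>
  (3 / 2) * (grad φ x a * grad φ x b - (1 / 2) * g x a b * inner₁ g (grad φ) (grad φ) x)

/-! ### The conformal frame and the equations on the manifold -/

section Frame

variable {M : Type*} [TopologicalSpace M] [ChartedSpace Coord M]

/-- The components of `g̃_ab = f' g_ab` in each chart. -/
def metricT (f : ℝ → ℝ) (g : LorentzMetric M) (Γ : SymmetricConnection M) :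
    OpenPartialHomeomorph M Coord → Comp₂ :=
  fun e => conformalMetric f (g.comp e) (Γ.comp e)

/-- The components of `Q̃_a = Q_a - ∇_a (ln f')` in each chart. -/
def oneFormT (f : ℝ → ℝ) (Q : OneForm M) (g : LorentzMetric M) (Γ : SymmetricConnection M) :
    OpenPartialHomeomorph M Coord → Comp₁ :=
  fun e => conformalOneForm f (Q.comp e) (g.comp e) (Γ.comp e)

/-- The components of the connection `∇̃` of the conformal frame, the Weyl connection of
`(g̃, Q̃)`. -/
def connectionT (f : ℝ → ℝ) (Q : OneForm M) (g : LorentzMetric M) (Γ : SymmetricConnection M) :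
    OpenPartialHomeomorph M Coord → Comp₃ :=
  fun e => weylConnection (metricT f g Γ e) (oneFormT f Q g Γ e)

/-- The components of the Levi-Civita connection of `g`. -/
def leviCivita (g : OpenPartialHomeomorph M Coord → Comp₂) :
    OpenPartialHomeomorph M Coord → Comp₃ :=
  fun e => christoffel (g e)

/-- The scalar field `φ = ln f'` in each chart. -/
def scalarT (f : ℝ → ℝ) (g : LorentzMetric M) (Γ : SymmetricConnection M) :
    OpenPartialHomeomorph M Coord → Coord → ℝ :=
  fun e => scalarField f (g.comp e) (Γ.comp e)

/-- The potential `½ (f')⁻² (R f' - f)` in each chart. -/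
def potentialT (f : ℝ → ℝ) (g : LorentzMetric M) (Γ : SymmetricConnection M) :
    OpenPartialHomeomorph M Coord → Coord → ℝ :=
  fun e x => potential f (scalarCurvature (g.comp e) (Γ.comp e) x)

/-- `Γ` is the Weyl connection of `(g, Q)`. -/
def WeylConstraint (Q : OneForm M) (g : LorentzMetric M) (Γ : SymmetricConnection M) : Prop :=
  TensorEq₃ Γ.comp (fun e => weylConnection (g.comp e) (Q.comp e))

/-- `Λ_c^ab = δ_c^(b (Q^a) f' - ∇^a) f') - g^ab (Q_c f' - ∇_c f')`. -/
def MultiplierEq (f : ℝ → ℝ) (Q : OneForm M) (g : LorentzMetric M) (Γ : SymmetricConnection M)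
    (Λ : Multiplier M) : Prop :=
  TensorEq₃ Λ.comp (fun e => multiplierValue f (Q.comp e) (g.comp e) (Γ.comp e))

end Frame

end

end WeylFR

open WeylFR

/-!
The proof is chart by chart. In a coordinate domain the variations are smooth and vanish outside a
compact set `K` on which `det g < 0`, so for small `ε` the varied density is smooth jointly in `ε`
and the coordinates (`SmoothFamilyAt.lagrangianDensity`); hence the action is differentiable at
`ε = 0`, with derivative `∫_K δL` for the explicit pointwise variation `δL = densityVariation`
(`hasDerivAt_setIntegral_of_contDiffAt`, `hasDerivAt_lagrangianDensity`).

Varying the multipliers alone, the fundamental lemma of the calculus of variations gives the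
constraint, i.e. `Γ` is the Weyl connection of `(g, Q)`. It implies `∇_c g^ab = Q_c g^ab` and
`∇_c √(-g) = -2 Q_c √(-g)`, which evaluate all partial derivatives of the densities `√(-g) f' g^ab`
and `√(-g) P^c g^ab`, where `P_a = Q_a f' - ∇_a f'`. With them
`δL = √(-g) (Λ - Λ₀)·(γ - δW) - √(-g) h_ab E^ab + ∂_c J^c` (`IsFieldOn.densityVariation_eq`), where
`Λ₀` is the asserted value of the multipliers, `δW` the variation of the Weyl connection, `E = 0` the
asserted metric equation, and `J` a current that vanishes outside `K`. The divergence integrates to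
zero, so stationarity is equivalent to the constraint, `Λ = Λ₀` and `E = 0`
(`IsFieldOn.isStationaryOn_iff`).

The Weyl connection does not change under `g ↦ f' g`, `Q ↦ Q - d ln f'`
(`IsMetricOn.weylConnection_smul`), so on passing to the conformal frame the curvature stays the same
and `E` is divided by `f'` (`IsFieldOn.fieldOperator_sub_weylSource_conformal`). For `Q = 0` the
Levi-Civita connection of `f' g` is, by the same invariance, the Weyl connection of `(g, d ln f')`,
whose Ricci tensor is computed in `IsMetricOn.ricci_add_weylDifference`; this gives the standard
conformal equivalence (`IsFieldOn.fieldOperator_kinetic`). The potential is a function of `φ` because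
`f'` is injective by Rolle's theorem when `f''` has no zero.
-/

namespace WeylFR

/-! ### Calculus of determinants and inverse matrices -/

section MatrixCalculus

open Matrix

variable {n : Type*} [Fintype n] [DecidableEq n]

theorem contDiff_det_of : ContDiff ℝ ∞ fun A : n → n → ℝ => (Matrix.of A).det := by
  simp only [Matrix.det_apply]
  refine ContDiff.sum fun σ _ => ContDiff.const_smul _ (contDiff_prod fun i _ => ?_)
  simp only [Matrix.of_apply]
  fun_prop

theorem contDiff_adjugate_of (i j : n) :
    ContDiff ℝ ∞ fun A : n → n → ℝ => (Matrix.of A).adjugate i j := by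
  simp only [Matrix.adjugate_apply]
  refine contDiff_det_of.comp (g := fun A : n → n → ℝ => (Matrix.of A).det)
    (f := fun A : n → n → ℝ => (Matrix.of A).updateRow j (Pi.single i 1)) ?_
  refine contDiff_pi.2 fun k => contDiff_pi.2 fun l => ?_
  by_cases hk : k = j
  · subst hk; simpa using! contDiff_const
  · simp only [Matrix.updateRow_ne hk, Matrix.of_apply]; fun_prop

theorem contDiffAt_inv_of (i j : n) {A : n → n → ℝ} (hA : (Matrix.of A).det ≠ 0) :
    ContDiffAt ℝ ∞ (fun A : n → n → ℝ => (Matrix.of A)⁻¹ i j) A := by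
  simp only [Matrix.inv_def, Matrix.smul_apply, smul_eq_mul, Ring.inverse_eq_inv']
  exact (contDiff_det_of.contDiffAt.inv hA).mul (contDiff_adjugate_of i j).contDiffAt

variable {E : Type*} [NormedAddCommGroup E] [NormedSpace ℝ E] {A : E → Matrix n n ℝ} {x : E}

theorem ContDiffAt.matrix_det {k : ℕ∞} (h : ∀ i j, ContDiffAt ℝ k (fun y => A y i j) x) :
    ContDiffAt ℝ k (fun y => (A y).det) x :=
  (contDiff_det_of.contDiffAt.of_le (by exact_mod_cast le_top)).comp x
    (contDiffAt_pi.2 fun i => contDiffAt_pi.2 fun j => h i j)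

theorem ContDiffAt.matrix_inv {k : ℕ∞} (h : ∀ i j, ContDiffAt ℝ k (fun y => A y i j) x)
    (hA : (A x).det ≠ 0) (i j : n) : ContDiffAt ℝ k (fun y => (A y)⁻¹ i j) x :=
  ((contDiffAt_inv_of i j (A := A x) hA).of_le (by exact_mod_cast le_top)).comp x
    (contDiffAt_pi.2 fun i => contDiffAt_pi.2 fun j => h i j)

theorem hasDerivAt_det_line {A : Matrix n n ℝ} (hA : A.det ≠ 0) (H : Matrix n n ℝ) :
    HasDerivAt (fun r : ℝ => (A + r • H).det) (A.det * (A⁻¹ * H).trace) 0 := by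
  have hu : IsUnit A.det := isUnit_iff_ne_zero.2 hA
  have h1 : ∀ r : ℝ, (A + r • H).det = A.det * (1 + (A⁻¹ * H).trace * r +
      (1 + (Polynomial.X : Polynomial ℝ) • (A⁻¹ * H).map Polynomial.C).det.divX.divX.eval r
        * r ^ 2) := by
    intro r
    rw [← Matrix.det_one_add_smul, ← Matrix.det_mul, Matrix.mul_add, Matrix.mul_one,
      Matrix.mul_smul, Matrix.mul_nonsing_inv_cancel_left _ _ hu]
  simp only [h1]
  have h2 := (Polynomial.hasDerivAt ((1 + (Polynomial.X : Polynomial ℝ) •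
      (A⁻¹ * H).map Polynomial.C).det.divX.divX) 0).mul ((hasDerivAt_id (0 : ℝ)).pow 2)
  have h3 := ((((hasDerivAt_id (0 : ℝ)).const_mul (A⁻¹ * H).trace).const_add 1).add h2).const_mul
    A.det
  refine h3.congr_deriv ?_
  simp

/-- Jacobi's formula. -/
theorem HasDerivAt.matrix_det {A : ℝ → Matrix n n ℝ} {A' : Matrix n n ℝ} {t : ℝ}
    (h : ∀ i j, HasDerivAt (fun r => A r i j) (A' i j) t) (hA : (A t).det ≠ 0) :
    HasDerivAt (fun r => (A r).det) ((A t).det * ((A t)⁻¹ * A').trace) t := by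
  have hd : HasFDerivAt (fun B : n → n → ℝ => (Matrix.of B).det)
      (fderiv ℝ (fun B : n → n → ℝ => (Matrix.of B).det) (A t)) (A t) :=
    (contDiff_det_of.differentiable (by simp)).differentiableAt.hasFDerivAt
  have h1 : HasDerivAt (fun r => (A r).det) _ t :=
    HasFDerivAt.comp_hasDerivAt t (f := fun r => fun i j => A r i j) (f' := fun i j => A' i j)
      (l := fun B : n → n → ℝ => (Matrix.of B).det)
      (l' := fderiv ℝ (fun B : n → n → ℝ => (Matrix.of B).det) (A t)) hd
      (hasDerivAt_pi.2 fun i => hasDerivAt_pi.2 fun j => h i j)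
  have hline : HasDerivAt (fun r : ℝ => fun i j => A t i j + r * A' i j) (fun i j => A' i j) 0 :=
    hasDerivAt_pi.2 fun i => hasDerivAt_pi.2 fun j => by
      simpa using ((hasDerivAt_id (0 : ℝ)).mul_const (A' i j)).const_add (A t i j)
  have h2 : HasDerivAt (fun r : ℝ => (A t + r • A').det) _ 0 :=
    HasFDerivAt.comp_hasDerivAt (0 : ℝ)
      (l := fun B : n → n → ℝ => (Matrix.of B).det)
      (l' := fderiv ℝ (fun B : n → n → ℝ => (Matrix.of B).det) (A t))
      (f := fun r : ℝ => fun i j => A t i j + r * A' i j)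
      (by simpa only [zero_mul, add_zero] using! hd) hline
  rw [← h2.unique (hasDerivAt_det_line hA A')]
  exact h1

theorem HasDerivAt.matrix_inv {A : ℝ → Matrix n n ℝ} {A' : Matrix n n ℝ} {t : ℝ}
    (h : ∀ i j, HasDerivAt (fun r => A r i j) (A' i j) t) (hA : (A t).det ≠ 0) (i j : n) :
    HasDerivAt (fun r => (A r)⁻¹ i j) (-((A t)⁻¹ * A' * (A t)⁻¹) i j) t := by
  have hd : ∀ i j, DifferentiableAt ℝ (fun r => (A r)⁻¹ i j) t := fun i j =>
    (((contDiffAt_inv_of i j (A := A t) hA).differentiableAt (by simp)).comp t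
      (f := fun r => fun i j => A r i j)
      (hasDerivAt_pi.2 fun i => hasDerivAt_pi.2 fun j => h i j).differentiableAt :)
  set B : Matrix n n ℝ := Matrix.of fun i j => deriv (fun r => (A r)⁻¹ i j) t with hB
  have hev : ∀ᶠ r in nhds t, (A r).det ≠ 0 :=
    (HasDerivAt.matrix_det h hA).continuousAt.eventually_ne hA
  have key : B * A t + (A t)⁻¹ * A' = 0 := by
    ext i j
    have h1 : HasDerivAt (fun r => ((A r)⁻¹ * A r) i j) ((B * A t + (A t)⁻¹ * A') i j) t := by
      simp only [Matrix.mul_apply, Matrix.add_apply, ← Finset.sum_add_distrib]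
      exact HasDerivAt.fun_sum fun k _ => (hd i k).hasDerivAt.mul (h k j)
    have h2 : HasDerivAt (fun r => ((A r)⁻¹ * A r) i j) 0 t := by
      refine (hasDerivAt_const t ((1 : Matrix n n ℝ) i j)).congr_of_eventuallyEq ?_
      filter_upwards [hev] with r hr
      rw [Matrix.nonsing_inv_mul _ (isUnit_iff_ne_zero.2 hr)]
    simpa using h1.unique h2
  have hBe : B = -((A t)⁻¹ * A' * (A t)⁻¹) := by
    have := congrArg (· * (A t)⁻¹) key
    simp only [Matrix.add_mul, Matrix.zero_mul,
      Matrix.mul_nonsing_inv_cancel_right _ _ (isUnit_iff_ne_zero.2 hA)] at this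
    exact eq_neg_of_add_eq_zero_left this
  have := (hd i j).hasDerivAt
  rwa [show deriv (fun r => (A r)⁻¹ i j) t = B i j from rfl, hBe] at this

end MatrixCalculus

/-! ### Partial derivatives -/

section PartialDerivatives

variable {u v : Coord → ℝ} {x : Coord} {a : Fin 4}

/-- A partial derivative is the derivative along a coordinate line; this gives access to the
one-variable calculus. -/
theorem hasDerivAt_pd (hu : DifferentiableAt ℝ u x) (a : Fin 4) :
    HasDerivAt (fun t : ℝ => u (x + t • EuclideanSpace.single a 1)) (pd a u x) 0 := by
  have h := hu.hasFDerivAt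
  refine HasFDerivAt.comp_hasDerivAt (0 : ℝ) (f := fun t : ℝ => x + t • EuclideanSpace.single a 1)
    (l := u) (l' := fderiv ℝ u x) (f' := EuclideanSpace.single a 1) (by simpa using h) ?_
  simpa using ((hasDerivAt_id (0 : ℝ)).smul_const
    (EuclideanSpace.single a (1 : ℝ) : Coord)).const_add x

theorem pd_eq_of_hasDerivAt {w : ℝ} (hu : DifferentiableAt ℝ u x)
    (h : HasDerivAt (fun t : ℝ => u (x + t • EuclideanSpace.single a 1)) w 0) : pd a u x = w :=
  (hasDerivAt_pd hu a).unique h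

theorem pd_congr (h : u =ᶠ[nhds x] v) : pd a u x = pd a v x := by
  simp only [pd, h.fderiv_eq]

theorem pd_congr_on {U : Set Coord} (hU : IsOpen U) (h : ∀ y ∈ U, u y = v y) (hx : x ∈ U) :
    pd a u x = pd a v x :=
  pd_congr (Filter.eventually_of_mem (hU.mem_nhds hx) h)

@[simp] theorem pd_const (c : ℝ) : pd a (fun _ => c) x = 0 := by simp [pd]

theorem pd_add (hu : DifferentiableAt ℝ u x) (hv : DifferentiableAt ℝ v x) :
    pd a (fun y => u y + v y) x = pd a u x + pd a v x := by
  simp [pd, fderiv_fun_add hu hv]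

theorem pd_sub (hu : DifferentiableAt ℝ u x) (hv : DifferentiableAt ℝ v x) :
    pd a (fun y => u y - v y) x = pd a u x - pd a v x := by
  simp [pd, fderiv_fun_sub hu hv]

theorem pd_mul (hu : DifferentiableAt ℝ u x) (hv : DifferentiableAt ℝ v x) :
    pd a (fun y => u y * v y) x = pd a u x * v x + u x * pd a v x := by
  simp [pd, fderiv_fun_mul hu hv]; ring

theorem pd_const_mul (c : ℝ) (hu : DifferentiableAt ℝ u x) :
    pd a (fun y => c * u y) x = c * pd a u x := by
  simp [pd, fderiv_const_mul hu]

theorem pd_sum {ι : Type*} {s : Finset ι} {u : ι → Coord → ℝ}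
    (hu : ∀ i ∈ s, DifferentiableAt ℝ (u i) x) :
    pd a (fun y => ∑ i ∈ s, u i y) x = ∑ i ∈ s, pd a (u i) x := by
  simp [pd, fderiv_fun_sum hu]

theorem pd_log (hu : DifferentiableAt ℝ u x) (h0 : u x ≠ 0) :
    pd a (fun y => Real.log (u y)) x = (u x)⁻¹ * pd a u x := by
  simp [pd, fderiv.log hu h0]

theorem ContDiffAt.pd {k m : ℕ∞} (hu : ContDiffAt ℝ k u x) (h : m + 1 ≤ k) :
    ContDiffAt ℝ m (pd a u) x := by
  have := hu.fderiv_right (m := m) (by exact_mod_cast h)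
  exact this.clm_apply contDiffAt_const

theorem ContDiff.pd (hu : ContDiff ℝ ∞ u) (a : Fin 4) : ContDiff ℝ ∞ (pd a u) :=
  contDiff_iff_contDiffAt.2 fun _ => ContDiffAt.pd (k := ⊤) (m := ⊤) hu.contDiffAt le_top

/-- Partial derivatives commute. -/
theorem pd_comm (hu : ContDiffAt ℝ ∞ u x) (a b : Fin 4) : pd a (pd b u) x = pd b (pd a u) x := by
  have hd : DifferentiableAt ℝ (fderiv ℝ u) x :=
    (hu.fderiv_right (m := 1) (by norm_cast)).differentiableAt (by simp)
  have hs := hu.isSymmSndFDerivAt (by simp; norm_cast)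
  have key : ∀ a b : Fin 4, WeylFR.pd a (WeylFR.pd b u) x =
      fderiv ℝ (fderiv ℝ u) x (EuclideanSpace.single a 1) (EuclideanSpace.single b 1) := by
    intro a b
    unfold WeylFR.pd
    rw [fderiv_clm_apply hd (differentiableAt_const _)]
    simp
  rw [key, key, hs.eq]

end PartialDerivatives

/-! ### Integrals over coordinate regions -/

section Integrals

open MeasureTheory Set

variable {U K : Set Coord}

/-- Differentiation under the integral sign over a compact set. The integrand needs to be
continuously differentiable only near the slice `ε = 0`, which is what is available for a density
that degenerates when the varied metric does. -/
theorem hasDerivAt_setIntegral_of_contDiffAt (hK : IsCompact K) {F : ℝ → Coord → ℝ}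
    {F' : Coord → ℝ} (hF : ∀ x ∈ K, ContDiffAt ℝ 1 (fun p : ℝ × Coord => F p.1 p.2) (0, x))
    (hF' : ∀ x ∈ K, HasDerivAt (fun ε => F ε x) (F' x) 0) :
    IntegrableOn F' K ∧ HasDerivAt (fun ε => ∫ x in K, F ε x) (∫ x in K, F' x) 0 := by
  set G : ℝ × Coord → ℝ := fun p => F p.1 p.2 with hG
  set N : Set (ℝ × Coord) := {p | ContDiffAt ℝ 1 G p} with hN
  have hNo : IsOpen N := isOpen_iff_eventually.2 fun p hp =>
    ContDiffAt.eventually (n := 1) (f := G) hp (by simp)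
  have hsub : ({0} : Set ℝ) ×ˢ K ⊆ N := by
    rintro ⟨ε, x⟩ ⟨hε, hx⟩
    obtain rfl : ε = 0 := hε
    exact hF x hx
  obtain ⟨u, v, hu, -, h0u, hKv, huv⟩ := generalized_tube_lemma isCompact_singleton hK hNo hsub
  obtain ⟨δ, hδ, hδu⟩ := Metric.nhds_basis_closedBall.mem_iff.1 (hu.mem_nhds (h0u rfl))
  have hmem : ∀ ε ∈ Metric.closedBall (0 : ℝ) δ, ∀ x ∈ K, ContDiffAt ℝ 1 G (ε, x) :=
    fun ε hε x hx => huv ⟨hδu hε, hKv hx⟩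
  set D : ℝ → Coord → ℝ := fun ε x => fderiv ℝ G (ε, x) (1, 0) with hD
  have hDcont : ContinuousOn (fun p : ℝ × Coord => D p.1 p.2) (Metric.closedBall (0 : ℝ) δ ×ˢ K) :=
    fun p hp => (((hmem p.1 hp.1 p.2 hp.2).fderiv_right (m := 0) (by simp)).continuousAt.clm_apply
      continuousAt_const).continuousWithinAt
  obtain ⟨C, hC⟩ := ((isCompact_closedBall (0 : ℝ) δ).prod hK).exists_bound_of_continuousOn hDcont
  have hderiv : ∀ ε ∈ Metric.closedBall (0 : ℝ) δ, ∀ x ∈ K,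
      HasDerivAt (fun ε => F ε x) (D ε x) ε := fun ε hε x hx => by
    have h1 := ((hmem ε hε x hx).differentiableAt (by simp)).hasFDerivAt
    exact h1.comp_hasDerivAt ε (f := fun ε : ℝ => (ε, x))
      ((hasDerivAt_id ε).prodMk (hasDerivAt_const ε x))
  have hcont : ∀ ε ∈ Metric.closedBall (0 : ℝ) δ, ContinuousOn (F ε) K := fun ε hε x hx =>
    ((hmem ε hε x hx).continuousAt.comp (f := fun x : Coord => (ε, x)) (by fun_prop)
      : ContinuousAt (F ε) x).continuousWithinAt
  have h00 : (0 : ℝ) ∈ Metric.closedBall (0 : ℝ) δ := Metric.mem_closedBall_self hδ.le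
  have hD0 : ∀ x ∈ K, F' x = D 0 x := fun x hx => (hF' x hx).unique (hderiv 0 h00 x hx)
  rw [setIntegral_congr_fun hK.measurableSet hD0, integrableOn_congr_fun hD0 hK.measurableSet]
  refine hasDerivAt_integral_of_dominated_loc_of_deriv_le (Metric.ball_mem_nhds (0 : ℝ) hδ)
    (bound := fun _ => C) ?_ ((hcont 0 h00).integrableOn_compact hK) ?_ ?_
    (integrableOn_const hK.measure_ne_top) ?_
  · filter_upwards [Metric.ball_mem_nhds (0 : ℝ) hδ] with ε hε
    exact (hcont ε (Metric.ball_subset_closedBall hε)).aestronglyMeasurable hK.measurableSet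
  · refine ContinuousOn.aestronglyMeasurable ?_ hK.measurableSet
    exact hDcont.comp (f := fun x : Coord => ((0 : ℝ), x)) (by fun_prop) fun x hx => ⟨h00, hx⟩
  · filter_upwards [ae_restrict_mem hK.measurableSet] with x hx ε hε
    exact hC (ε, x) ⟨Metric.ball_subset_closedBall hε, hx⟩
  · filter_upwards [ae_restrict_mem hK.measurableSet] with x hx ε hε
    exact hderiv ε (Metric.ball_subset_closedBall hε) x hx

theorem contDiff_of_contDiffOn_of_vanish (hU : IsOpen U) (hK : IsCompact K) (hKU : K ⊆ U)
    {J : Coord → ℝ} (hJ : ContDiffOn ℝ ∞ J U) (h0 : ∀ x ∉ K, J x = 0) : ContDiff ℝ ∞ J := by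
  refine contDiff_iff_contDiffAt.2 fun x => ?_
  by_cases hx : x ∈ K
  · exact hJ.contDiffAt (hU.mem_nhds (hKU hx))
  · exact (contDiffAt_const (c := (0 : ℝ))).congr_of_eventuallyEq
      (Filter.eventually_of_mem (hK.isClosed.isOpen_compl.mem_nhds hx) h0)

theorem pd_eq_zero_of_vanish (hK : IsCompact K) {J : Coord → ℝ} (h0 : ∀ x ∉ K, J x = 0)
    {x : Coord} (hx : x ∉ K) (a : Fin 4) : pd a J x = 0 := by
  rw [pd_congr_on hK.isClosed.isOpen_compl h0 hx, pd_const]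

/-- The integral of a divergence of a compactly supported current vanishes, component by
component. -/
theorem setIntegral_pd_eq_zero (hK : IsCompact K) {J : Coord → ℝ} (hJ : ContDiff ℝ ∞ J)
    (h0 : ∀ x ∉ K, J x = 0) (a : Fin 4) : ∫ x in K, pd a J x = 0 := by
  rw [setIntegral_eq_integral_of_forall_compl_eq_zero fun x hx => pd_eq_zero_of_vanish hK h0 hx a]
  have hs : HasCompactSupport J := HasCompactSupport.intro hK h0
  have hs' : HasCompactSupport (pd a J) :=
    HasCompactSupport.intro hK fun x hx => pd_eq_zero_of_vanish hK h0 hx a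
  have h := integral_mul_fderiv_eq_neg_fderiv_mul_of_integrable (μ := volume)
    (f := fun _ : Coord => (1 : ℝ)) (g := J) (v := EuclideanSpace.single a (1 : ℝ)) (by simp)
    (by simpa using! (hJ.pd a).continuous.integrable_of_hasCompactSupport hs')
    (by simpa using hJ.continuous.integrable_of_hasCompactSupport hs) (by simp)
    (fun x _ => (hJ.differentiable (by simp)).differentiableAt)
  simpa using! h

/-- The fundamental lemma of the calculus of variations. -/
theorem eq_zero_of_forall_setIntegral_mul_eq_zero (hU : IsOpen U) {u : Coord → ℝ}
    (hu : ContinuousOn u U)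
    (h : ∀ K, IsCompact K → K ⊆ U → ∀ φ : Coord → ℝ, ContDiff ℝ ∞ φ → (∀ x ∉ K, φ x = 0) →
      ∫ x in K, φ x * u x = 0) : ∀ x ∈ U, u x = 0 := by
  have h1 := hU.ae_eq_zero_of_integral_contDiff_smul_eq_zero (μ := volume)
    (hu.locallyIntegrableOn hU.measurableSet) fun φ hφ hs hsU => by
      have h2 := h _ hs.isCompact hsU φ hφ fun x hx => image_eq_zero_of_notMem_tsupport hx
      rwa [setIntegral_eq_integral_of_forall_compl_eq_zero fun x hx => by
        rw [image_eq_zero_of_notMem_tsupport hx, zero_mul]] at h2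
  have h2 : u =ᵐ[volume.restrict U] fun _ => 0 := (ae_restrict_iff' hU.measurableSet).2 h1
  exact Measure.eqOn_open_of_ae_eq h2 hU hu continuousOn_const

end Integrals

/-! ### Smooth one-parameter families of fields -/

section Families

/-- A one-parameter family `u ε` of functions is jointly smooth in the parameter and the
coordinates near `ε = 0` and the point `x`. -/
def SmoothFamilyAt (u : ℝ → Coord → ℝ) (x : Coord) : Prop :=
  ContDiffAt ℝ ∞ (fun p : ℝ × Coord => u p.1 p.2) (0, x)

namespace SmoothFamilyAt

variable {u v : ℝ → Coord → ℝ} {x : Coord}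

theorem of_const {u : Coord → ℝ} (hu : ContDiffAt ℝ ∞ u x) : SmoothFamilyAt (fun _ => u) x :=
  ContDiffAt.comp (𝕜 := ℝ) (f := fun p : ℝ × Coord => p.2) (g := u) (0, x) hu contDiffAt_snd

theorem const (c : ℝ) : SmoothFamilyAt (fun _ _ => c) x := contDiffAt_const

theorem add (hu : SmoothFamilyAt u x) (hv : SmoothFamilyAt v x) :
    SmoothFamilyAt (fun ε y => u ε y + v ε y) x := ContDiffAt.add hu hv

theorem sub (hu : SmoothFamilyAt u x) (hv : SmoothFamilyAt v x) :
    SmoothFamilyAt (fun ε y => u ε y - v ε y) x := ContDiffAt.sub hu hv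

theorem mul (hu : SmoothFamilyAt u x) (hv : SmoothFamilyAt v x) :
    SmoothFamilyAt (fun ε y => u ε y * v ε y) x := ContDiffAt.mul hu hv

theorem sum {ι : Type*} {s : Finset ι} {u : ι → ℝ → Coord → ℝ}
    (hu : ∀ i, SmoothFamilyAt (u i) x) : SmoothFamilyAt (fun ε y => ∑ i ∈ s, u i ε y) x :=
  ContDiffAt.sum fun i _ => hu i

theorem affine {u v : Coord → ℝ} (hu : ContDiffAt ℝ ∞ u x) (hv : ContDiffAt ℝ ∞ v x) :
    SmoothFamilyAt (fun ε y => u y + ε * v y) x :=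
  (of_const hu).add (ContDiffAt.mul contDiffAt_fst (of_const hv))

/-- A member of a jointly smooth family is smooth; so smoothness of a single field is the case of
a constant family. -/
theorem contDiffAt (hu : SmoothFamilyAt u x) : ContDiffAt ℝ ∞ (u 0) x :=
  ContDiffAt.comp (𝕜 := ℝ) (f := fun y : Coord => ((0 : ℝ), y))
    (g := fun p : ℝ × Coord => u p.1 p.2) x hu (contDiffAt_const.prodMk contDiffAt_id)

theorem comp {φ : ℝ → ℝ} (hu : SmoothFamilyAt u x) (hφ : ContDiffAt ℝ ∞ φ (u 0 x)) :
    SmoothFamilyAt (fun ε y => φ (u ε y)) x :=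
  ContDiffAt.comp (𝕜 := ℝ) (f := fun p : ℝ × Coord => u p.1 p.2) (g := φ) (0, x) hφ hu

theorem pd (hu : SmoothFamilyAt u x) (a : Fin 4) : SmoothFamilyAt (fun ε => pd a (u ε)) x := by
  have h : ContDiffAt ℝ ∞ (fun p : ℝ × Coord => fderiv ℝ (u p.1) p.2) (0, x) := by
    refine ContDiffAt.fderiv (n := ∞) (f := fun (p : ℝ × Coord) (y : Coord) => u p.1 y)
      (g := fun p : ℝ × Coord => p.2) ?_ contDiffAt_snd (by simp)
    exact ContDiffAt.comp (𝕜 := ℝ) (f := fun q : (ℝ × Coord) × Coord => (q.1.1, q.2))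
      (g := fun p : ℝ × Coord => u p.1 p.2) ((0, x), x) hu (by fun_prop)
  exact h.clm_apply contDiffAt_const

variable {g : ℝ → Comp₂} {Q : ℝ → Comp₁} {Γ : ℝ → Comp₃}

theorem det (hg : ∀ a b, SmoothFamilyAt (fun ε y => g ε y a b) x) :
    SmoothFamilyAt (fun ε y => (g ε y).det) x :=
  ContDiffAt.matrix_det (k := ⊤) (A := fun p : ℝ × Coord => g p.1 p.2) hg

theorem inv (hg : ∀ a b, SmoothFamilyAt (fun ε y => g ε y a b) x) (h0 : (g 0 x).det ≠ 0)
    (a b : Fin 4) : SmoothFamilyAt (fun ε y => (g ε y)⁻¹ a b) x :=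
  ContDiffAt.matrix_inv (k := ⊤) (A := fun p : ℝ × Coord => g p.1 p.2) hg h0 a b

theorem christoffel (hg : ∀ a b, SmoothFamilyAt (fun ε y => g ε y a b) x) (h0 : (g 0 x).det ≠ 0)
    (c a b : Fin 4) : SmoothFamilyAt (fun ε y => christoffel (g ε) y c a b) x :=
  (const _).mul (sum fun d => (inv hg h0 c d).mul
    ((((hg a d).pd b).add ((hg d b).pd a)).sub ((hg a b).pd d)))

theorem weylDifference (hg : ∀ a b, SmoothFamilyAt (fun ε y => g ε y a b) x)
    (h0 : (g 0 x).det ≠ 0) (hQ : ∀ a, SmoothFamilyAt (fun ε y => Q ε y a) x)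
    (c a b : Fin 4) : SmoothFamilyAt (fun ε y => weylDifference (g ε) (Q ε) y c a b) x :=
  (const _).mul (sum fun d => (inv hg h0 c d).mul
    ((((hQ b).mul (hg a d)).add ((hQ a).mul (hg d b))).sub ((hQ d).mul (hg a b))))

theorem ricci (hΓ : ∀ c a b, SmoothFamilyAt (fun ε y => Γ ε y c a b) x) (a b : Fin 4) :
    SmoothFamilyAt (fun ε y => ricci (Γ ε) y a b) x :=
  (sum fun c => ((hΓ c a b).pd c).sub ((hΓ c a c).pd b)).add
    (sum fun c => sum fun d => ((hΓ c c d).mul (hΓ d a b)).sub ((hΓ c b d).mul (hΓ d a c)))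

theorem scalarCurvature (hg : ∀ a b, SmoothFamilyAt (fun ε y => g ε y a b) x)
    (h0 : (g 0 x).det ≠ 0) (hΓ : ∀ c a b, SmoothFamilyAt (fun ε y => Γ ε y c a b) x) :
    SmoothFamilyAt (fun ε y => scalarCurvature (g ε) (Γ ε) y) x :=
  sum fun a => sum fun b => (inv hg h0 a b).mul (ricci hΓ a b)

theorem sqrt_neg_det (hg : ∀ a b, SmoothFamilyAt (fun ε y => g ε y a b) x)
    (h0 : (g 0 x).det < 0) : SmoothFamilyAt (fun ε y => √(-(g ε y).det)) x :=
  ContDiffAt.sqrt (ContDiffAt.neg (det hg)) (by simpa using h0.ne)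

theorem lagrangianDensity {f : ℝ → ℝ} (hf : ContDiff ℝ ∞ f) {Λ : ℝ → Comp₃}
    (hg : ∀ a b, SmoothFamilyAt (fun ε y => g ε y a b) x) (h0 : (g 0 x).det < 0)
    (hQ : ∀ a, SmoothFamilyAt (fun ε y => Q ε y a) x)
    (hΓ : ∀ c a b, SmoothFamilyAt (fun ε y => Γ ε y c a b) x)
    (hΛ : ∀ c a b, SmoothFamilyAt (fun ε y => Λ ε y c a b) x) :
    SmoothFamilyAt (fun ε => lagrangianDensity f (Q ε) (g ε) (Γ ε) (Λ ε)) x :=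
  (sqrt_neg_det hg h0).mul (((scalarCurvature hg h0.ne hΓ).comp hf.contDiffAt).add
    (sum fun c => sum fun a => sum fun b => (hΛ c a b).mul
      (((hΓ c a b).sub (christoffel hg h0.ne c a b)).sub (weylDifference hg h0.ne hQ c a b))))

end SmoothFamilyAt

end Families

/-! ### The first variation of the Lagrangian density -/

section FirstVariation

noncomputable section

/-- The Weyl connection with its upper index lowered, up to a factor two:
`∂_b g_ad + ∂_a g_db - ∂_d g_ab + Q_b g_ad + Q_a g_db - Q_d g_ab`. It is linear in `g`. -/
def weylLower (g : Comp₂) (Q : Comp₁) : Comp₃ := fun x d a b =>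
  pd b (fun y => g y a d) x + pd a (fun y => g y d b) x - pd d (fun y => g y a b) x
    + (Q x b * g x a d + Q x a * g x d b - Q x d * g x a b)

/-- The variation of the Ricci tensor of `Γ` along `γ`. -/
def ricciVariation (Γ γ : Comp₃) : Comp₂ := fun x a b =>
  (∑ c, (pd c (fun y => γ y c a b) x - pd b (fun y => γ y c a c) x)) +
    ∑ c, ∑ d, (γ x c c d * Γ x d a b + Γ x c c d * γ x d a b
      - γ x c b d * Γ x d a c - Γ x c b d * γ x d a c)

/-- The variation of the Weyl connection of `(g, Q)` along the metric variation `h`. -/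
def weylVariation (g : Comp₂) (Q : Comp₁) (h : Comp₂) : Comp₃ := fun x c a b =>
  (1 / 2) * ∑ d, (-((g x)⁻¹ * h x * (g x)⁻¹) c d * weylLower g Q x d a b
    + (g x)⁻¹ c d * weylLower h Q x d a b)

/-- The variation of the scalar curvature `g^ab R_ab(Γ)` along `(h, γ)`. -/
def scalarVariation (g : Comp₂) (Γ : Comp₃) (h : Comp₂) (γ : Comp₃) (x : Coord) : ℝ :=
  ∑ a, ∑ b, (-((g x)⁻¹ * h x * (g x)⁻¹) a b * ricci Γ x a b
    + (g x)⁻¹ a b * ricciVariation Γ γ x a b)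

/-- The variation of the Lagrangian density along `(h, γ, μ)`. -/
def densityVariation (f : ℝ → ℝ) (Q : Comp₁) (g : Comp₂) (Γ Λ : Comp₃) (h : Comp₂) (γ μ : Comp₃)
    (x : Coord) : ℝ :=
  √(-(g x).det) * ((1 / 2) * ((g x)⁻¹ * h x).trace) * (f (scalarCurvature g Γ x) +
      ∑ c, ∑ a, ∑ b, Λ x c a b * (Γ x c a b - christoffel g x c a b - weylDifference g Q x c a b))
    + √(-(g x).det) * (fPrime f g Γ x * scalarVariation g Γ h γ x +
      ∑ c, ∑ a, ∑ b, (μ x c a b *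
          (Γ x c a b - christoffel g x c a b - weylDifference g Q x c a b)
        + Λ x c a b * (γ x c a b - weylVariation g Q h x c a b)))

variable {f : ℝ → ℝ} {Q : Comp₁} {g h : Comp₂} {Γ γ Λ μ : Comp₃} {x : Coord}

theorem weylConnection_eq_weylLower (g : Comp₂) (Q : Comp₁) (x : Coord) (c a b : Fin 4) :
    weylConnection g Q x c a b = (1 / 2) * ∑ d, (g x)⁻¹ c d * weylLower g Q x d a b := by
  simp only [weylConnection, christoffel, weylDifference, weylLower, mul_add, Finset.sum_add_distrib]

theorem pd_affine {u v : Coord → ℝ} (hu : DifferentiableAt ℝ u x) (hv : DifferentiableAt ℝ v x)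
    (ε : ℝ) (a : Fin 4) : pd a (fun y => u y + ε * v y) x = pd a u x + ε * pd a v x := by
  rw [pd_add hu (hv.const_mul ε), pd_const_mul ε hv]

theorem hasDerivAt_affine (u v : ℝ) : HasDerivAt (fun ε : ℝ => u + ε * v) v 0 := by
  simpa using ((hasDerivAt_id (0 : ℝ)).mul_const v).const_add u

theorem hasDerivAt_inv_affine (A H : Matrix (Fin 4) (Fin 4) ℝ) (hA : A.det ≠ 0) (a b : Fin 4) :
    HasDerivAt (fun ε : ℝ => (A + ε • H)⁻¹ a b) (-(A⁻¹ * H * A⁻¹) a b) 0 := by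
  have := HasDerivAt.matrix_inv (A := fun ε : ℝ => A + ε • H) (A' := H) (t := 0)
    (fun i j => by simpa using hasDerivAt_affine (A i j) (H i j)) (by simpa using hA) a b
  simpa using this

theorem hasDerivAt_sqrt_neg_det {A : ℝ → Matrix (Fin 4) (Fin 4) ℝ} {A' : Matrix (Fin 4) (Fin 4) ℝ}
    {t : ℝ} (h : ∀ i j, HasDerivAt (fun r => A r i j) (A' i j) t) (hA : (A t).det < 0) :
    HasDerivAt (fun r => √(-(A r).det)) (√(-(A t).det) * ((1 / 2) * ((A t)⁻¹ * A').trace)) t := by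
  have h1 := (HasDerivAt.matrix_det h hA.ne).neg.sqrt (by simpa using hA.ne)
  refine h1.congr_deriv ?_
  have h2 : 0 < √(-(A t).det) := Real.sqrt_pos.2 (by linarith)
  have h3 : √(-(A t).det) * √(-(A t).det) = -(A t).det := Real.mul_self_sqrt (by linarith)
  simp only [Pi.neg_apply]
  rw [div_eq_iff (by positivity)]
  linear_combination (-((A t)⁻¹ * A').trace) * h3

theorem hasDerivAt_ricci (hΓ : ∀ c a b, DifferentiableAt ℝ (fun y => Γ y c a b) x)
    (hγ : ∀ c a b, DifferentiableAt ℝ (fun y => γ y c a b) x) (a b : Fin 4) :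
    HasDerivAt (fun ε : ℝ => ricci (fun y => Γ y + ε • γ y) x a b)
      (ricciVariation Γ γ x a b) 0 := by
  simp only [ricci, Pi.add_apply, Pi.smul_apply, smul_eq_mul, ricciVariation]
  refine HasDerivAt.fun_add (HasDerivAt.fun_sum fun c _ => ?_)
    (HasDerivAt.fun_sum fun c _ => HasDerivAt.fun_sum fun d _ => ?_)
  · simp only [pd_affine (hΓ _ _ _) (hγ _ _ _)]
    exact (hasDerivAt_affine _ _).sub (hasDerivAt_affine _ _)
  · refine (((hasDerivAt_affine (Γ x c c d) (γ x c c d)).mul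
      (hasDerivAt_affine (Γ x d a b) (γ x d a b))).sub
      ((hasDerivAt_affine (Γ x c b d) (γ x c b d)).mul
        (hasDerivAt_affine (Γ x d a c) (γ x d a c)))).congr_deriv ?_
    ring

theorem hasDerivAt_weylConnection (hg : ∀ a b, DifferentiableAt ℝ (fun y => g y a b) x)
    (hh : ∀ a b, DifferentiableAt ℝ (fun y => h y a b) x) (h0 : (g x).det ≠ 0) (c a b : Fin 4) :
    HasDerivAt (fun ε : ℝ => weylConnection (fun y => g y + ε • h y) Q x c a b)
      (weylVariation g Q h x c a b) 0 := by
  simp only [weylConnection_eq_weylLower, weylVariation]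
  refine (HasDerivAt.fun_sum fun d _ => ?_).const_mul _
  have h1 : ∀ ε : ℝ, weylLower (fun y => g y + ε • h y) Q x d a b =
      weylLower g Q x d a b + ε * weylLower h Q x d a b := by
    intro ε
    simp only [weylLower, Matrix.add_apply, Matrix.smul_apply, smul_eq_mul,
      pd_affine (hg _ _) (hh _ _)]
    ring
  simp only [h1]
  refine ((hasDerivAt_inv_affine (g x) (h x) h0 c d).mul (hasDerivAt_affine _ _)).congr_deriv ?_
  simp

theorem hasDerivAt_scalarCurvature (hΓ : ∀ c a b, DifferentiableAt ℝ (fun y => Γ y c a b) x)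
    (hγ : ∀ c a b, DifferentiableAt ℝ (fun y => γ y c a b) x) (h0 : (g x).det ≠ 0) :
    HasDerivAt (fun ε : ℝ => scalarCurvature (fun y => g y + ε • h y) (fun y => Γ y + ε • γ y) x)
      (scalarVariation g Γ h γ x) 0 := by
  simp only [scalarCurvature, scalarVariation]
  refine HasDerivAt.fun_sum fun a _ => HasDerivAt.fun_sum fun b _ => ?_
  refine ((hasDerivAt_inv_affine (g x) (h x) h0 a b).mul (hasDerivAt_ricci hΓ hγ a b)).congr_deriv ?_
  simp

theorem hasDerivAt_lagrangianDensity (hf : Differentiable ℝ f)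
    (hg : ∀ a b, DifferentiableAt ℝ (fun y => g y a b) x)
    (hh : ∀ a b, DifferentiableAt ℝ (fun y => h y a b) x) (h0 : (g x).det < 0)
    (hΓ : ∀ c a b, DifferentiableAt ℝ (fun y => Γ y c a b) x)
    (hγ : ∀ c a b, DifferentiableAt ℝ (fun y => γ y c a b) x) :
    HasDerivAt (fun ε : ℝ => lagrangianDensity f Q (fun y => g y + ε • h y)
      (fun y => Γ y + ε • γ y) (fun y => Λ y + ε • μ y) x)
      (densityVariation f Q g Γ Λ h γ μ x) 0 := by
  have hs : HasDerivAt (fun ε : ℝ => √(-(g x + ε • h x).det))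
      (√(-(g x).det) * ((1 / 2) * ((g x)⁻¹ * h x).trace)) 0 := by
    simpa using hasDerivAt_sqrt_neg_det (A := fun ε : ℝ => g x + ε • h x) (A' := h x) (t := 0)
      (fun i j => by simpa using hasDerivAt_affine (g x i j) (h x i j)) (by simpa using h0)
  have hR := hasDerivAt_scalarCurvature (h := h) hΓ hγ h0.ne
  have hfR := ((hf (scalarCurvature (fun y => g y + (0 : ℝ) • h y)
    (fun y => Γ y + (0 : ℝ) • γ y) x)).hasDerivAt).comp (0 : ℝ) hR
  have hC : HasDerivAt (fun ε : ℝ => ∑ c, ∑ a, ∑ b, (Λ x + ε • μ x) c a b *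
      ((Γ x + ε • γ x) c a b - christoffel (fun y => g y + ε • h y) x c a b
        - weylDifference (fun y => g y + ε • h y) Q x c a b))
      (∑ c, ∑ a, ∑ b, (μ x c a b *
          (Γ x c a b - christoffel g x c a b - weylDifference g Q x c a b)
        + Λ x c a b * (γ x c a b - weylVariation g Q h x c a b))) 0 := by
    refine HasDerivAt.fun_sum fun c _ => HasDerivAt.fun_sum fun a _ =>
      HasDerivAt.fun_sum fun b _ => ?_
    simp only [sub_sub]
    refine ((hasDerivAt_affine (Λ x c a b) (μ x c a b)).mul
      ((hasDerivAt_affine (Γ x c a b) (γ x c a b)).sub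
        (hasDerivAt_weylConnection (Q := Q) hg hh h0.ne c a b))).congr_deriv ?_
    simp [weylConnection]
  refine (hs.mul (hfR.add hC)).congr_deriv ?_
  simp [densityVariation, fPrime]

end

end FirstVariation

/-! ### Weyl compatibility in a coordinate domain -/

section Compatibility

open Matrix

/-- A smooth nondegenerate metric of negative determinant and a smooth one-form on the open set
`U` of coordinates. -/
structure IsMetricOn (U : Set Coord) (g : Comp₂) (Q : Comp₁) : Prop where
  isOpen : IsOpen U
  smooth_metric : ∀ a b, ContDiffOn ℝ ∞ (fun x => g x a b) U
  smooth_oneForm : ∀ a, ContDiffOn ℝ ∞ (fun x => Q x a) U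
  symm : ∀ x ∈ U, ∀ a b, g x a b = g x b a
  det_neg : ∀ x ∈ U, (g x).det < 0

namespace IsMetricOn

variable {U : Set Coord} {g : Comp₂} {Q : Comp₁} {x : Coord}

theorem metric_at (H : IsMetricOn U g Q) (hx : x ∈ U) (a b : Fin 4) :
    ContDiffAt ℝ ∞ (fun y => g y a b) x := (H.smooth_metric a b).contDiffAt (H.isOpen.mem_nhds hx)

theorem oneForm_at (H : IsMetricOn U g Q) (hx : x ∈ U) (a : Fin 4) :
    ContDiffAt ℝ ∞ (fun y => Q y a) x := (H.smooth_oneForm a).contDiffAt (H.isOpen.mem_nhds hx)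

theorem inv_at (H : IsMetricOn U g Q) (hx : x ∈ U) (a b : Fin 4) :
    ContDiffAt ℝ ∞ (fun y => (g y)⁻¹ a b) x :=
  ContDiffAt.matrix_inv (k := ⊤) (H.metric_at hx) (H.det_neg x hx).ne a b

theorem isUnit_det (H : IsMetricOn U g Q) (hx : x ∈ U) : IsUnit (g x).det :=
  isUnit_iff_ne_zero.2 (H.det_neg x hx).ne

theorem transpose (H : IsMetricOn U g Q) (hx : x ∈ U) : (g x)ᵀ = g x := by
  ext a b; exact (H.symm x hx a b).symm

theorem inv_symm (H : IsMetricOn U g Q) (hx : x ∈ U) (a b : Fin 4) :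
    (g x)⁻¹ a b = (g x)⁻¹ b a := by
  have h : ((g x)⁻¹)ᵀ = (g x)⁻¹ := by rw [Matrix.transpose_nonsing_inv, H.transpose hx]
  exact congrFun (congrFun h b) a

theorem sqrt_pos (H : IsMetricOn U g Q) (hx : x ∈ U) : 0 < √(-(g x).det) :=
  Real.sqrt_pos.2 (by linarith [H.det_neg x hx])

theorem sqrt_at (H : IsMetricOn U g Q) (hx : x ∈ U) :
    ContDiffAt ℝ ∞ (fun y => √(-(g y).det)) x :=
  (SmoothFamilyAt.sqrt_neg_det (g := fun _ => g)
    (fun a b => SmoothFamilyAt.of_const (H.metric_at hx a b)) (H.det_neg x hx)).contDiffAt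

theorem weylConnection_at (H : IsMetricOn U g Q) (hx : x ∈ U) (c a b : Fin 4) :
    ContDiffAt ℝ ∞ (fun y => weylConnection g Q y c a b) x :=
  ((SmoothFamilyAt.christoffel (g := fun _ => g)
    (fun a b => SmoothFamilyAt.of_const (H.metric_at hx a b)) (H.det_neg x hx).ne c a b).add
    (SmoothFamilyAt.weylDifference (g := fun _ => g) (Q := fun _ => Q)
    (fun a b => SmoothFamilyAt.of_const (H.metric_at hx a b)) (H.det_neg x hx).ne
    (fun a => SmoothFamilyAt.of_const (H.oneForm_at hx a)) c a b)).contDiffAt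

theorem pd_metric_symm (H : IsMetricOn U g Q) (hx : x ∈ U) (c a b : Fin 4) :
    pd c (fun y => g y a b) x = pd c (fun y => g y b a) x :=
  pd_congr_on H.isOpen (fun y hy => H.symm y hy a b) hx

theorem weylLower_symm (H : IsMetricOn U g Q) (hx : x ∈ U) (d a b : Fin 4) :
    weylLower g Q x d a b = weylLower g Q x d b a := by
  simp only [weylLower]
  rw [H.pd_metric_symm hx b a d, H.pd_metric_symm hx a d b, H.pd_metric_symm hx d a b,
    H.symm x hx a d, H.symm x hx d b, H.symm x hx a b]
  ring

theorem weylConnection_symm (H : IsMetricOn U g Q) (hx : x ∈ U) (c a b : Fin 4) :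
    weylConnection g Q x c a b = weylConnection g Q x c b a := by
  simp only [weylConnection_eq_weylLower, H.weylLower_symm hx _ a b]

theorem sum_metric_mul_weylConnection (H : IsMetricOn U g Q) (hx : x ∈ U) (e a b : Fin 4) :
    ∑ c, g x e c * weylConnection g Q x c a b = (1 / 2) * weylLower g Q x e a b := by
  have h := congrFun (congrArg (fun A => A *ᵥ fun d => weylLower g Q x d a b)
    (Matrix.mul_nonsing_inv _ (H.isUnit_det hx))) e
  simp only [← Matrix.mulVec_mulVec, Matrix.one_mulVec] at h
  rw [← h]
  simp only [weylConnection_eq_weylLower, Matrix.mulVec, dotProduct, Finset.mul_sum]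
  refine Finset.sum_congr rfl fun c _ => Finset.sum_congr rfl fun d _ => by ring

/-- The Weyl connection satisfies `∇_b g_ae = - Q_b g_ae`. -/
theorem pd_metric (H : IsMetricOn U g Q) (hx : x ∈ U) (b a e : Fin 4) :
    pd b (fun y => g y a e) x = ∑ c, g x e c * weylConnection g Q x c a b +
      ∑ c, g x a c * weylConnection g Q x c e b - Q x b * g x a e := by
  rw [H.sum_metric_mul_weylConnection hx, H.sum_metric_mul_weylConnection hx]
  simp only [weylLower]
  rw [H.pd_metric_symm hx b e a, H.pd_metric_symm hx e a b, H.pd_metric_symm hx a e b,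
    H.symm x hx e a, H.symm x hx a b, H.symm x hx e b]
  ring

/-- `∂_c g` as a matrix, with `N = (Γ^k_fc)`. -/
theorem pd_metric_matrix (H : IsMetricOn U g Q) (hx : x ∈ U) (c : Fin 4) :
    (Matrix.of fun a e => pd c (fun y => g y a e) x) =
      (Matrix.of fun k f => weylConnection g Q x k f c)ᵀ * g x +
        g x * (Matrix.of fun k f => weylConnection g Q x k f c) - Q x c • g x := by
  ext a e
  simp only [Matrix.of_apply, Matrix.sub_apply, Matrix.add_apply, Matrix.mul_apply,
    Matrix.transpose_apply, Matrix.smul_apply, smul_eq_mul]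
  rw [H.pd_metric hx]
  congr 2
  exact Finset.sum_congr rfl fun k _ => by rw [H.symm x hx e k]; ring

/-- The Weyl connection satisfies `∇_c g^ab = Q_c g^ab`. -/
theorem pd_inv (H : IsMetricOn U g Q) (hx : x ∈ U) (c a b : Fin 4) :
    pd c (fun y => (g y)⁻¹ a b) x = Q x c * (g x)⁻¹ a b
      - ∑ d, weylConnection g Q x a c d * (g x)⁻¹ d b
      - ∑ d, weylConnection g Q x b c d * (g x)⁻¹ a d := by
  have h := HasDerivAt.matrix_inv (t := 0)
    (A := fun t : ℝ => g (x + t • EuclideanSpace.single c 1))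
    (A' := Matrix.of fun a e => pd c (fun y => g y a e) x)
    (fun i j => hasDerivAt_pd ((H.metric_at hx i j).differentiableAt (by simp)) c)
    (by simpa using (H.det_neg x hx).ne) a b
  rw [pd_eq_of_hasDerivAt ((H.inv_at hx a b).differentiableAt (by simp)) h]
  simp only [zero_smul, add_zero]
  rw [H.pd_metric_matrix hx, Matrix.mul_sub, Matrix.mul_add, Matrix.sub_mul, Matrix.add_mul,
    ← Matrix.mul_assoc, Matrix.mul_nonsing_inv_cancel_right _ _ (H.isUnit_det hx),
    Matrix.nonsing_inv_mul_cancel_left _ _ (H.isUnit_det hx), Matrix.mul_smul,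
    Matrix.nonsing_inv_mul _ (H.isUnit_det hx), Matrix.smul_mul, Matrix.one_mul]
  simp only [Matrix.sub_apply, Matrix.add_apply, Matrix.mul_apply, Matrix.transpose_apply,
    Matrix.of_apply, Matrix.smul_apply, smul_eq_mul, H.weylConnection_symm hx _ _ c]
  rw [Finset.sum_congr rfl fun k _ => mul_comm ((g x)⁻¹ a k) _]
  ring

/-- The volume density satisfies `∇_c √(-g) = - 2 Q_c √(-g)`. -/
theorem pd_sqrt (H : IsMetricOn U g Q) (hx : x ∈ U) (c : Fin 4) :
    pd c (fun y => √(-(g y).det)) x =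
      √(-(g x).det) * (∑ d, weylConnection g Q x d c d - 2 * Q x c) := by
  have h := hasDerivAt_sqrt_neg_det (t := 0)
    (A := fun t : ℝ => g (x + t • EuclideanSpace.single c 1))
    (A' := Matrix.of fun a e => pd c (fun y => g y a e) x)
    (fun i j => hasDerivAt_pd ((H.metric_at hx i j).differentiableAt (by simp)) c)
    (by simpa using H.det_neg x hx)
  rw [pd_eq_of_hasDerivAt ((H.sqrt_at hx).differentiableAt (by simp)) h]
  simp only [zero_smul, add_zero]
  rw [H.pd_metric_matrix hx, Matrix.mul_sub, Matrix.mul_add,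
    Matrix.nonsing_inv_mul_cancel_left _ _ (H.isUnit_det hx), Matrix.mul_smul,
    Matrix.nonsing_inv_mul _ (H.isUnit_det hx), Matrix.trace_sub, Matrix.trace_add,
    Matrix.trace_mul_comm, Matrix.mul_nonsing_inv_cancel_right _ _ (H.isUnit_det hx),
    Matrix.trace_transpose, Matrix.trace_smul, Matrix.trace_one]
  simp only [Matrix.trace, Matrix.diag_apply, Matrix.of_apply, H.weylConnection_symm hx _ _ c,
    smul_eq_mul, Fintype.card_fin]
  push_cast
  ring

/-- The coordinate derivative of the vector `η^c = g^cd η_d`. -/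
theorem pd_raise (H : IsMetricOn U g Q) (hx : x ∈ U) {η : Comp₁}
    (hη : ∀ a, DifferentiableAt ℝ (fun y => η y a) x) (e c : Fin 4) :
    pd e (fun y => ∑ d, (g y)⁻¹ c d * η y d) x = Q x e * ∑ d, (g x)⁻¹ c d * η x d
      - ∑ d, weylConnection g Q x c e d * ∑ k, (g x)⁻¹ d k * η x k
      + ∑ k, (g x)⁻¹ c k * covDeriv (weylConnection g Q) η x e k := by
  have hi := fun d => (H.inv_at hx c d).differentiableAt (by simp)
  rw [pd_sum fun d _ => (hi d).fun_mul (hη d)]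
  simp only [fun d => pd_mul (a := e) (hi d) (hη d), H.pd_inv hx, covDeriv, Fin.sum_univ_four]
  ring

theorem sum_inv_mul_metric (H : IsMetricOn U g Q) (hx : x ∈ U) :
    ∑ a, ∑ b, (g x)⁻¹ a b * g x a b = 4 := by
  have h := congrArg Matrix.trace (Matrix.nonsing_inv_mul _ (H.isUnit_det hx))
  rw [Matrix.trace_one, Fintype.card_fin] at h
  simp only [Matrix.trace, Matrix.diag_apply, Matrix.mul_apply] at h
  rw [show (4 : ℝ) = ((4 : ℕ) : ℝ) by norm_num, ← h]
  exact Finset.sum_congr rfl fun a _ => Finset.sum_congr rfl fun b _ => by rw [H.symm x hx a b]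

end IsMetricOn

end Compatibility

/-! ### Index algebra at a point -/

section IndexAlgebra

variable {G h : Fin 4 → Fin 4 → ℝ} {Γ γ : Fin 4 → Fin 4 → Fin 4 → ℝ}

set_option maxHeartbeats 1000000 in
/-- The Palatini identity at a point: the contracted variation of the Ricci tensor is, up to a
divergence, the contraction of `γ` with minus the multiplier. Here `dγ e c a b` stands for
`∂_e γ^c_ab`, and `dA` for the derivative of the density `√(-g) f' g^ab`, already evaluated by Weyl
compatibility. -/
theorem palatini_algebra (s F : ℝ) (dγ : Fin 4 → Fin 4 → Fin 4 → Fin 4 → ℝ) (Q dF V : Fin 4 → ℝ)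
    (dA : Fin 4 → Fin 4 → Fin 4 → ℝ) (hG : ∀ a b, G a b = G b a)
    (hΓ : ∀ c a b, Γ c a b = Γ c b a) (hγ : ∀ c a b, γ c a b = γ c b a)
    (hV : ∀ a, V a = ∑ d, G a d * (Q d * F - dF d))
    (hdA : ∀ c a b, dA c a b = (s * (∑ d, Γ d c d - 2 * Q c) * F + s * dF c) * G a b +
      s * F * (Q c * G a b - ∑ d, Γ a c d * G d b - ∑ d, Γ b c d * G a d)) :
    s * F * ∑ a, ∑ b, G a b * ((∑ c, (dγ c c a b - dγ b c a c)) +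
        ∑ c, ∑ d, (γ c c d * Γ d a b + Γ c c d * γ d a b - γ c b d * Γ d a c - Γ c b d * γ d a c))
      + s * ∑ c, ∑ a, ∑ b, ((1 / 2) * ((if c = b then V a else 0) + (if c = a then V b else 0))
        - G a b * (Q c * F - dF c)) * γ c a b =
    ∑ c, (∑ a, ∑ b, (dA c a b * γ c a b + s * F * G a b * dγ c c a b)
      - ∑ a, ∑ b, (dA c a c * γ b a b + s * F * G a c * dγ c b a b)) := by
  -- Symmetry rewrites each lower-triangular component to the upper one, so that both sides are
  -- polynomials in independent components.
  have a1 := hG 1 0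
  have a2 := hG 2 0
  have a3 := hG 3 0
  have a4 := hG 2 1
  have a5 := hG 3 1
  have a6 := hG 3 2
  have b1 := fun c => hΓ c 1 0
  have b2 := fun c => hΓ c 2 0
  have b3 := fun c => hΓ c 3 0
  have b4 := fun c => hΓ c 2 1
  have b5 := fun c => hΓ c 3 1
  have b6 := fun c => hΓ c 3 2
  have c1 := fun c => hγ c 1 0
  have c2 := fun c => hγ c 2 0
  have c3 := fun c => hγ c 3 0
  have c4 := fun c => hγ c 2 1
  have c5 := fun c => hγ c 3 1
  have c6 := fun c => hγ c 3 2
  simp [hdA, hV, Fin.sum_univ_four, a1, a2, a3, a4, a5, a6, b1, b2, b3, b4, b5, b6,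
    c1, c2, c3, c4, c5, c6]
  ring

/-- Contraction of the multiplier with `½ g^cd M_dab`. -/
theorem multiplier_contraction_algebra (P V : Fin 4 → ℝ) (M : Fin 4 → Fin 4 → Fin 4 → ℝ)
    (hG : ∀ a b, G a b = G b a) (hM : ∀ d a b, M d a b = M d b a)
    (hV : ∀ a, V a = ∑ d, G a d * P d) :
    ∑ c, ∑ a, ∑ b, ((1 / 2) * ((if c = b then V a else 0) + (if c = a then V b else 0))
        - G a b * P c) * ((1 / 2) * ∑ d, G c d * M d a b) =
      (1 / 2) * ∑ a, ∑ b, ∑ d, V a * G b d * M d a b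
        - (1 / 2) * ∑ a, ∑ b, ∑ d, G a b * V d * M d a b := by
  -- Symmetry rewrites each lower-triangular component to the upper one, so that both sides are
  -- polynomials in independent components.
  have a1 := hG 1 0
  have a2 := hG 2 0
  have a3 := hG 3 0
  have a4 := hG 2 1
  have a5 := hG 3 1
  have a6 := hG 3 2
  have b1 := fun c => hM c 1 0
  have b2 := fun c => hM c 2 0
  have b3 := fun c => hM c 3 0
  have b4 := fun c => hM c 2 1
  have b5 := fun c => hM c 3 1
  have b6 := fun c => hM c 3 2
  simp [hV, Fin.sum_univ_four, a1, a2, a3, a4, a5, a6, b1, b2, b3, b4, b5, b6]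
  ring

/-- Integration by parts at a point, for the part of the metric variation that comes from the
constraint. Here `dh c a b` stands for `∂_c h_ab`, `V` for the vector `P^a`, `N c a` for
`∇_c P^a` up to the weight of the metric, and `dB c` for the derivative along `x^c` of the density
`√(-g) P^d g^ab`. -/
theorem metric_variation_algebra (s : ℝ) (Q V : Fin 4 → ℝ) (N : Fin 4 → Fin 4 → ℝ)
    (dh : Fin 4 → Fin 4 → Fin 4 → ℝ) (dB : Fin 4 → Fin 4 → Fin 4 → Fin 4 → ℝ)
    (hG : ∀ a b, G a b = G b a) (hh : ∀ a b, h a b = h b a) (hΓ : ∀ c a b, Γ c a b = Γ c b a)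
    (hdh : ∀ c a b, dh c a b = dh c b a)
    (hdB : ∀ e c a b, dB e c a b = s * (∑ d, Γ d e d - 2 * Q e) * (V c * G a b)
      + s * ((Q e * V c - ∑ d, Γ c e d * V d + N e c) * G a b
        + V c * (Q e * G a b - ∑ d, Γ a e d * G d b - ∑ d, Γ b e d * G a d))) :
    s * ((1 / 2) * ∑ a, ∑ b, ∑ d, V a * G b d *
          (dh b a d + dh a d b - dh d a b + (Q b * h a d + Q a * h d b - Q d * h a b)
            - 2 * ∑ e, h d e * Γ e a b)
        - (1 / 2) * ∑ a, ∑ b, ∑ d, G a b * V d *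
          (dh b a d + dh a d b - dh d a b + (Q b * h a d + Q a * h d b - Q d * h a b)
            - 2 * ∑ e, h d e * Γ e a b)) =
      ∑ c, (∑ a, ∑ b, (dB c c a b * h a b + s * (V c * G a b) * dh c a b)
        - ∑ a, ∑ b, (dB c a b c * h a b + s * (V a * G b c) * dh c a b))
      - s * (((∑ c, N c c) - ∑ c, Q c * V c) * ∑ a, ∑ b, G a b * h a b
        - ∑ a, ∑ b, ∑ c, G b c * (N c a - Q c * V a) * h a b) := by
  -- Symmetry rewrites each lower-triangular component to the upper one, so that both sides are
  -- polynomials in independent components.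
  have a1 := hG 1 0
  have a2 := hG 2 0
  have a3 := hG 3 0
  have a4 := hG 2 1
  have a5 := hG 3 1
  have a6 := hG 3 2
  have b1 := fun c => hΓ c 1 0
  have b2 := fun c => hΓ c 2 0
  have b3 := fun c => hΓ c 3 0
  have b4 := fun c => hΓ c 2 1
  have b5 := fun c => hΓ c 3 1
  have b6 := fun c => hΓ c 3 2
  have c1 := fun c => hdh c 1 0
  have c2 := fun c => hdh c 2 0
  have c3 := fun c => hdh c 3 0
  have c4 := fun c => hdh c 2 1
  have c5 := fun c => hdh c 3 1
  have c6 := fun c => hdh c 3 2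
  have d1 := hh 1 0
  have d2 := hh 2 0
  have d3 := hh 3 0
  have d4 := hh 2 1
  have d5 := hh 3 1
  have d6 := hh 3 2
  simp only [hdB, Fin.sum_univ_four, a1, a2, a3, a4, a5, a6, b1, b2, b3, b4, b5, b6,
    c1, c2, c3, c4, c5, c6, d1, d2, d3, d4, d5, d6]
  ring

end IndexAlgebra

/-! ### The field equations in terms of the momentum one-form -/

section Momentum

open Matrix

noncomputable section

/-- The one-form `P_a = Q_a f' - ∇_a f'` from which the multipliers are built. -/
def momentum (f : ℝ → ℝ) (Q : Comp₁) (g : Comp₂) (Γ : Comp₃) : Comp₁ := fun x a =>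
  Q x a * fPrime f g Γ x - grad (fPrime f g Γ) x a

/-- The vector field `P^a = g^ad P_d`. -/
def momentumUp (f : ℝ → ℝ) (Q : Comp₁) (g : Comp₂) (Γ : Comp₃) : Comp₁ := fun x a =>
  ∑ d, (g x)⁻¹ a d * momentum f Q g Γ x d

theorem multiplierValue_eq (f : ℝ → ℝ) (Q : Comp₁) (g : Comp₂) (Γ : Comp₃) (x : Coord)
    (c a b : Fin 4) : multiplierValue f Q g Γ x c a b =
      (1 / 2) * ((if c = b then momentumUp f Q g Γ x a else 0)
        + (if c = a then momentumUp f Q g Γ x b else 0)) - (g x)⁻¹ a b * momentum f Q g Γ x c := rfl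

/-- A smooth metric, one-form and symmetric connection on the open set `U` of coordinates, together
with a smooth Lagrangian function. -/
structure IsFieldOn (U : Set Coord) (f : ℝ → ℝ) (Q : Comp₁) (g : Comp₂) (Γ : Comp₃) : Prop
    extends IsMetricOn U g Q where
  smooth_lagrangian : ContDiff ℝ ∞ f
  smooth_connection : ∀ c a b, ContDiffOn ℝ ∞ (fun x => Γ x c a b) U
  symm_connection : ∀ x ∈ U, ∀ c a b, Γ x c a b = Γ x c b a

namespace IsFieldOn

variable {U : Set Coord} {f : ℝ → ℝ} {Q : Comp₁} {g : Comp₂} {Γ : Comp₃} {x : Coord}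

theorem connection_at (H : IsFieldOn U f Q g Γ) (hx : x ∈ U) (c a b : Fin 4) :
    ContDiffAt ℝ ∞ (fun y => Γ y c a b) x :=
  (H.smooth_connection c a b).contDiffAt (H.isOpen.mem_nhds hx)

theorem fPrime_at (H : IsFieldOn U f Q g Γ) (hx : x ∈ U) : ContDiffAt ℝ ∞ (fPrime f g Γ) x := by
  have h1 : ContDiffAt ℝ ∞ (scalarCurvature g Γ) x :=
    (SmoothFamilyAt.scalarCurvature (g := fun _ => g) (Γ := fun _ => Γ)
      (fun a b => .of_const (H.metric_at hx a b)) (H.det_neg x hx).ne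
      (fun c a b => .of_const (H.connection_at hx c a b))).contDiffAt
  have h2 : ContDiff ℝ ∞ (deriv f) := (contDiff_infty_iff_deriv.1 H.smooth_lagrangian).2
  exact h2.contDiffAt.comp x h1

theorem grad_at (H : IsFieldOn U f Q g Γ) (hx : x ∈ U) (a : Fin 4) :
    ContDiffAt ℝ ∞ (fun y => grad (fPrime f g Γ) y a) x :=
  ContDiffAt.pd (k := ⊤) (m := ⊤) (H.fPrime_at hx) le_top

theorem momentum_at (H : IsFieldOn U f Q g Γ) (hx : x ∈ U) (a : Fin 4) :
    ContDiffAt ℝ ∞ (fun y => momentum f Q g Γ y a) x :=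
  ((H.oneForm_at hx a).mul (H.fPrime_at hx)).sub (H.grad_at hx a)

theorem momentumUp_at (H : IsFieldOn U f Q g Γ) (hx : x ∈ U) (a : Fin 4) :
    ContDiffAt ℝ ∞ (fun y => momentumUp f Q g Γ y a) x :=
  ContDiffAt.sum fun d _ => (H.inv_at hx a d).mul (H.momentum_at hx d)

theorem hessian_symm (H : IsFieldOn U f Q g Γ) (hx : x ∈ U) (a b : Fin 4) :
    hessian Γ (fPrime f g Γ) x a b = hessian Γ (fPrime f g Γ) x b a := by
  simp only [hessian, covDeriv, grad, H.symm_connection x hx _ a b]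
  rw [show pd a (fun y => pd b (fPrime f g Γ) y) x = pd b (fun y => pd a (fPrime f g Γ) y) x from
    pd_comm (H.fPrime_at hx) a b]

theorem covDeriv_momentum (H : IsFieldOn U f Q g Γ) (hx : x ∈ U) (a b : Fin 4) :
    covDeriv Γ (momentum f Q g Γ) x a b = fPrime f g Γ x * covDeriv Γ Q x a b
      + Q x b * grad (fPrime f g Γ) x a - hessian Γ (fPrime f g Γ) x a b := by
  simp only [covDeriv, momentum, hessian]
  rw [pd_sub (((H.oneForm_at hx b).mul (H.fPrime_at hx)).differentiableAt (by simp))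
      ((H.grad_at hx b).differentiableAt (by simp)),
    pd_mul ((H.oneForm_at hx b).differentiableAt (by simp))
      ((H.fPrime_at hx).differentiableAt (by simp))]
  have : ∑ c, Γ x c a b * (Q x c * fPrime f g Γ x - grad (fPrime f g Γ) x c) =
      fPrime f g Γ x * ∑ c, Γ x c a b * Q x c - ∑ c, Γ x c a b * grad (fPrime f g Γ) x c := by
    rw [Finset.mul_sum, ← Finset.sum_sub_distrib]
    exact Finset.sum_congr rfl fun c _ => by ring
  rw [this]
  simp only [grad]
  ring

/-- The metric field equation, written with `Z_ab = ∇_a P_b - Q_a P_b`. -/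
theorem fieldOperator_sub_weylSource (H : IsFieldOn U f Q g Γ) (hx : x ∈ U) (a b : Fin 4) :
    fieldOperator f g Γ x a b - weylSource f Q g Γ x a b =
      fPrime f g Γ x * symPart (ricci Γ) x a b - (1 / 2) * f (scalarCurvature g Γ x) * g x a b
      + (1 / 2) * ((covDeriv Γ (momentum f Q g Γ) x a b - Q x a * momentum f Q g Γ x b)
        + (covDeriv Γ (momentum f Q g Γ) x b a - Q x b * momentum f Q g Γ x a))
      - g x a b * ∑ c, ∑ d, (g x)⁻¹ c d *
        (covDeriv Γ (momentum f Q g Γ) x c d - Q x c * momentum f Q g Γ x d) := by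
  have hswap : ∑ c, ∑ d, (g x)⁻¹ c d * (Q x d * grad (fPrime f g Γ) x c) =
      inner₁ g Q (grad (fPrime f g Γ)) x := by
    rw [inner₁, Finset.sum_comm]
    exact Finset.sum_congr rfl fun d _ => Finset.sum_congr rfl fun c _ => by
      rw [H.inv_symm hx c d]; ring
  have hsum : ∑ c, ∑ d, (g x)⁻¹ c d *
        (covDeriv Γ (momentum f Q g Γ) x c d - Q x c * momentum f Q g Γ x d) =
      fPrime f g Γ x * contract g (covDeriv Γ Q) x + 2 * inner₁ g Q (grad (fPrime f g Γ)) x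
        - contract g (hessian Γ (fPrime f g Γ)) x - inner₁ g Q Q x * fPrime f g Γ x := by
    rw [two_mul, ← add_assoc]
    nth_rewrite 1 [← hswap]
    simp only [contract, inner₁, Finset.mul_sum, Finset.sum_mul, ← Finset.sum_add_distrib,
      ← Finset.sum_sub_distrib]
    exact Finset.sum_congr rfl fun c _ => Finset.sum_congr rfl fun d _ => by
      rw [H.covDeriv_momentum hx, momentum]; ring
  rw [hsum, H.covDeriv_momentum hx, H.covDeriv_momentum hx, H.hessian_symm hx b a]
  simp only [fieldOperator, weylSource, momentum, symPart]
  ring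

end IsFieldOn

end

end Momentum

/-! ### Integration by parts in the first variation -/

section Stationarity

open Matrix

/-- The part of the metric variation that needs no integration by parts combines with the terms
left over from it to `h_ab E^ab`, where `E_cd` is the metric field equation. Here `D c e` stands
for `∇_c P_e`. -/
theorem metric_field_algebra {G h g Ric D : Fin 4 → Fin 4 → ℝ} {Q P V : Fin 4 → ℝ}
    {N E : Fin 4 → Fin 4 → ℝ} (s F k : ℝ)
    (hG : ∀ a b, G a b = G b a) (hh : ∀ a b, h a b = h b a)
    (hg : ∀ a b, ∑ c, ∑ d, G a c * G b d * g c d = G a b)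
    (hV : ∀ a, V a = ∑ e, G a e * P e) (hN : ∀ c a, N c a = ∑ e, G a e * D c e)
    (hE : ∀ a b, E a b = F * ((1 / 2) * (Ric a b + Ric b a)) - (1 / 2) * k * g a b
      + (1 / 2) * ((D a b - Q a * P b) + (D b a - Q b * P a))
      - g a b * ∑ c, ∑ d, G c d * (D c d - Q c * P d)) :
    s * ((1 / 2) * ∑ a, ∑ b, G a b * h a b) * k
      + s * F * ∑ a, ∑ b, -(∑ c, ∑ d, G a c * h c d * G d b) * Ric a b
      + s * (((∑ c, N c c) - ∑ c, Q c * V c) * ∑ a, ∑ b, G a b * h a b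
        - ∑ a, ∑ b, ∑ c, G b c * (N c a - Q c * V a) * h a b) =
    -(s * ∑ a, ∑ b, h a b * ∑ c, ∑ d, G a c * G b d * E c d) := by
  set t := ∑ c, ∑ d, G c d * (D c d - Q c * P d) with ht
  have h1 : ∀ a b, ∑ c, ∑ d, G a c * G b d * E c d =
      ∑ c, ∑ d, G a c * G b d * (F * ((1 / 2) * (Ric c d + Ric d c))
        + (1 / 2) * ((D c d - Q c * P d) + (D d c - Q d * P c))) - ((1 / 2) * k + t) * G a b := by
    intro a b
    rw [← hg a b, Finset.mul_sum, ← Finset.sum_sub_distrib]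
    refine Finset.sum_congr rfl fun c _ => ?_
    rw [Finset.mul_sum, ← Finset.sum_sub_distrib]
    exact Finset.sum_congr rfl fun d _ => by rw [hE]; ring
  have h2 : (∑ c, N c c) - ∑ c, Q c * V c = t := by
    rw [ht, ← Finset.sum_sub_distrib]
    refine Finset.sum_congr rfl fun c _ => ?_
    rw [hN, hV, Finset.mul_sum, ← Finset.sum_sub_distrib]
    exact Finset.sum_congr rfl fun d _ => by ring
  have h3 : ∀ a b, ∑ c, G b c * (N c a - Q c * V a) =
      ∑ c, ∑ d, G b c * G a d * (D c d - Q c * P d) := by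
    intro a b
    refine Finset.sum_congr rfl fun c _ => ?_
    rw [hN, hV, Finset.mul_sum, ← Finset.sum_sub_distrib, Finset.mul_sum]
    exact Finset.sum_congr rfl fun d _ => by ring
  have h4 : ∑ a, ∑ b, ∑ c, G b c * (N c a - Q c * V a) * h a b =
      ∑ a, ∑ b, h a b * ∑ c, ∑ d, G b c * G a d * (D c d - Q c * P d) := by
    simp only [← h3, Finset.sum_mul, mul_comm (h _ _)]
  rw [h2, h4]
  simp only [h1]
  clear_value t
  clear h1 h2 h3 h4 hE hN hV hg
  generalize hZ : (fun c d => D c d - Q c * P d) = Z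
  simp only [fun c d => show D c d - Q c * P d = Z c d from congrFun (congrFun hZ c) d]
  -- Symmetry rewrites each lower-triangular component to the upper one, so that both sides are
  -- polynomials in independent components.
  have a1 := hG 1 0
  have a2 := hG 2 0
  have a3 := hG 3 0
  have a4 := hG 2 1
  have a5 := hG 3 1
  have a6 := hG 3 2
  have d1 := hh 1 0
  have d2 := hh 2 0
  have d3 := hh 3 0
  have d4 := hh 2 1
  have d5 := hh 3 1
  have d6 := hh 3 2
  simp only [Fin.sum_univ_four, a1, a2, a3, a4, a5, a6, d1, d2, d3, d4, d5, d6]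
  ring

theorem pd_sum_sum_mul {x : Coord} {u v : Fin 4 → Fin 4 → Coord → ℝ}
    (hu : ∀ a b, DifferentiableAt ℝ (u a b) x) (hv : ∀ a b, DifferentiableAt ℝ (v a b) x)
    (c : Fin 4) : pd c (fun y => ∑ a, ∑ b, u a b y * v a b y) x =
      ∑ a, ∑ b, (pd c (u a b) x * v a b x + u a b x * pd c (v a b) x) := by
  rw [pd_sum fun a _ => DifferentiableAt.fun_sum fun b _ => (hu a b).fun_mul (hv a b)]
  refine Finset.sum_congr rfl fun a _ => ?_
  rw [pd_sum fun b _ => (hu a b).fun_mul (hv a b)]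
  exact Finset.sum_congr rfl fun b _ => pd_mul (hu a b) (hv a b)

noncomputable section

/-- The current `√(-g) f' (g^ab γ^c_ab - g^ac γ^b_ab)` of the connection variation. -/
def connectionCurrent (f : ℝ → ℝ) (g : Comp₂) (Γ γ : Comp₃) (c : Fin 4) (y : Coord) : ℝ :=
  ∑ a, ∑ b, √(-(g y).det) * fPrime f g Γ y * (g y)⁻¹ a b * γ y c a b
    - ∑ a, ∑ b, √(-(g y).det) * fPrime f g Γ y * (g y)⁻¹ a c * γ y b a b

/-- The current `√(-g) (P^c g^ab h_ab - P^a g^bc h_ab)` of the metric variation. -/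
def metricCurrent (f : ℝ → ℝ) (Q : Comp₁) (g : Comp₂) (Γ : Comp₃) (h : Comp₂)
    (c : Fin 4) (y : Coord) : ℝ :=
  ∑ a, ∑ b, √(-(g y).det) * (momentumUp f Q g Γ y c * (g y)⁻¹ a b) * h y a b
    - ∑ a, ∑ b, √(-(g y).det) * (momentumUp f Q g Γ y a * (g y)⁻¹ b c) * h y a b

namespace IsFieldOn

variable {U K : Set Coord} {f : ℝ → ℝ} {Q : Comp₁} {g h : Comp₂} {Γ Λ γ μ : Comp₃} {x : Coord}

theorem weylVariation_eq (H : IsFieldOn U f Q g Γ)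
    (hW : ∀ x ∈ U, ∀ c a b, Γ x c a b = weylConnection g Q x c a b) (hx : x ∈ U) (c a b : Fin 4) :
    weylVariation g Q h x c a b = (1 / 2) * ∑ d, (g x)⁻¹ c d *
      (weylLower h Q x d a b - 2 * ∑ e, h x d e * Γ x e a b) := by
  have h1 : ((g x)⁻¹ * h x * (g x)⁻¹) *ᵥ (fun d => weylLower g Q x d a b) =
      ((g x)⁻¹ * h x) *ᵥ (fun e => 2 * Γ x e a b) := by
    have : (fun d => weylLower g Q x d a b) = g x *ᵥ fun e => 2 * Γ x e a b := by
      ext d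
      have := H.sum_metric_mul_weylConnection hx d a b
      simp only [Matrix.mulVec, dotProduct, hW x hx]
      rw [show ∑ e, g x d e * (2 * weylConnection g Q x e a b) =
        2 * ∑ e, g x d e * weylConnection g Q x e a b by
          rw [Finset.mul_sum]; exact Finset.sum_congr rfl fun _ _ => by ring, this]
      ring
    rw [this, Matrix.mulVec_mulVec, Matrix.nonsing_inv_mul_cancel_right _ _ (H.isUnit_det hx)]
  have h2 : ∑ d, ((g x)⁻¹ * h x * (g x)⁻¹) c d * weylLower g Q x d a b =
      ∑ e, ((g x)⁻¹ * h x) c e * (2 * Γ x e a b) := congrFun h1 c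
  have h3 : ∑ e, ((g x)⁻¹ * h x) c e * (2 * Γ x e a b) =
      ∑ d, (g x)⁻¹ c d * (2 * ∑ e, h x d e * Γ x e a b) := by
    simp only [Matrix.mul_apply, Finset.sum_mul, Finset.mul_sum]
    rw [Finset.sum_comm]
    exact Finset.sum_congr rfl fun d _ => Finset.sum_congr rfl fun e _ => by ring
  simp only [weylVariation, Finset.sum_add_distrib, mul_sub, Finset.sum_sub_distrib, neg_mul,
    Finset.sum_neg_distrib, h2, h3]
  ring

theorem pd_momentumUp (H : IsFieldOn U f Q g Γ)
    (hW : ∀ x ∈ U, ∀ c a b, Γ x c a b = weylConnection g Q x c a b) (hx : x ∈ U) (e c : Fin 4) :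
    pd e (fun y => momentumUp f Q g Γ y c) x = Q x e * momentumUp f Q g Γ x c
      - ∑ d, Γ x c e d * momentumUp f Q g Γ x d
      + ∑ k, (g x)⁻¹ c k * covDeriv Γ (momentum f Q g Γ) x e k := by
  have hc : ∀ k, covDeriv Γ (momentum f Q g Γ) x e k =
      covDeriv (weylConnection g Q) (momentum f Q g Γ) x e k := fun k => by
    simp only [covDeriv, hW x hx]
  simp only [hc, hW x hx]
  exact H.pd_raise hx (fun d => (H.momentum_at hx d).differentiableAt (by simp)) e c

theorem pd_density_inv (H : IsFieldOn U f Q g Γ)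
    (hW : ∀ x ∈ U, ∀ c a b, Γ x c a b = weylConnection g Q x c a b) (hx : x ∈ U) (c a b : Fin 4) :
    pd c (fun y => √(-(g y).det) * fPrime f g Γ y * (g y)⁻¹ a b) x =
      (√(-(g x).det) * (∑ d, Γ x d c d - 2 * Q x c) * fPrime f g Γ x
        + √(-(g x).det) * grad (fPrime f g Γ) x c) * (g x)⁻¹ a b
      + √(-(g x).det) * fPrime f g Γ x * (Q x c * (g x)⁻¹ a b
        - ∑ d, Γ x a c d * (g x)⁻¹ d b - ∑ d, Γ x b c d * (g x)⁻¹ a d) := by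
  have hF := (H.fPrime_at hx).differentiableAt (by simp)
  have hs := (H.sqrt_at hx).differentiableAt (by simp)
  rw [pd_mul (hs.fun_mul hF) ((H.inv_at hx a b).differentiableAt (by simp)), pd_mul hs hF,
    H.pd_sqrt hx, H.pd_inv hx]
  simp only [hW x hx, H.weylConnection_symm hx _ c, grad]

theorem pd_density_momentumUp (H : IsFieldOn U f Q g Γ)
    (hW : ∀ x ∈ U, ∀ c a b, Γ x c a b = weylConnection g Q x c a b) (hx : x ∈ U)
    (e c a b : Fin 4) :
    pd e (fun y => √(-(g y).det) * (momentumUp f Q g Γ y c * (g y)⁻¹ a b)) x =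
      √(-(g x).det) * (∑ d, Γ x d e d - 2 * Q x e) * (momentumUp f Q g Γ x c * (g x)⁻¹ a b)
      + √(-(g x).det) * ((Q x e * momentumUp f Q g Γ x c
          - ∑ d, Γ x c e d * momentumUp f Q g Γ x d
          + ∑ k, (g x)⁻¹ c k * covDeriv Γ (momentum f Q g Γ) x e k) * (g x)⁻¹ a b
        + momentumUp f Q g Γ x c * (Q x e * (g x)⁻¹ a b
          - ∑ d, Γ x a e d * (g x)⁻¹ d b - ∑ d, Γ x b e d * (g x)⁻¹ a d)) := by
  have hs := (H.sqrt_at hx).differentiableAt (by simp)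
  have hi := (H.inv_at hx a b).differentiableAt (by simp)
  have hP := (H.momentumUp_at hx c).differentiableAt (by simp)
  rw [pd_mul hs (hP.fun_mul hi), pd_mul hP hi, H.pd_sqrt hx, H.pd_inv hx, H.pd_momentumUp hW hx]
  simp only [hW x hx]

theorem sum_pd_connectionCurrent (H : IsFieldOn U f Q g Γ)
    (hW : ∀ x ∈ U, ∀ c a b, Γ x c a b = weylConnection g Q x c a b) (hx : x ∈ U)
    (hγ : ∀ c a b, DifferentiableAt ℝ (fun y => γ y c a b) x)
    (hγs : ∀ c a b, γ x c a b = γ x c b a) :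
    ∑ c, pd c (connectionCurrent f g Γ γ c) x =
      √(-(g x).det) * fPrime f g Γ x * ∑ a, ∑ b, (g x)⁻¹ a b * ricciVariation Γ γ x a b
      + √(-(g x).det) * ∑ c, ∑ a, ∑ b, multiplierValue f Q g Γ x c a b * γ x c a b := by
  have kG := palatini_algebra (√(-(g x).det)) (fPrime f g Γ x)
    (fun e c a b => pd e (fun y => γ y c a b) x) (Q x) (grad (fPrime f g Γ) x)
    (momentumUp f Q g Γ x) _ (H.inv_symm hx) (H.symm_connection x hx) hγs
    (fun a => rfl) (H.pd_density_inv hW hx)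
  refine Eq.trans (Finset.sum_congr rfl fun c _ => ?_) kG.symm
  have hd := fun a b => (((H.sqrt_at hx).mul (H.fPrime_at hx)).mul
    (H.inv_at hx a b)).differentiableAt (by simp)
  have s2 : ∀ (u v : Fin 4 → Fin 4 → Coord → ℝ), (∀ a b, DifferentiableAt ℝ (u a b) x) →
      (∀ a b, DifferentiableAt ℝ (v a b) x) →
      DifferentiableAt ℝ (fun y => ∑ a, ∑ b, u a b y * v a b y) x := fun u v hu hv =>
    DifferentiableAt.fun_sum fun a _ => DifferentiableAt.fun_sum fun b _ =>
      (hu a b).fun_mul (hv a b)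
  refine (pd_sub (s2 _ _ (fun a b => hd a b) (fun a b => hγ c a b))
    (s2 _ _ (fun a _ => hd a c) (fun a b => hγ b a b))).trans ?_
  exact congrArg₂ _ (pd_sum_sum_mul (fun a b => hd a b) (fun a b => hγ c a b) c)
    (pd_sum_sum_mul (fun a _ => hd a c) (fun a b => hγ b a b) c)

theorem sum_pd_metricCurrent (H : IsFieldOn U f Q g Γ)
    (hW : ∀ x ∈ U, ∀ c a b, Γ x c a b = weylConnection g Q x c a b) (hx : x ∈ U)
    (hh : ∀ a b, DifferentiableAt ℝ (fun y => h y a b) x) (hhs : ∀ y a b, h y a b = h y b a) :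
    ∑ c, pd c (metricCurrent f Q g Γ h c) x =
      √(-(g x).det) * ∑ c, ∑ a, ∑ b,
        multiplierValue f Q g Γ x c a b * weylVariation g Q h x c a b
      + √(-(g x).det) * (((∑ c, ∑ e, (g x)⁻¹ c e * covDeriv Γ (momentum f Q g Γ) x c e)
            - ∑ c, Q x c * momentumUp f Q g Γ x c) * ∑ a, ∑ b, (g x)⁻¹ a b * h x a b
        - ∑ a, ∑ b, ∑ c, (g x)⁻¹ b c *
          ((∑ e, (g x)⁻¹ a e * covDeriv Γ (momentum f Q g Γ) x c e)
            - Q x c * momentumUp f Q g Γ x a) * h x a b) := by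
  have hds : ∀ c a b, pd c (fun y => h y a b) x = pd c (fun y => h y b a) x := fun c a b =>
    pd_congr (Filter.Eventually.of_forall fun y => hhs y a b)
  have kM := multiplier_contraction_algebra (momentum f Q g Γ x) (momentumUp f Q g Γ x)
    (fun d a b => weylLower h Q x d a b - 2 * ∑ e, h x d e * Γ x e a b) (H.inv_symm hx)
    (fun d a b => by
      simp only [weylLower, H.symm_connection x hx _ a b]
      rw [hds b a d, hds a d b, hds d a b, hhs x a d, hhs x d b, hhs x a b]
      ring) (fun a => rfl)
  have kB := metric_variation_algebra (√(-(g x).det)) (Q x) (momentumUp f Q g Γ x)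
    (fun e c => ∑ k, (g x)⁻¹ c k * covDeriv Γ (momentum f Q g Γ) x e k)
    (fun c a b => pd c (fun y => h y a b) x) _ (H.inv_symm hx) (hhs x)
    (H.symm_connection x hx) hds (H.pd_density_momentumUp hW hx)
  simp only [← H.weylVariation_eq hW hx] at kM
  have kM' : ∑ c, ∑ a, ∑ b, multiplierValue f Q g Γ x c a b * weylVariation g Q h x c a b = _ := kM
  rw [kM']
  refine Eq.trans (Finset.sum_congr rfl fun c _ => ?_) (sub_eq_iff_eq_add.1 kB.symm)
  have hd := fun c a b => ((H.sqrt_at hx).mul ((H.momentumUp_at hx c).mul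
    (H.inv_at hx a b))).differentiableAt (by simp)
  have s2 : ∀ (u v : Fin 4 → Fin 4 → Coord → ℝ), (∀ a b, DifferentiableAt ℝ (u a b) x) →
      (∀ a b, DifferentiableAt ℝ (v a b) x) →
      DifferentiableAt ℝ (fun y => ∑ a, ∑ b, u a b y * v a b y) x := fun u v hu hv =>
    DifferentiableAt.fun_sum fun a _ => DifferentiableAt.fun_sum fun b _ =>
      (hu a b).fun_mul (hv a b)
  refine (pd_sub (s2 _ _ (fun a b => hd c a b) hh) (s2 _ _ (fun a b => hd a b c) hh)).trans ?_
  exact congrArg₂ _ (pd_sum_sum_mul (fun a b => hd c a b) hh c)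
    (pd_sum_sum_mul (fun a b => hd a b c) hh c)

/-- The first variation at a field whose connection is the Weyl connection, up to a divergence. -/
theorem densityVariation_eq (H : IsFieldOn U f Q g Γ)
    (hW : ∀ x ∈ U, ∀ c a b, Γ x c a b = weylConnection g Q x c a b) (hv : IsVariation K h γ μ)
    (hx : x ∈ U) :
    densityVariation f Q g Γ Λ h γ μ x =
      √(-(g x).det) * ∑ c, ∑ a, ∑ b, (Λ x c a b - multiplierValue f Q g Γ x c a b)
        * (γ x c a b - weylVariation g Q h x c a b)
      - √(-(g x).det) * ∑ a, ∑ b, h x a b * ∑ c, ∑ d, (g x)⁻¹ a c * (g x)⁻¹ b d *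
        (fieldOperator f g Γ x c d - weylSource f Q g Γ x c d)
      + (∑ c, pd c (connectionCurrent f g Γ γ c) x - ∑ c, pd c (metricCurrent f Q g Γ h c) x) := by
  have hgg : ∀ a b, ∑ c, ∑ d, (g x)⁻¹ a c * (g x)⁻¹ b d * g x c d = (g x)⁻¹ a b := by
    intro a b
    have e' : ((g x)⁻¹ * g x * (g x)⁻¹) a b = (g x)⁻¹ a b := by
      rw [Matrix.nonsing_inv_mul _ (H.isUnit_det hx), Matrix.one_mul]
    rw [← e']
    simp only [Matrix.mul_apply, Finset.sum_mul]
    rw [Finset.sum_comm]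
    exact Finset.sum_congr rfl fun d _ => Finset.sum_congr rfl fun c _ => by
      rw [H.inv_symm hx b d]; ring
  have kE := metric_field_algebra (√(-(g x).det)) (fPrime f g Γ x) (f (scalarCurvature g Γ x))
    (G := fun a b => (g x)⁻¹ a b) (h := h x) (g := g x) (Ric := ricci Γ x)
    (D := covDeriv Γ (momentum f Q g Γ) x) (Q := Q x) (P := momentum f Q g Γ x)
    (V := momentumUp f Q g Γ x)
    (N := fun c a => ∑ e, (g x)⁻¹ a e * covDeriv Γ (momentum f Q g Γ) x c e)
    (E := fun a b => fieldOperator f g Γ x a b - weylSource f Q g Γ x a b)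
    (H.inv_symm hx) (hv.symm_metric x) hgg (fun _ => rfl) (fun _ _ => rfl)
    (fun a b => by rw [H.fieldOperator_sub_weylSource hx a b]; rfl)
  have htr : ((g x)⁻¹ * h x).trace = ∑ a, ∑ b, (g x)⁻¹ a b * h x a b := by
    simp only [Matrix.trace, Matrix.diag_apply, Matrix.mul_apply]
    exact Finset.sum_congr rfl fun a _ => Finset.sum_congr rfl fun b _ => by
      rw [hv.symm_metric x b a]
  have hsc : scalarVariation g Γ h γ x =
      (∑ a, ∑ b, -(∑ c, ∑ d, (g x)⁻¹ a c * h x c d * (g x)⁻¹ d b) * ricci Γ x a b)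
      + ∑ a, ∑ b, (g x)⁻¹ a b * ricciVariation Γ γ x a b := by
    have hm : ∀ a b, ((g x)⁻¹ * h x * (g x)⁻¹) a b =
        ∑ c, ∑ d, (g x)⁻¹ a c * h x c d * (g x)⁻¹ d b := fun a b => by
      simp only [Matrix.mul_apply, Finset.sum_mul]
      exact Finset.sum_comm
    simp only [scalarVariation, hm, Finset.sum_add_distrib]
  have hC : ∀ c a b, Γ x c a b - christoffel g x c a b - weylDifference g Q x c a b = 0 :=
    fun c a b => by rw [sub_sub, sub_eq_zero]; exact hW x hx c a b
  have hsplit : ∑ c, ∑ a, ∑ b, (Λ x c a b - multiplierValue f Q g Γ x c a b)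
        * (γ x c a b - weylVariation g Q h x c a b) =
      ∑ c, ∑ a, ∑ b, Λ x c a b * (γ x c a b - weylVariation g Q h x c a b)
      - ∑ c, ∑ a, ∑ b, multiplierValue f Q g Γ x c a b * γ x c a b
      + ∑ c, ∑ a, ∑ b, multiplierValue f Q g Γ x c a b * weylVariation g Q h x c a b := by
    simp only [← Finset.sum_sub_distrib, ← Finset.sum_add_distrib]
    exact Finset.sum_congr rfl fun c _ => Finset.sum_congr rfl fun a _ =>
      Finset.sum_congr rfl fun b _ => by ring
  rw [H.sum_pd_connectionCurrent hW hx
      (fun c a b => (hv.smooth_connection c a b).contDiffAt.differentiableAt (by simp))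
      (hv.symm_connection x),
    H.sum_pd_metricCurrent hW hx
      (fun a b => (hv.smooth_metric a b).contDiffAt.differentiableAt (by simp)) hv.symm_metric,
    hsplit]
  simp only [densityVariation, hC, mul_zero, Finset.sum_const_zero, add_zero, zero_add, hsc, htr]
  linear_combination kE

end IsFieldOn

end

end Stationarity

/-! ### Stationary points in a coordinate domain -/

section Stationary

open Matrix MeasureTheory

variable {U K : Set Coord} {f : ℝ → ℝ} {Q : Comp₁} {g h : Comp₂} {Γ Λ γ μ : Comp₃} {x : Coord}

/-- The first variation of the action vanishes for all variations compactly supported in the open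
set `U` of coordinates. -/
def IsStationaryOn (U : Set Coord) (f : ℝ → ℝ) (Q : Comp₁) (g : Comp₂) (Γ Λ : Comp₃) : Prop :=
  ∀ K : Set Coord, IsCompact K → K ⊆ U → ∀ (h : Comp₂) (γ μ : Comp₃), IsVariation K h γ μ →
    HasDerivAt (fun ε : ℝ => constrainedAction f Q K (fun x => g x + ε • h x)
      (fun x => Γ x + ε • γ x) (fun x => Λ x + ε • μ x)) 0 0

/-- The indicator of the symmetric pair of indices `a₀, b₀`, as a symmetric matrix. -/
def symUnit (a₀ b₀ a b : Fin 4) : ℝ :=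
  (if a = a₀ ∧ b = b₀ then 1 else 0) + (if a = b₀ ∧ b = a₀ then 1 else 0)

theorem symUnit_symm (a₀ b₀ a b : Fin 4) : symUnit a₀ b₀ a b = symUnit a₀ b₀ b a := by
  simp only [symUnit, and_comm, add_comm]

theorem sum_symUnit (a₀ b₀ : Fin 4) (X : Fin 4 → Fin 4 → ℝ) :
    ∑ a, ∑ b, symUnit a₀ b₀ a b * X a b = X a₀ b₀ + X b₀ a₀ := by
  simp [symUnit, add_mul, Finset.sum_add_distrib, ite_and]

theorem IsVariation.zero (K : Set Coord) : IsVariation K 0 0 0 := by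
  constructor <;> intros <;> first | rfl | exact contDiff_const

theorem weylVariation_zero (g : Comp₂) (Q : Comp₁) (x : Coord) (c a b : Fin 4) :
    weylVariation g Q 0 x c a b = 0 := by
  simp [weylVariation, weylLower]

theorem densityVariation_multiplier (f : ℝ → ℝ) (Q : Comp₁) (g : Comp₂) (Γ Λ μ : Comp₃)
    (x : Coord) : densityVariation f Q g Γ Λ 0 0 μ x = √(-(g x).det) * ∑ c, ∑ a, ∑ b,
      μ x c a b * (Γ x c a b - christoffel g x c a b - weylDifference g Q x c a b) := by
  simp [densityVariation, scalarVariation, ricciVariation, weylVariation_zero]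

section Smoothness

theorem covDeriv_contDiffAt {η : Comp₁} (hΓ : ∀ c a b, ContDiffAt ℝ ∞ (fun y => Γ y c a b) x)
    (hη : ∀ a, ContDiffAt ℝ ∞ (fun y => η y a) x) (a b : Fin 4) :
    ContDiffAt ℝ ∞ (fun y => covDeriv Γ η y a b) x :=
  (ContDiffAt.pd (k := ⊤) (m := ⊤) (hη b) le_top).sub
    (ContDiffAt.sum fun c _ => (hΓ c a b).mul (hη c))

theorem contract_contDiffAt {T : Comp₂} (hg : ∀ a b, ContDiffAt ℝ ∞ (fun y => (g y)⁻¹ a b) x)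
    (hT : ∀ a b, ContDiffAt ℝ ∞ (fun y => T y a b) x) : ContDiffAt ℝ ∞ (contract g T) x :=
  ContDiffAt.sum fun a _ => ContDiffAt.sum fun b _ => (hg a b).mul (hT a b)

theorem inner₁_contDiffAt {η ξ : Comp₁} (hg : ∀ a b, ContDiffAt ℝ ∞ (fun y => (g y)⁻¹ a b) x)
    (hη : ∀ a, ContDiffAt ℝ ∞ (fun y => η y a) x) (hξ : ∀ a, ContDiffAt ℝ ∞ (fun y => ξ y a) x) :
    ContDiffAt ℝ ∞ (inner₁ g η ξ) x :=
  ContDiffAt.sum fun a _ => ContDiffAt.sum fun b _ => ((hg a b).mul (hη a)).mul (hξ b)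

theorem symPart_contDiffAt {T : Comp₂} (hT : ∀ a b, ContDiffAt ℝ ∞ (fun y => T y a b) x)
    (a b : Fin 4) : ContDiffAt ℝ ∞ (fun y => symPart T y a b) x :=
  contDiffAt_const.mul ((hT a b).add (hT b a))

namespace IsFieldOn

theorem ricci_at (H : IsFieldOn U f Q g Γ) (hx : x ∈ U) (a b : Fin 4) :
    ContDiffAt ℝ ∞ (fun y => ricci Γ y a b) x :=
  (SmoothFamilyAt.ricci (Γ := fun _ => Γ)
    (fun c a b => .of_const (H.connection_at hx c a b)) a b).contDiffAt

theorem scalarCurvature_at (H : IsFieldOn U f Q g Γ) (hx : x ∈ U) :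
    ContDiffAt ℝ ∞ (scalarCurvature g Γ) x :=
  contract_contDiffAt (T := ricci Γ) (H.inv_at hx) (H.ricci_at hx)

theorem fieldOperator_at (H : IsFieldOn U f Q g Γ) (hx : x ∈ U) (a b : Fin 4) :
    ContDiffAt ℝ ∞ (fun y => fieldOperator f g Γ y a b) x := by
  have hh := fun a b => covDeriv_contDiffAt (H.connection_at hx) (H.grad_at hx) a b
  exact ((((H.fPrime_at hx).mul (symPart_contDiffAt (H.ricci_at hx) a b)).sub
    ((contDiffAt_const.mul (H.smooth_lagrangian.contDiffAt.comp x (H.scalarCurvature_at hx))).mul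
      (H.metric_at hx a b))).sub (hh a b)).add
    ((H.metric_at hx a b).mul (contract_contDiffAt (H.inv_at hx) hh))

theorem weylSource_at (H : IsFieldOn U f Q g Γ) (hx : x ∈ U) (a b : Fin 4) :
    ContDiffAt ℝ ∞ (fun y => weylSource f Q g Γ y a b) x := by
  have hF := H.fPrime_at hx
  have hq := H.oneForm_at hx
  have hd := H.grad_at hx
  have hc := fun a b => covDeriv_contDiffAt (H.connection_at hx) hq a b
  have hi := H.inv_at hx
  exact ((((((hq a).mul (hd b)).add ((hq b).mul (hd a))).neg).sub
    (hF.mul (symPart_contDiffAt hc a b))).add ((hF.mul (hq a)).mul (hq b))).add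
    ((H.metric_at hx a b).mul (((contDiffAt_const.mul (inner₁_contDiffAt hi hq hd)).sub
      ((inner₁_contDiffAt hi hq hq).mul hF)).add (hF.mul (contract_contDiffAt hi hc))))

theorem multiplierValue_at (H : IsFieldOn U f Q g Γ) (hx : x ∈ U) (c a b : Fin 4) :
    ContDiffAt ℝ ∞ (fun y => multiplierValue f Q g Γ y c a b) x := by
  simp only [multiplierValue_eq]
  refine ContDiffAt.sub (contDiffAt_const.mul (ContDiffAt.add ?_ ?_))
    ((H.inv_at hx a b).mul (H.momentum_at hx c))
  · split_ifs
    exacts [H.momentumUp_at hx a, contDiffAt_const]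
  · split_ifs
    exacts [H.momentumUp_at hx b, contDiffAt_const]

theorem multiplierValue_symm (H : IsFieldOn U f Q g Γ) (hx : x ∈ U) (c a b : Fin 4) :
    multiplierValue f Q g Γ x c a b = multiplierValue f Q g Γ x c b a := by
  rw [multiplierValue_eq, multiplierValue_eq, H.inv_symm hx a b]
  ring

end IsFieldOn

end Smoothness

namespace IsFieldOn

theorem hasDerivAt_constrainedAction (H : IsFieldOn U f Q g Γ)
    (hΛ : ∀ c a b, ContDiffOn ℝ ∞ (fun x => Λ x c a b) U) (hK : IsCompact K) (hKU : K ⊆ U)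
    (hv : IsVariation K h γ μ) :
    IntegrableOn (densityVariation f Q g Γ Λ h γ μ) K ∧
    HasDerivAt (fun ε : ℝ => constrainedAction f Q K (fun x => g x + ε • h x)
      (fun x => Γ x + ε • γ x) (fun x => Λ x + ε • μ x))
      (∫ x in K, densityVariation f Q g Γ Λ h γ μ x) 0 := by
  refine hasDerivAt_setIntegral_of_contDiffAt hK (F := fun ε => lagrangianDensity f Q
    (fun x => g x + ε • h x) (fun x => Γ x + ε • γ x) (fun x => Λ x + ε • μ x)) ?_ ?_
  · intro x hx
    have hsm : SmoothFamilyAt (fun ε => lagrangianDensity f Q (fun x => g x + ε • h x)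
        (fun x => Γ x + ε • γ x) (fun x => Λ x + ε • μ x)) x := by
      refine SmoothFamilyAt.lagrangianDensity (Q := fun _ => Q)
        (g := fun ε x => g x + ε • h x) (Γ := fun ε x => Γ x + ε • γ x)
        (Λ := fun ε x => Λ x + ε • μ x) H.smooth_lagrangian (fun a b => ?_)
        (by simpa using H.det_neg x (hKU hx)) (fun a => .of_const (H.oneForm_at (hKU hx) a))
        (fun c a b => ?_) (fun c a b => ?_)
      · exact .affine (H.metric_at (hKU hx) a b) (hv.smooth_metric a b).contDiffAt
      · exact .affine (H.connection_at (hKU hx) c a b) (hv.smooth_connection c a b).contDiffAt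
      · exact .affine ((hΛ c a b).contDiffAt (H.isOpen.mem_nhds (hKU hx)))
          (hv.smooth_multiplier c a b).contDiffAt
    exact hsm.of_le (by norm_cast)
  · intro x hx
    exact hasDerivAt_lagrangianDensity (H.smooth_lagrangian.differentiable (by simp))
      (fun a b => (H.metric_at (hKU hx) a b).differentiableAt (by simp))
      (fun a b => (hv.smooth_metric a b).contDiffAt.differentiableAt (by simp))
      (H.det_neg x (hKU hx))
      (fun c a b => (H.connection_at (hKU hx) c a b).differentiableAt (by simp))
      (fun c a b => (hv.smooth_connection c a b).contDiffAt.differentiableAt (by simp))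

theorem isStationaryOn_iff_setIntegral (H : IsFieldOn U f Q g Γ)
    (hΛ : ∀ c a b, ContDiffOn ℝ ∞ (fun x => Λ x c a b) U) :
    IsStationaryOn U f Q g Γ Λ ↔ ∀ K : Set Coord, IsCompact K → K ⊆ U →
      ∀ (h : Comp₂) (γ μ : Comp₃), IsVariation K h γ μ →
        ∫ x in K, densityVariation f Q g Γ Λ h γ μ x = 0 := by
  refine forall_congr' fun K => forall_congr' fun hK => forall_congr' fun hKU =>
    forall_congr' fun h => forall_congr' fun γ => forall_congr' fun μ => forall_congr' fun hv => ?_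
  have hd := (H.hasDerivAt_constrainedAction hΛ hK hKU hv).2
  exact ⟨fun h0 => hd.unique h0, fun h0 => h0 ▸ hd⟩

/-- Varying the multipliers enforces the constraint. -/
theorem weylConnection_of_isStationaryOn (H : IsFieldOn U f Q g Γ)
    (hΛ : ∀ c a b, ContDiffOn ℝ ∞ (fun x => Λ x c a b) U) (hst : IsStationaryOn U f Q g Γ Λ) :
    ∀ x ∈ U, ∀ c a b, Γ x c a b = weylConnection g Q x c a b := by
  rw [H.isStationaryOn_iff_setIntegral hΛ] at hst
  intro x hx c a b
  set X : Comp₃ := fun x c a b =>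
    Γ x c a b - christoffel g x c a b - weylDifference g Q x c a b with hX
  have hXe : ∀ y c a b, X y c a b = Γ y c a b - weylConnection g Q y c a b := fun y c a b => by
    simp only [hX, weylConnection]; ring
  have key := eq_zero_of_forall_setIntegral_mul_eq_zero H.isOpen
    (u := fun y => √(-(g y).det) * (X y c a b + X y c b a)) ?_ ?_ x hx
  · rw [mul_eq_zero, or_iff_right (H.sqrt_pos hx).ne', hXe, hXe, H.symm_connection x hx c b a,
      H.weylConnection_symm hx c b a] at key
    linarith
  · intro y hy
    simp only [hXe]
    exact (((H.sqrt_at hy).mul (((H.connection_at hy c a b).sub (H.weylConnection_at hy c a b)).add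
      ((H.connection_at hy c b a).sub
        (H.weylConnection_at hy c b a)))).continuousAt).continuousWithinAt
  · intro K hK hKU φ hφ h0
    have hv : IsVariation K 0 0
        (fun y c' a' b' => φ y * ((if c' = c then 1 else 0) * symUnit a b a' b')) :=
      { IsVariation.zero K with
        smooth_multiplier := fun _ _ _ => hφ.mul contDiff_const
        symm_multiplier := fun y c' a' b' => by rw [symUnit_symm]
        vanish_multiplier := fun y hy _ _ _ => by rw [h0 y hy, zero_mul] }
    rw [← hst K hK hKU _ _ _ hv]
    refine setIntegral_congr_fun hK.measurableSet fun y _ => ?_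
    have hs : ∑ c', ∑ a', ∑ b',
        φ y * ((if c' = c then 1 else 0) * symUnit a b a' b') * X y c' a' b' =
        φ y * (X y c a b + X y c b a) := by
      rw [← sum_symUnit a b (X y c), Finset.sum_eq_single c]
      · simp only [if_true, one_mul, Finset.mul_sum, mul_assoc]
      · intro c' _ hc; simp [hc]
      · simp
    simp only [densityVariation_multiplier]
    rw [hs]; ring

theorem setIntegral_densityVariation (H : IsFieldOn U f Q g Γ)
    (hΛ : ∀ c a b, ContDiffOn ℝ ∞ (fun x => Λ x c a b) U)
    (hW : ∀ x ∈ U, ∀ c a b, Γ x c a b = weylConnection g Q x c a b)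
    (hK : IsCompact K) (hKU : K ⊆ U) (hv : IsVariation K h γ μ) :
    ∫ x in K, densityVariation f Q g Γ Λ h γ μ x = ∫ x in K,
      (√(-(g x).det) * ∑ c, ∑ a, ∑ b, (Λ x c a b - multiplierValue f Q g Γ x c a b)
        * (γ x c a b - weylVariation g Q h x c a b)
      - √(-(g x).det) * ∑ a, ∑ b, h x a b * ∑ c, ∑ d, (g x)⁻¹ a c * (g x)⁻¹ b d *
        (fieldOperator f g Γ x c d - weylSource f Q g Γ x c d)) := by
  have hJ1 : ∀ c, ContDiff ℝ ∞ (connectionCurrent f g Γ γ c) := fun c => by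
    refine contDiff_of_contDiffOn_of_vanish H.isOpen hK hKU (fun x hx => ?_) fun x hx => ?_
    · exact ContDiffAt.contDiffWithinAt (ContDiffAt.sub
        (ContDiffAt.sum fun a _ => ContDiffAt.sum fun b _ => (((H.sqrt_at hx).mul
          (H.fPrime_at hx)).mul (H.inv_at hx a b)).mul (hv.smooth_connection c a b).contDiffAt)
        (ContDiffAt.sum fun a _ => ContDiffAt.sum fun b _ => (((H.sqrt_at hx).mul
          (H.fPrime_at hx)).mul (H.inv_at hx a c)).mul (hv.smooth_connection b a b).contDiffAt))
    · simp [connectionCurrent, hv.vanish_connection x hx]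
  have hJ2 : ∀ c, ContDiff ℝ ∞ (metricCurrent f Q g Γ h c) := fun c => by
    refine contDiff_of_contDiffOn_of_vanish H.isOpen hK hKU (fun x hx => ?_) fun x hx => ?_
    · exact ContDiffAt.contDiffWithinAt (ContDiffAt.sub
        (ContDiffAt.sum fun a _ => ContDiffAt.sum fun b _ => ((H.sqrt_at hx).mul
          ((H.momentumUp_at hx c).mul (H.inv_at hx a b))).mul (hv.smooth_metric a b).contDiffAt)
        (ContDiffAt.sum fun a _ => ContDiffAt.sum fun b _ => ((H.sqrt_at hx).mul
          ((H.momentumUp_at hx a).mul (H.inv_at hx b c))).mul (hv.smooth_metric a b).contDiffAt))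
    · simp [metricCurrent, hv.vanish_metric x hx]
  have hi : ∀ {J : Coord → ℝ} (_ : ContDiff ℝ ∞ J) (c : Fin 4), IntegrableOn (pd c J) K :=
    fun hJ c => (hJ.pd c).continuous.continuousOn.integrableOn_compact hK
  have hi1 : IntegrableOn (fun x => ∑ c, pd c (connectionCurrent f g Γ γ c) x) K :=
    integrable_finsetSum _ fun c _ => hi (hJ1 c) c
  have hi2 : IntegrableOn (fun x => ∑ c, pd c (metricCurrent f Q g Γ h c) x) K :=
    integrable_finsetSum _ fun c _ => hi (hJ2 c) c
  have h1 : ∫ x in K, ∑ c, pd c (connectionCurrent f g Γ γ c) x = 0 := by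
    rw [integral_finsetSum _ fun c _ => hi (hJ1 c) c]
    refine Finset.sum_eq_zero fun c _ => setIntegral_pd_eq_zero hK (hJ1 c) (fun x hx => ?_) c
    simp [connectionCurrent, hv.vanish_connection x hx]
  have h2 : ∫ x in K, ∑ c, pd c (metricCurrent f Q g Γ h c) x = 0 := by
    rw [integral_finsetSum _ fun c _ => hi (hJ2 c) c]
    refine Finset.sum_eq_zero fun c _ => setIntegral_pd_eq_zero hK (hJ2 c) (fun x hx => ?_) c
    simp [metricCurrent, hv.vanish_metric x hx]
  have h3 : ∫ x in K, (∑ c, pd c (connectionCurrent f g Γ γ c) x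
      - ∑ c, pd c (metricCurrent f Q g Γ h c) x) = 0 := by
    rw [integral_sub hi1 hi2, h1, h2, sub_zero]
  have hi3 : IntegrableOn (fun x => ∑ c, pd c (connectionCurrent f g Γ γ c) x
      - ∑ c, pd c (metricCurrent f Q g Γ h c) x) K := hi1.sub hi2
  rw [← sub_zero (∫ x in K, densityVariation f Q g Γ Λ h γ μ x), ← h3,
    ← integral_sub (H.hasDerivAt_constrainedAction hΛ hK hKU hv).1 hi3]
  refine setIntegral_congr_fun hK.measurableSet fun x hx => ?_
  simp only [H.densityVariation_eq hW hv (hKU hx)]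
  ring

/-- Varying the connection determines the multipliers. -/
theorem multiplierValue_of_isStationaryOn (H : IsFieldOn U f Q g Γ)
    (hΛ : ∀ c a b, ContDiffOn ℝ ∞ (fun x => Λ x c a b) U)
    (hΛs : ∀ x ∈ U, ∀ c a b, Λ x c a b = Λ x c b a)
    (hW : ∀ x ∈ U, ∀ c a b, Γ x c a b = weylConnection g Q x c a b)
    (hst : IsStationaryOn U f Q g Γ Λ) :
    ∀ x ∈ U, ∀ c a b, Λ x c a b = multiplierValue f Q g Γ x c a b := by
  rw [H.isStationaryOn_iff_setIntegral hΛ] at hst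
  intro x hx c a b
  set X : Comp₃ := fun x c a b => Λ x c a b - multiplierValue f Q g Γ x c a b with hX
  have key := eq_zero_of_forall_setIntegral_mul_eq_zero H.isOpen
    (u := fun y => √(-(g y).det) * (X y c a b + X y c b a)) ?_ ?_ x hx
  · rw [mul_eq_zero, or_iff_right (H.sqrt_pos hx).ne', hX] at key
    simp only [hΛs x hx c b a, H.multiplierValue_symm hx c b a] at key
    linarith
  · intro y hy
    have hd : ∀ a b, ContDiffAt ℝ ∞ (fun y => X y c a b) y := fun a b =>
      ((hΛ c a b).contDiffAt (H.isOpen.mem_nhds hy)).sub (H.multiplierValue_at hy c a b)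
    exact (((H.sqrt_at hy).mul ((hd a b).add (hd b a))).continuousAt).continuousWithinAt
  · intro K hK hKU φ hφ h0
    have hv : IsVariation K 0
        (fun y c' a' b' => φ y * ((if c' = c then 1 else 0) * symUnit a b a' b')) 0 :=
      { IsVariation.zero K with
        smooth_connection := fun _ _ _ => hφ.mul contDiff_const
        symm_connection := fun y c' a' b' => by rw [symUnit_symm]
        vanish_connection := fun y hy _ _ _ => by rw [h0 y hy, zero_mul] }
    rw [← hst K hK hKU _ _ _ hv, H.setIntegral_densityVariation hΛ hW hK hKU hv]
    refine setIntegral_congr_fun hK.measurableSet fun y _ => ?_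
    have hs : ∑ c', ∑ a', ∑ b', X y c' a' b' *
        (φ y * ((if c' = c then 1 else 0) * symUnit a b a' b')) =
        φ y * (X y c a b + X y c b a) := by
      rw [← sum_symUnit a b (X y c), Finset.sum_eq_single c]
      · simp only [if_true, one_mul, Finset.mul_sum]
        exact Finset.sum_congr rfl fun a' _ => Finset.sum_congr rfl fun b' _ => by ring
      · intro c' _ hc; simp [hc]
      · simp
    simp only [weylVariation_zero, sub_zero, Pi.zero_apply, Matrix.zero_apply, zero_mul,
      Finset.sum_const_zero, mul_zero]
    rw [hs]; ring

theorem fieldOperator_symm (H : IsFieldOn U f Q g Γ) (hx : x ∈ U) (a b : Fin 4) :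
    fieldOperator f g Γ x a b - weylSource f Q g Γ x a b =
      fieldOperator f g Γ x b a - weylSource f Q g Γ x b a := by
  rw [H.fieldOperator_sub_weylSource hx, H.fieldOperator_sub_weylSource hx, H.symm x hx a b]
  simp only [symPart]
  ring

/-- Varying the metric gives the field equation. -/
theorem fieldOperator_eq_of_isStationaryOn (H : IsFieldOn U f Q g Γ)
    (hΛ : ∀ c a b, ContDiffOn ℝ ∞ (fun x => Λ x c a b) U)
    (hW : ∀ x ∈ U, ∀ c a b, Γ x c a b = weylConnection g Q x c a b)
    (hM : ∀ x ∈ U, ∀ c a b, Λ x c a b = multiplierValue f Q g Γ x c a b)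
    (hst : IsStationaryOn U f Q g Γ Λ) :
    ∀ x ∈ U, ∀ a b, fieldOperator f g Γ x a b = weylSource f Q g Γ x a b := by
  rw [H.isStationaryOn_iff_setIntegral hΛ] at hst
  intro x hx
  -- `Y` is the field equation `E` with both indices raised
  set E : Comp₂ := fun x a b => fieldOperator f g Γ x a b - weylSource f Q g Γ x a b with hE
  set Y : Comp₂ := fun x a b => ∑ c, ∑ d, (g x)⁻¹ a c * (g x)⁻¹ b d * E x c d with hY
  have hYm : Y x = (g x)⁻¹ * E x * (g x)⁻¹ := by
    ext a b
    simp only [hY, Matrix.mul_apply, Finset.sum_mul]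
    rw [Finset.sum_comm]
    exact Finset.sum_congr rfl fun d _ => Finset.sum_congr rfl fun c _ => by
      rw [H.inv_symm hx d b]; ring
  have hYs : ∀ a b, Y x a b = Y x b a := fun a b => by
    have hEt : (E x)ᵀ = E x := by ext a b; exact H.fieldOperator_symm hx b a
    have : (Y x)ᵀ = Y x := by
      rw [hYm, Matrix.transpose_mul, Matrix.transpose_mul, Matrix.transpose_nonsing_inv,
        H.transpose hx, hEt, Matrix.mul_assoc]
    exact congrFun (congrFun this b) a
  have hY0 : Y x = 0 := by
    ext a b
    have key := eq_zero_of_forall_setIntegral_mul_eq_zero H.isOpen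
      (u := fun y => √(-(g y).det) * (Y y a b + Y y b a)) ?_ ?_ x hx
    · rw [mul_eq_zero, or_iff_right (H.sqrt_pos hx).ne', hYs b a] at key
      simpa using key
    · intro y hy
      have hd : ∀ a b, ContDiffAt ℝ ∞ (fun y => Y y a b) y := fun a b =>
        ContDiffAt.sum fun c _ => ContDiffAt.sum fun d _ =>
          ((H.inv_at hy a c).mul (H.inv_at hy b d)).mul
            ((H.fieldOperator_at hy c d).sub (H.weylSource_at hy c d))
      exact (((H.sqrt_at hy).mul ((hd a b).add (hd b a))).continuousAt).continuousWithinAt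
    · intro K hK hKU φ hφ h0
      have hv : IsVariation K (fun y => Matrix.of fun a' b' => φ y * symUnit a b a' b') 0 0 :=
        { IsVariation.zero K with
          smooth_metric := fun _ _ => hφ.mul contDiff_const
          symm_metric := fun y a' b' => by simp only [Matrix.of_apply]; rw [symUnit_symm]
          vanish_metric := fun y hy _ _ => by rw [Matrix.of_apply, h0 y hy, zero_mul] }
      have hint := hst K hK hKU _ _ _ hv
      rw [H.setIntegral_densityVariation hΛ hW hK hKU hv] at hint
      rw [← neg_eq_zero, ← integral_neg, ← hint]
      refine setIntegral_congr_fun hK.measurableSet fun y hy => ?_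
      have hs : ∑ a', ∑ b', φ y * symUnit a b a' b' * Y y a' b' =
          φ y * (Y y a b + Y y b a) := by
        rw [← sum_symUnit a b (Y y)]
        simp only [Finset.mul_sum, mul_assoc]
      simp only [hM y (hKU hy), sub_self, zero_mul, Finset.sum_const_zero, mul_zero, zero_sub,
        Matrix.of_apply]
      rw [show ∑ a', ∑ b', φ y * symUnit a b a' b' * ∑ c, ∑ d, (g y)⁻¹ a' c * (g y)⁻¹ b' d *
        (fieldOperator f g Γ y c d - weylSource f Q g Γ y c d) = _ from hs]
      ring
  have hE0 : E x = 0 := by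
    have : g x * Y x * g x = E x := by
      rw [hYm, Matrix.mul_assoc (g x)⁻¹,
        Matrix.mul_nonsing_inv_cancel_left _ _ (H.isUnit_det hx),
        Matrix.nonsing_inv_mul_cancel_right _ _ (H.isUnit_det hx)]
    rw [← this, hY0, Matrix.mul_zero, Matrix.zero_mul]
  intro a b
  exact sub_eq_zero.1 (congrFun (congrFun hE0 a) b)

/-- The field equations of the constrained action in a coordinate domain. -/
theorem isStationaryOn_iff (H : IsFieldOn U f Q g Γ)
    (hΛ : ∀ c a b, ContDiffOn ℝ ∞ (fun x => Λ x c a b) U)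
    (hΛs : ∀ x ∈ U, ∀ c a b, Λ x c a b = Λ x c b a) :
    IsStationaryOn U f Q g Γ Λ ↔
      (∀ x ∈ U, ∀ c a b, Γ x c a b = weylConnection g Q x c a b) ∧
      (∀ x ∈ U, ∀ c a b, Λ x c a b = multiplierValue f Q g Γ x c a b) ∧
      ∀ x ∈ U, ∀ a b, fieldOperator f g Γ x a b = weylSource f Q g Γ x a b := by
  constructor
  · intro hst
    have hW := H.weylConnection_of_isStationaryOn hΛ hst
    have hM := H.multiplierValue_of_isStationaryOn hΛ hΛs hW hst
    exact ⟨hW, hM, H.fieldOperator_eq_of_isStationaryOn hΛ hW hM hst⟩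
  · rintro ⟨hW, hM, hE⟩
    rw [H.isStationaryOn_iff_setIntegral hΛ]
    intro K hK hKU h γ μ hv
    rw [H.setIntegral_densityVariation hΛ hW hK hKU hv]
    refine setIntegral_eq_zero_of_forall_eq_zero fun x hx => ?_
    simp [hM x (hKU hx), hE x (hKU hx)]

end IsFieldOn

end Stationary

/-! ### Conformal transformations -/

section Conformal

open Matrix

variable {U : Set Coord} {f : ℝ → ℝ} {Q : Comp₁} {g : Comp₂} {Γ Γ' : Comp₃} {x : Coord}

theorem inv_smul_matrix {k : ℝ} (hk : k ≠ 0) {A : Matrix (Fin 4) (Fin 4) ℝ} (hA : IsUnit A.det) :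
    (k • A)⁻¹ = k⁻¹ • A⁻¹ := by
  refine Matrix.inv_eq_right_inv ?_
  rw [Matrix.smul_mul, Matrix.mul_smul, smul_smul, mul_inv_cancel₀ hk, one_smul,
    Matrix.mul_nonsing_inv _ hA]

theorem ricci_congr (hU : IsOpen U) (h : ∀ y ∈ U, ∀ c a b, Γ' y c a b = Γ y c a b) (hx : x ∈ U)
    (a b : Fin 4) : ricci Γ' x a b = ricci Γ x a b := by
  have hp : ∀ e c a b, pd e (fun y => Γ' y c a b) x = pd e (fun y => Γ y c a b) x :=
    fun e c a b => pd_congr_on hU (fun y hy => h y hy c a b) hx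
  simp only [ricci, hp, h x hx]

theorem covDeriv_congr_connection (h : ∀ c a b, Γ' x c a b = Γ x c a b) (η : Comp₁)
    (a b : Fin 4) : covDeriv Γ' η x a b = covDeriv Γ η x a b := by
  simp only [covDeriv, h]

theorem contract_smul {k : ℝ} (hk : k ≠ 0) {g' : Comp₂} (hg : g' x = k • g x)
    (hu : IsUnit (g x).det) (T : Comp₂) : contract g' T x = k⁻¹ * contract g T x := by
  simp only [contract, hg, inv_smul_matrix hk hu, Matrix.smul_apply, smul_eq_mul, Finset.mul_sum,
    mul_assoc]

theorem inner₁_smul {k : ℝ} (hk : k ≠ 0) {g' : Comp₂} (hg : g' x = k • g x)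
    (hu : IsUnit (g x).det) (η ξ : Comp₁) : inner₁ g' η ξ x = k⁻¹ * inner₁ g η ξ x := by
  simp only [inner₁, hg, inv_smul_matrix hk hu, Matrix.smul_apply, smul_eq_mul, Finset.mul_sum,
    mul_assoc]

theorem weylConnection_eq_christoffel (h : ∀ a, Q x a = 0) (c a b : Fin 4) :
    weylConnection g Q x c a b = christoffel g x c a b := by
  simp [weylConnection, weylDifference, h]

/-- The Weyl connection is invariant under `g ↦ u g`, `Q ↦ Q - d ln u`. -/
theorem IsMetricOn.weylConnection_smul (H : IsMetricOn U g Q) (hx : x ∈ U) {u : Coord → ℝ}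
    (hu : DifferentiableAt ℝ u x) (h0 : u x ≠ 0) (c a b : Fin 4) :
    weylConnection (fun y => u y • g y)
      (fun y a => Q y a - grad (fun z => Real.log (u z)) y a) x c a b
      = weylConnection g Q x c a b := by
  have h1 : ∀ d, weylLower (fun y => u y • g y)
      (fun y a => Q y a - grad (fun z => Real.log (u z)) y a) x d a b
      = u x * weylLower g Q x d a b := by
    intro d
    have hp : ∀ e i j, pd e (fun y => u y * g y i j) x =
        pd e u x * g x i j + u x * pd e (fun y => g y i j) x := fun e i j =>
      pd_mul hu ((H.metric_at hx i j).differentiableAt (by simp))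
    simp only [weylLower, grad, pd_log hu h0, Matrix.smul_apply, smul_eq_mul, hp]
    field_simp
    ring
  simp only [weylConnection_eq_weylLower, h1, inv_smul_matrix h0 (H.isUnit_det hx),
    Matrix.smul_apply, smul_eq_mul]
  congr 1
  exact Finset.sum_congr rfl fun d _ => by field_simp

theorem IsMetricOn.einstein_smul (H : IsMetricOn U g Q) (hx : x ∈ U) {k : ℝ} (hk : k ≠ 0) {g' : Comp₂}
    (hg : g' x = k • g x) (Γ : Comp₃) (a b : Fin 4) : einstein g' Γ x a b =
      symPart (ricci Γ) x a b - (1 / 2) * scalarCurvature g Γ x * g x a b := by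
  have := contract_smul hk hg (H.isUnit_det hx) (ricci Γ)
  rw [einstein, show scalarCurvature g' Γ x = _ from this, hg]
  simp only [Matrix.smul_apply, smul_eq_mul]
  rw [show contract g (ricci Γ) x = scalarCurvature g Γ x from rfl]
  field_simp

namespace IsFieldOn

theorem scalarField_at (H : IsFieldOn U f Q g Γ) (hpos : ∀ x ∈ U, 0 < fPrime f g Γ x)
    (hx : x ∈ U) : ContDiffAt ℝ ∞ (scalarField f g Γ) x :=
  (H.fPrime_at hx).log (hpos x hx).ne'

theorem gradScalarField_at (H : IsFieldOn U f Q g Γ) (hpos : ∀ x ∈ U, 0 < fPrime f g Γ x)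
    (hx : x ∈ U) (a : Fin 4) : ContDiffAt ℝ ∞ (fun y => grad (scalarField f g Γ) y a) x :=
  ContDiffAt.pd (k := ⊤) (m := ⊤) (H.scalarField_at hpos hx) le_top

theorem grad_fPrime (H : IsFieldOn U f Q g Γ) (hpos : ∀ x ∈ U, 0 < fPrime f g Γ x)
    (hx : x ∈ U) (a : Fin 4) :
    grad (fPrime f g Γ) x a = fPrime f g Γ x * grad (scalarField f g Γ) x a := by
  have h := pd_log (a := a) ((H.fPrime_at hx).differentiableAt (by simp)) (hpos x hx).ne'
  rw [grad, grad, show pd a (scalarField f g Γ) x = _ from h,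
    mul_inv_cancel_left₀ (hpos x hx).ne']

/-- `∇_a ∇_b f' = f' (∇_a ∇_b φ + ∇_a φ ∇_b φ)`. -/
theorem hessian_fPrime (H : IsFieldOn U f Q g Γ) (hpos : ∀ x ∈ U, 0 < fPrime f g Γ x)
    (hx : x ∈ U) (a b : Fin 4) :
    hessian Γ (fPrime f g Γ) x a b = fPrime f g Γ x * (covDeriv Γ (grad (scalarField f g Γ)) x a b
      + grad (scalarField f g Γ) x a * grad (scalarField f g Γ) x b) := by
  have h1 : pd a (fun y => grad (fPrime f g Γ) y b) x =
      pd a (fun y => fPrime f g Γ y * grad (scalarField f g Γ) y b) x :=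
    pd_congr_on H.isOpen (fun y hy => H.grad_fPrime hpos hy b) hx
  rw [hessian, covDeriv, h1, pd_mul ((H.fPrime_at hx).differentiableAt (by simp))
    ((H.gradScalarField_at hpos hx b).differentiableAt (by simp))]
  have h2 : pd a (fPrime f g Γ) x = fPrime f g Γ x * grad (scalarField f g Γ) x a :=
    H.grad_fPrime hpos hx a
  have h3 : ∑ c, Γ x c a b * (fPrime f g Γ x * grad (scalarField f g Γ) x c) =
      fPrime f g Γ x * ∑ c, Γ x c a b * grad (scalarField f g Γ) x c := by
    rw [Finset.mul_sum]; exact Finset.sum_congr rfl fun c _ => by ring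
  simp only [H.grad_fPrime hpos hx, h2, h3, covDeriv]
  ring

theorem contract_hessian_fPrime (H : IsFieldOn U f Q g Γ)
    (hpos : ∀ x ∈ U, 0 < fPrime f g Γ x) (hx : x ∈ U) :
    contract g (hessian Γ (fPrime f g Γ)) x = fPrime f g Γ x *
      (contract g (covDeriv Γ (grad (scalarField f g Γ))) x
        + inner₁ g (grad (scalarField f g Γ)) (grad (scalarField f g Γ)) x) := by
  simp only [contract, inner₁, H.hessian_fPrime hpos hx, ← Finset.sum_add_distrib, Finset.mul_sum]
  exact Finset.sum_congr rfl fun a _ => Finset.sum_congr rfl fun b _ => by ring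

theorem weylConnection_conformal (H : IsFieldOn U f Q g Γ)
    (hpos : ∀ x ∈ U, 0 < fPrime f g Γ x) (hx : x ∈ U) (c a b : Fin 4) :
    weylConnection (conformalMetric f g Γ) (conformalOneForm f Q g Γ) x c a b
      = weylConnection g Q x c a b :=
  H.weylConnection_smul hx ((H.fPrime_at hx).differentiableAt (by simp)) (hpos x hx).ne' c a b

/-- In the conformal frame the metric field equation is divided by `f'`. -/
theorem fieldOperator_sub_weylSource_conformal (H : IsFieldOn U f Q g Γ)
    (hpos : ∀ x ∈ U, 0 < fPrime f g Γ x)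
    (hΓ' : ∀ y ∈ U, ∀ c a b, Γ' y c a b = Γ y c a b) (hx : x ∈ U) (a b : Fin 4) :
    fieldOperator f g Γ x a b - weylSource f Q g Γ x a b = fPrime f g Γ x *
      (einstein (conformalMetric f g Γ) Γ' x a b
        - (conformalSource (conformalMetric f g Γ) Γ' (conformalOneForm f Q g Γ) x a b
          - conformalMetric f g Γ x a b * potential f (scalarCurvature g Γ x))) := by
  have hF := (hpos x hx).ne'
  have hgF : conformalMetric f g Γ x = fPrime f g Γ x • g x := rfl
  have hu := H.isUnit_det hx
  set η := grad (scalarField f g Γ) with hη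
  have hQd : ∀ a b, covDeriv Γ' (conformalOneForm f Q g Γ) x a b =
      covDeriv Γ Q x a b - covDeriv Γ η x a b := by
    intro a b
    rw [covDeriv_congr_connection (hΓ' x hx)]
    simp only [covDeriv, conformalOneForm, mul_sub, Finset.sum_sub_distrib]
    rw [pd_sub ((H.oneForm_at hx b).differentiableAt (by simp))
      ((H.gradScalarField_at hpos hx b).differentiableAt (by simp))]
    ring
  have hc : contract (conformalMetric f g Γ) (covDeriv Γ' (conformalOneForm f Q g Γ)) x =
      (fPrime f g Γ x)⁻¹ * (contract g (covDeriv Γ Q) x - contract g (covDeriv Γ η) x) := by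
    rw [contract_smul hF hgF hu]
    simp only [contract, hQd, mul_sub, Finset.sum_sub_distrib]
  have hi : inner₁ (conformalMetric f g Γ) (conformalOneForm f Q g Γ) (conformalOneForm f Q g Γ) x
      = (fPrime f g Γ x)⁻¹ * (inner₁ g Q Q x - 2 * inner₁ g Q η x + inner₁ g η η x) := by
    rw [inner₁_smul hF hgF hu]
    have hs : inner₁ g η Q x = inner₁ g Q η x := by
      rw [inner₁, inner₁, Finset.sum_comm]
      exact Finset.sum_congr rfl fun d _ => Finset.sum_congr rfl fun c _ => by
        rw [H.inv_symm hx c d]; ring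
    rw [two_mul]
    nth_rewrite 1 [← hs]
    simp only [inner₁, conformalOneForm, ← Finset.sum_add_distrib, ← Finset.sum_sub_distrib]
    congr 1
    exact Finset.sum_congr rfl fun d _ => Finset.sum_congr rfl fun c _ => by
      simp only [hη]; ring
  have hie : inner₁ g Q (grad (fPrime f g Γ)) x = fPrime f g Γ x * inner₁ g Q η x := by
    simp only [inner₁, H.grad_fPrime hpos hx, Finset.mul_sum]
    exact Finset.sum_congr rfl fun d _ => Finset.sum_congr rfl fun c _ => by ring
  have he : einstein (conformalMetric f g Γ) Γ' x a b =
      symPart (ricci Γ) x a b - (1 / 2) * scalarCurvature g Γ x * g x a b := by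
    rw [← H.einstein_smul hx hF hgF Γ]
    simp only [einstein, symPart, scalarCurvature, ricci_congr H.isOpen hΓ' hx]
  have hs : hessian Γ (fPrime f g Γ) x a b = fPrime f g Γ x *
      ((1 / 2) * (covDeriv Γ η x a b + covDeriv Γ η x b a) + η x a * η x b) := by
    linear_combination (1 / 2) * H.hessian_symm hx a b + (1 / 2) * H.hessian_fPrime hpos hx a b
      + (1 / 2) * H.hessian_fPrime hpos hx b a
  have hV : fPrime f g Γ x * potential f (scalarCurvature g Γ x) * fPrime f g Γ x =
      (1 / 2) * (scalarCurvature g Γ x * fPrime f g Γ x - f (scalarCurvature g Γ x)) := by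
    have : deriv f (scalarCurvature g Γ x) ≠ 0 := hF
    simp only [potential, fPrime]
    field_simp
  rw [fieldOperator, weylSource, he, conformalSource, hc, hi, hie,
    H.contract_hessian_fPrime hpos hx, hs, H.grad_fPrime hpos hx, H.grad_fPrime hpos hx, hgF]
  simp only [symPart, hQd, conformalOneForm, Matrix.smul_apply, smul_eq_mul, ← hη]
  field_simp
  linear_combination (-2 * g x a b) * hV

end IsFieldOn

/-- The scalar curvature is recovered from `φ = ln f'` by the inverse function of `f'`. -/
theorem potential_eq_scalarPotential (hf : ContDiff ℝ ∞ f) (h2 : ∀ r, deriv (deriv f) r ≠ 0)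
    {r : ℝ} (hr : 0 < deriv f r) : potential f r = scalarPotential f (Real.log (deriv f r)) := by
  have hd : Differentiable ℝ (deriv f) :=
    (contDiff_infty_iff_deriv.1 hf).2.differentiable (by simp)
  have hlt : ∀ a b, a < b → deriv f a ≠ deriv f b := fun a b hab he =>
    let ⟨c, _, hc⟩ := exists_deriv_eq_zero hab hd.continuous.continuousOn he
    h2 c hc
  have hinj : Function.Injective (deriv f) := fun a b he => by
    rcases lt_trichotomy a b with hab | hab | hab
    exacts [absurd he (hlt a b hab), hab, absurd he.symm (hlt b a hab)]
  rw [scalarPotential, Real.exp_log hr, Function.leftInverse_invFun hinj r]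

end Conformal

/-! ### The Einstein tensor of a conformally related metric -/

section ConformalEinstein

open Matrix

/-- The Ricci tensor of `Γ + S` at a point, where `Γ` is the Levi-Civita connection of `g` and `S`
the difference tensor of Weyl geometry for `η_a = g_ad V^d`. Here `N e c` stands for `∇_e V^c`, and
`dg`, `dη`, `dV`, `dS` for the partial derivatives. -/
theorem conformal_ricci_algebra {g : Fin 4 → Fin 4 → ℝ} {Γ S : Fin 4 → Fin 4 → Fin 4 → ℝ}
    {η V : Fin 4 → ℝ} {N dV dη : Fin 4 → Fin 4 → ℝ}
    {dg : Fin 4 → Fin 4 → Fin 4 → ℝ} {dS : Fin 4 → Fin 4 → Fin 4 → Fin 4 → ℝ}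
    (hg : ∀ a b, g a b = g b a) (hΓ : ∀ c a b, Γ c a b = Γ c b a)
    (hη : ∀ a, η a = ∑ d, g a d * V d)
    (hS : ∀ c a b, S c a b = (1 / 2) * ((if c = a then η b else 0) + (if c = b then η a else 0)
      - g a b * V c))
    (hdg : ∀ e a b, dg e a b = ∑ c, g b c * Γ c a e + ∑ c, g a c * Γ c b e)
    (hdV : ∀ e c, dV e c = N e c - ∑ d, Γ c e d * V d)
    (hdη : ∀ e a, dη e a = ∑ d, (dg e a d * V d + g a d * dV e d))
    (hdS : ∀ e c a b, dS e c a b = (1 / 2) * ((if c = a then dη e b else 0)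
      + (if c = b then dη e a else 0) - (dg e a b * V c + g a b * dV e c)))
    (a b : Fin 4) :
    (∑ c, (dS c c a b - dS b c a c)) + ∑ c, ∑ d, ((Γ c c d + S c c d) * (Γ d a b + S d a b)
        - (Γ c b d + S c b d) * (Γ d a c + S d a c))
      - ∑ c, ∑ d, (Γ c c d * Γ d a b - Γ c b d * Γ d a c) =
    (1 / 2) * ((dη a b - ∑ c, Γ c a b * η c) + (dη b a - ∑ c, Γ c b a * η c))
      - 2 * (dη b a - ∑ c, Γ c b a * η c) - (1 / 2) * g a b * ∑ c, N c c
      + (1 / 2) * η a * η b - (1 / 2) * g a b * ∑ c, V c * η c := by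
  have hSs : ∀ c a b, S c a b = S c b a := fun c a b => by rw [hS, hS, hg a b]; ring
  -- contraction of the upper index of `S` with an arbitrary covector
  have low : ∀ (X : Fin 4 → ℝ) (a b : Fin 4), ∑ d, S d a b * X d =
      (1 / 2) * (X a * η b + X b * η a - g a b * ∑ d, V d * X d) := by
    intro X a b
    have h1 : X a * η b = ∑ d, (if d = a then η b else 0) * X d := by simp [mul_comm]
    have h2 : X b * η a = ∑ d, (if d = b then η a else 0) * X d := by simp [mul_comm]
    rw [h1, h2, Finset.mul_sum, ← Finset.sum_add_distrib, ← Finset.sum_sub_distrib, Finset.mul_sum]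
    exact Finset.sum_congr rfl fun d _ => by rw [hS]; ring
  have tr : ∀ d, ∑ c, S c c d = 2 * η d := by
    intro d
    have h1 : ∀ c, S c c d =
        (1 / 2) * (η d + (if c = d then η d else 0) - g d c * V c) := fun c => by
      rw [hS, hg c d]; by_cases h : c = d <;> simp [h]
    simp only [h1, ← Finset.mul_sum, Finset.sum_sub_distrib, Finset.sum_add_distrib, ← hη]
    simp; ring
  have dtr : ∑ c, dS b c a c = 2 * dη b a := by
    have h1 : ∀ c, dS b c a c = (1 / 2) * ((if c = a then dη b a else 0) + dη b a
        - (dg b a c * V c + g a c * dV b c)) := fun c => by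
      rw [hdS]; by_cases h : c = a <;> simp [h]
    simp only [h1, ← Finset.mul_sum, Finset.sum_sub_distrib, Finset.sum_add_distrib (s := Finset.univ)
      (f := fun c => if c = a then dη b a else 0), ← hdη]
    simp; ring
  have div : ∑ c, dS c c a b = (1 / 2) * (dη a b + dη b a - ∑ c, dg c a b * V c
      - g a b * ∑ c, dV c c) := by
    simp only [hdS, ← Finset.mul_sum, Finset.sum_sub_distrib, Finset.sum_add_distrib]
    simp; ring
  have hdgV : ∑ c, dg c a b * V c =
      ∑ c, g b c * ∑ d, V d * Γ c a d + ∑ c, g a c * ∑ d, V d * Γ c b d := by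
    simp only [hdg, Finset.sum_mul, add_mul, Finset.sum_add_distrib, Finset.mul_sum]
    congr 1 <;> rw [Finset.sum_comm] <;>
      exact Finset.sum_congr rfl fun c _ => Finset.sum_congr rfl fun d _ => by ring
  have hdVt : ∑ c, dV c c = ∑ c, N c c - ∑ d, V d * ∑ c, Γ c c d := by
    simp only [hdV, Finset.sum_sub_distrib, Finset.mul_sum]
    rw [Finset.sum_comm (f := fun d c => V d * Γ c c d)]
    congr 1
    exact Finset.sum_congr rfl fun c _ => Finset.sum_congr rfl fun d _ => by ring
  -- the terms linear in `S`
  have l1 : ∑ c, ∑ d, Γ c c d * S d a b =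
      (1 / 2) * ((∑ c, Γ c c a) * η b + (∑ c, Γ c c b) * η a
        - g a b * ∑ d, V d * ∑ c, Γ c c d) := by
    rw [← low fun d => ∑ c, Γ c c d, Finset.sum_comm]
    exact Finset.sum_congr rfl fun d _ => by
      rw [Finset.mul_sum]; exact Finset.sum_congr rfl fun c _ => mul_comm _ _
  have trT : ∀ T : Fin 4 → ℝ, ∑ c, ∑ d, S c c d * T d = 2 * ∑ d, η d * T d := fun T => by
    rw [Finset.sum_comm, Finset.mul_sum]
    exact Finset.sum_congr rfl fun d _ => by rw [← Finset.sum_mul, tr]; ring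
  have l2 : ∀ a b, ∑ c, ∑ d, Γ c b d * S d a c = (1 / 2) * (∑ c, Γ c a b * η c
      + (∑ c, Γ c c b) * η a - ∑ c, g a c * ∑ d, V d * Γ c b d) := by
    intro a b
    have h1 : ∀ c, ∑ d, Γ c b d * S d a c = (1 / 2) * (Γ c a b * η c + Γ c c b * η a
        - g a c * ∑ d, V d * Γ c b d) := fun c => by
      rw [hΓ c a b, hΓ c c b, ← low (fun d => Γ c b d) a c]
      exact Finset.sum_congr rfl fun d _ => mul_comm _ _
    simp only [h1, ← Finset.mul_sum, Finset.sum_sub_distrib, Finset.sum_add_distrib,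
      ← Finset.sum_mul]
  have l3 : ∑ c, ∑ d, S c b d * Γ d a c = ∑ c, ∑ d, Γ c a d * S d b c := by
    rw [Finset.sum_comm]
    exact Finset.sum_congr rfl fun d _ => Finset.sum_congr rfl fun c _ => mul_comm _ _
  -- the terms quadratic in `S`
  have hηη : ∑ d, S d a b * η d = (1 / 2) * (2 * η a * η b - g a b * ∑ d, V d * η d) := by
    rw [low]; ring
  have q : ∑ c, ∑ d, S c b d * S d a c =
      (3 / 2) * η a * η b - (1 / 2) * g a b * ∑ d, V d * η d := by
    have h1 : ∀ d, ∑ c, S c b d * S d a c = (1 / 2) * (S d a b * η d + S d d a * η b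
        - g b d * ∑ c, V c * S d a c) := fun d => by
      rw [hSs d d a]; exact low (fun c => S d a c) b d
    have h2 : ∑ d, g b d * ∑ c, V c * S d a c = (1 / 2) * (g a b * ∑ d, V d * η d) := by
      have h3 : ∑ d, g b d * ∑ c, V c * S d a c = ∑ c, V c * ∑ d, S d a c * g b d := by
        simp only [Finset.mul_sum]
        rw [Finset.sum_comm]
        exact Finset.sum_congr rfl fun c _ => Finset.sum_congr rfl fun d _ => by ring
      have h4 : ∀ c, V c * ∑ d, S d a c * g b d =
          (1 / 2) * (g a b * (V c * η c) + η a * (g b c * V c) - η b * (g a c * V c)) := by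
        intro c
        have h5 : ∑ d, V d * g b d = η b := by
          rw [hη]; exact Finset.sum_congr rfl fun d _ => mul_comm _ _
        rw [low, h5, hg a b]; ring
      simp only [h3, h4, ← Finset.mul_sum, Finset.sum_sub_distrib, Finset.sum_add_distrib, ← hη]
      ring
    rw [Finset.sum_comm]
    simp only [h1, ← Finset.mul_sum, Finset.sum_sub_distrib, Finset.sum_add_distrib,
      ← Finset.sum_mul, tr, h2, hηη]
    ring
  have hsplit : ∑ c, ∑ d, ((Γ c c d + S c c d) * (Γ d a b + S d a b)
        - (Γ c b d + S c b d) * (Γ d a c + S d a c))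
      - ∑ c, ∑ d, (Γ c c d * Γ d a b - Γ c b d * Γ d a c) =
      ∑ c, ∑ d, Γ c c d * S d a b + ∑ c, ∑ d, S c c d * Γ d a b + ∑ c, ∑ d, S c c d * S d a b
        - ∑ c, ∑ d, Γ c b d * S d a c - ∑ c, ∑ d, S c b d * Γ d a c
        - ∑ c, ∑ d, S c b d * S d a c := by
    simp only [← Finset.sum_sub_distrib, ← Finset.sum_add_distrib]
    exact Finset.sum_congr rfl fun c _ => Finset.sum_congr rfl fun d _ => by ring
  have hΓη : ∀ a b, ∑ d, η d * Γ d a b = ∑ d, Γ d a b * η d := fun a b =>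
    Finset.sum_congr rfl fun d _ => mul_comm _ _
  have hSη : ∑ d, η d * S d a b = ∑ d, S d a b * η d :=
    Finset.sum_congr rfl fun d _ => mul_comm _ _
  have hba : ∑ c, Γ c b a * η c = ∑ c, Γ c a b * η c :=
    Finset.sum_congr rfl fun c _ => by rw [hΓ]
  rw [add_sub_assoc, hsplit, Finset.sum_sub_distrib, div, dtr, hdgV, hdVt, l1, trT, trT, l2, l3,
    l2, q, hΓη, hSη, hηη, hba]
  ring

variable {U : Set Coord} {f : ℝ → ℝ} {Q : Comp₁} {g : Comp₂} {Γ Γ' : Comp₃} {x : Coord}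

theorem IsMetricOn.sum_metric_mul_inv (H : IsMetricOn U g Q) (hx : x ∈ U) (η : Fin 4 → ℝ)
    (a : Fin 4) : ∑ d, g x a d * ∑ e, (g x)⁻¹ d e * η e = η a := by
  have h := congrFun (congrArg (fun A => A *ᵥ η)
    (Matrix.mul_nonsing_inv _ (H.isUnit_det hx))) a
  simp only [← Matrix.mulVec_mulVec, Matrix.one_mulVec] at h
  exact h

theorem IsMetricOn.weylDifference_eq (H : IsMetricOn U g Q) (hx : x ∈ U) (η : Comp₁)
    (c a b : Fin 4) : weylDifference g η x c a b =
      (1 / 2) * ((if c = a then η x b else 0) + (if c = b then η x a else 0)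
        - g x a b * ∑ d, (g x)⁻¹ c d * η x d) := by
  have hδ : ∀ a, ∑ d, (g x)⁻¹ c d * g x a d = if c = a then 1 else 0 := fun a => by
    have := congrFun (congrFun (Matrix.nonsing_inv_mul _ (H.isUnit_det hx)) c) a
    rw [Matrix.mul_apply, Matrix.one_apply] at this
    rw [← this]
    exact Finset.sum_congr rfl fun d _ => by rw [H.symm x hx a d]
  have e1 : (if c = a then η x b else 0) = η x b * ∑ d, (g x)⁻¹ c d * g x a d := by
    rw [hδ]; split_ifs <;> ring
  have e2 : (if c = b then η x a else 0) = η x a * ∑ d, (g x)⁻¹ c d * g x b d := by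
    rw [hδ]; split_ifs <;> ring
  rw [e1, e2, weylDifference]
  congr 1
  simp only [Finset.mul_sum, ← Finset.sum_add_distrib, ← Finset.sum_sub_distrib]
  exact Finset.sum_congr rfl fun d _ => by rw [H.symm x hx d b]; ring

/-- The Ricci tensor of a Weyl connection whose one-form `η` is arbitrary, in terms of that of the
Levi-Civita connection. -/
theorem IsMetricOn.ricci_add_weylDifference (H : IsMetricOn U g fun _ _ => 0)
    (hΓ : ∀ y ∈ U, ∀ c a b, Γ y c a b = christoffel g y c a b) {η : Comp₁}
    (hη : ∀ y ∈ U, ∀ a, ContDiffAt ℝ ∞ (fun z => η z a) y)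
    (hΓ' : ∀ y ∈ U, ∀ c a b, Γ' y c a b = Γ y c a b + weylDifference g η y c a b)
    (hx : x ∈ U) (a b : Fin 4) :
    ricci Γ' x a b = ricci Γ x a b
      + (1 / 2) * (covDeriv Γ η x a b + covDeriv Γ η x b a) - 2 * covDeriv Γ η x b a
      - (1 / 2) * g x a b * contract g (covDeriv Γ η) x
      + (1 / 2) * η x a * η x b - (1 / 2) * g x a b * inner₁ g η η x := by
  have hW : ∀ y ∈ U, ∀ c a b, Γ y c a b = weylConnection g (fun _ _ => 0) y c a b :=
    fun y hy c a b => by rw [hΓ y hy, weylConnection_eq_christoffel fun _ => rfl]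
  set V : Comp₁ := fun y c => ∑ d, (g y)⁻¹ c d * η y d with hV
  have hVat : ∀ c, ContDiffAt ℝ ∞ (fun y => V y c) x := fun c =>
    ContDiffAt.sum fun d _ => (H.inv_at hx c d).mul (hη x hx d)
  have hVd := fun c => (hVat c).differentiableAt (by simp)
  have hgd := fun a b => (H.metric_at hx a b).differentiableAt (by simp)
  have hηd := fun a => (hη x hx a).differentiableAt (by simp)
  have hif : ∀ (c a b : Fin 4) (e : Fin 4), DifferentiableAt ℝ
      (fun y => if c = a then η y b else 0) x ∧
      pd e (fun y => if c = a then η y b else 0) x =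
        if c = a then pd e (fun y => η y b) x else 0 := by
    intro c a b e
    split_ifs
    exacts [⟨hηd b, rfl⟩, ⟨differentiableAt_const _, pd_const _⟩]
  have hdS : ∀ e c a b, pd e (fun y => weylDifference g η y c a b) x =
      (1 / 2) * ((if c = a then pd e (fun y => η y b) x else 0)
        + (if c = b then pd e (fun y => η y a) x else 0)
        - (pd e (fun y => g y a b) x * V x c + g x a b * pd e (fun y => V y c) x)) := by
    intro e c a b
    rw [pd_congr_on H.isOpen (fun y hy => H.weylDifference_eq hy η c a b) hx,
      pd_const_mul _ (((hif c a b e).1.fun_add (hif c b a e).1).fun_sub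
        ((hgd a b).fun_mul (hVd c))),
      pd_sub ((hif c a b e).1.fun_add (hif c b a e).1) ((hgd a b).fun_mul (hVd c)),
      pd_add (hif c a b e).1 (hif c b a e).1, (hif c a b e).2, (hif c b a e).2,
      pd_mul (hgd a b) (hVd c)]
  have hSd : ∀ c a b, DifferentiableAt ℝ (fun y => weylDifference g η y c a b) x := by
    intro c a b
    have : (fun y => weylDifference g η y c a b) =ᶠ[nhds x] fun y =>
        (1 / 2) * ((if c = a then η y b else 0) + (if c = b then η y a else 0)
          - g y a b * V y c) :=
      Filter.eventually_of_mem (H.isOpen.mem_nhds hx) fun y hy => H.weylDifference_eq hy η c a b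
    refine DifferentiableAt.congr_of_eventuallyEq ?_ this
    exact (((hif c a b 0).1.fun_add (hif c b a 0).1).fun_sub
        ((hgd a b).fun_mul (hVd c))).const_mul _
  have hΓd : ∀ c a b, DifferentiableAt ℝ (fun y => Γ y c a b) x := fun c a b =>
    ((H.weylConnection_at hx c a b).differentiableAt (by simp)).congr_of_eventuallyEq
      (Filter.eventually_of_mem (H.isOpen.mem_nhds hx) fun y hy => hW y hy c a b)
  have hpd : ∀ e c a b, pd e (fun y => Γ' y c a b) x =
      pd e (fun y => Γ y c a b) x + pd e (fun y => weylDifference g η y c a b) x := by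
    intro e c a b
    rw [pd_congr_on H.isOpen (fun y hy => hΓ' y hy c a b) hx, pd_add (hΓd c a b) (hSd c a b)]
  have hdη : ∀ e a, pd e (fun y => η y a) x =
      ∑ d, (pd e (fun y => g y a d) x * V x d + g x a d * pd e (fun y => V y d) x) := by
    intro e a
    rw [pd_congr_on H.isOpen (fun y hy => (H.sum_metric_mul_inv hy (η y) a).symm) hx,
      pd_sum fun d _ => (hgd a d).fun_mul (hVd d)]
    exact Finset.sum_congr rfl fun d _ => pd_mul (hgd a d) (hVd d)
  have hdV : ∀ e c, pd e (fun y => V y c) x =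
      (∑ k, (g x)⁻¹ c k * covDeriv Γ η x e k) - ∑ d, Γ x c e d * V x d := by
    intro e c
    have h := H.pd_raise hx hηd e c
    have hc : ∀ k, covDeriv (weylConnection g fun _ _ => 0) η x e k = covDeriv Γ η x e k :=
      fun k => by simp only [covDeriv, hW x hx]
    simp only [hc, ← hW x hx] at h
    rw [h]; ring
  have key := conformal_ricci_algebra (g := g x) (Γ := Γ x) (S := weylDifference g η x)
    (η := η x) (V := V x) (N := fun e c => ∑ k, (g x)⁻¹ c k * covDeriv Γ η x e k)
    (dV := fun e c => pd e (fun y => V y c) x) (dη := fun e a => pd e (fun y => η y a) x)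
    (dg := fun e a b => pd e (fun y => g y a b) x)
    (dS := fun e c a b => pd e (fun y => weylDifference g η y c a b) x)
    (H.symm x hx) (fun c a b => by rw [hW x hx, hW x hx, H.weylConnection_symm hx])
    (fun a => (H.sum_metric_mul_inv hx (η x) a).symm) (H.weylDifference_eq hx η)
    (fun e a b => by rw [H.pd_metric hx]; simp only [hW x hx, zero_mul, sub_zero])
    hdV hdη hdS a b
  have hin : inner₁ g η η x = ∑ c, V x c * η x c := by
    simp only [inner₁, hV, Finset.sum_mul]
    rw [Finset.sum_comm]
    exact Finset.sum_congr rfl fun d _ => Finset.sum_congr rfl fun c _ => by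
      rw [H.inv_symm hx c d]
  have hR : ricci Γ' x a b - ricci Γ x a b = _ :=
    Eq.trans (by
      simp only [ricci, hpd, hΓ' x hx, Finset.sum_add_distrib, Finset.sum_sub_distrib]
      ring) key
  rw [hin, ← sub_eq_zero]
  rw [← sub_eq_zero] at hR
  refine Eq.trans ?_ hR
  simp only [covDeriv, contract]
  ring

/-- For vanishing Weyl one-form, the difference of the two sides of the field equation is `f'` times
the corresponding difference for the Einstein equations of `f' g` with the scalar `φ = ln f'` as
source. -/
theorem IsFieldOn.fieldOperator_kinetic (H : IsFieldOn U f Q g Γ)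
    (hpos : ∀ x ∈ U, 0 < fPrime f g Γ x)
    (hΓ : ∀ y ∈ U, ∀ c a b, Γ y c a b = christoffel g y c a b) (hx : x ∈ U) (a b : Fin 4) :
    fieldOperator f g Γ x a b = fPrime f g Γ x *
      (einstein (conformalMetric f g Γ) (christoffel (conformalMetric f g Γ)) x a b
        - (kineticSource (conformalMetric f g Γ) (scalarField f g Γ) x a b
          - conformalMetric f g Γ x a b * potential f (scalarCurvature g Γ x))) := by
  have hF := (hpos x hx).ne'
  have hgF : conformalMetric f g Γ x = fPrime f g Γ x • g x := rfl
  have hu := H.isUnit_det hx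
  set η := grad (scalarField f g Γ) with hη
  have Hη : ∀ y ∈ U, ∀ a, ContDiffAt ℝ ∞ (fun z => η z a) y := fun y hy a =>
    H.gradScalarField_at hpos hy a
  have H0 : IsMetricOn U g fun _ _ => 0 :=
    { H.toIsMetricOn with smooth_oneForm := fun _ => contDiffOn_const }
  have Hg : IsMetricOn U g η :=
    { H.toIsMetricOn with smooth_oneForm := fun a y hy => (Hη y hy a).contDiffWithinAt }
  -- the Levi-Civita connection of `f' g` is the Weyl connection of `(g, dφ)`
  have hΓ' : ∀ y ∈ U, ∀ c a b, christoffel (conformalMetric f g Γ) y c a b =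
      Γ y c a b + weylDifference g η y c a b := by
    intro y hy c a b
    have h := Hg.weylConnection_smul hy ((H.fPrime_at hy).differentiableAt (by simp))
      (hpos y hy).ne' c a b
    rw [weylConnection_eq_christoffel fun a => sub_self _] at h
    rw [hΓ y hy]
    exact h
  have hR := fun a b => H0.ricci_add_weylDifference hΓ Hη hΓ' hx a b
  have hsc : scalarCurvature g (christoffel (conformalMetric f g Γ)) x =
      scalarCurvature g Γ x - 3 * contract g (covDeriv Γ η) x - (3 / 2) * inner₁ g η η x := by
    have hT : ∑ a, ∑ b, (g x)⁻¹ a b * covDeriv Γ η x b a = contract g (covDeriv Γ η) x := by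
      rw [contract, Finset.sum_comm]
      exact Finset.sum_congr rfl fun d _ => Finset.sum_congr rfl fun c _ => by
        rw [H.inv_symm hx c d]
    have h4 := H.sum_inv_mul_metric hx
    have : scalarCurvature g (christoffel (conformalMetric f g Γ)) x =
        scalarCurvature g Γ x + (1 / 2) * (∑ a, ∑ b, (g x)⁻¹ a b * covDeriv Γ η x a b)
        - (3 / 2) * (∑ a, ∑ b, (g x)⁻¹ a b * covDeriv Γ η x b a)
        - (1 / 2) * (contract g (covDeriv Γ η) x + inner₁ g η η x)
          * (∑ a, ∑ b, (g x)⁻¹ a b * g x a b)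
        + (1 / 2) * ∑ a, ∑ b, (g x)⁻¹ a b * η x a * η x b := by
      simp only [scalarCurvature, hR]
      generalize contract g (covDeriv Γ η) x = t
      generalize inner₁ g η η x = i
      simp only [Finset.mul_sum, ← Finset.sum_add_distrib, ← Finset.sum_sub_distrib]
      exact Finset.sum_congr rfl fun a _ => Finset.sum_congr rfl fun b _ => by ring
    rw [show ∑ a, ∑ b, (g x)⁻¹ a b * covDeriv Γ η x a b = contract g (covDeriv Γ η) x from rfl,
      show ∑ a, ∑ b, (g x)⁻¹ a b * η x a * η x b = inner₁ g η η x from rfl] at this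
    rw [this, hT, h4]
    ring
  have he := H.einstein_smul hx hF hgF (christoffel (conformalMetric f g Γ)) a b
  have hV : fPrime f g Γ x * potential f (scalarCurvature g Γ x) * fPrime f g Γ x =
      (1 / 2) * (scalarCurvature g Γ x * fPrime f g Γ x - f (scalarCurvature g Γ x)) := by
    have : deriv f (scalarCurvature g Γ x) ≠ 0 := hF
    simp only [potential, fPrime]
    field_simp
  have hs : hessian Γ (fPrime f g Γ) x a b = fPrime f g Γ x *
      ((1 / 2) * (covDeriv Γ η x a b + covDeriv Γ η x b a) + η x a * η x b) := by
    linear_combination (1 / 2) * H.hessian_symm hx a b + (1 / 2) * H.hessian_fPrime hpos hx a b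
      + (1 / 2) * H.hessian_fPrime hpos hx b a
  rw [fieldOperator, he, hsc, kineticSource, inner₁_smul hF hgF hu,
    H.contract_hessian_fPrime hpos hx, hs, hgF]
  simp only [symPart, hR, Matrix.smul_apply, smul_eq_mul, ← hη]
  rw [H.symm x hx b a]
  field_simp
  linear_combination (-4 * g x a b) * hV

end ConformalEinstein

/-! ### From coordinate domains to the manifold -/

section Global

open Matrix

theorem IsLorentzian.symm {A : Matrix (Fin 4) (Fin 4) ℝ} (hA : IsLorentzian A) (a b : Fin 4) :
    A a b = A b a := by
  obtain ⟨P, hP, h⟩ := hA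
  have h1 : A = (P⁻¹)ᵀ * Matrix.diagonal ![-1, 1, 1, 1] * P⁻¹ := by
    have hPt : IsUnit Pᵀ.det := by rwa [Matrix.det_transpose]
    rw [← h, Matrix.transpose_nonsing_inv, Matrix.mul_assoc Pᵀ,
      Matrix.nonsing_inv_mul_cancel_left _ _ hPt, Matrix.mul_nonsing_inv_cancel_right _ _ hP]
  have h2 : Aᵀ = A := by
    rw [h1, Matrix.transpose_mul, Matrix.transpose_mul, Matrix.transpose_transpose,
      Matrix.diagonal_transpose, Matrix.mul_assoc]
  exact congrFun (congrFun h2 b) a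

theorem IsLorentzian.det_neg {A : Matrix (Fin 4) (Fin 4) ℝ} (hA : IsLorentzian A) : A.det < 0 := by
  obtain ⟨P, -, h⟩ := hA
  have h1 : P.det ^ 2 * A.det = -1 := by
    have := congrArg Matrix.det h
    rw [Matrix.det_mul, Matrix.det_mul, Matrix.det_transpose, Matrix.det_diagonal] at this
    simp [Fin.prod_univ_four] at this
    linarith
  by_contra hn
  nlinarith [mul_nonneg (sq_nonneg P.det) (not_lt.1 hn)]

variable {M : Type*} [TopologicalSpace M] [ChartedSpace Coord M] {f : ℝ → ℝ} {Q : OneForm M}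
  {g : LorentzMetric M} {Γ : SymmetricConnection M} {Λ : Multiplier M}

theorem isFieldOn (hf : ContDiff ℝ ∞ f) (Q : OneForm M) (g : LorentzMetric M)
    (Γ : SymmetricConnection M) {e : OpenPartialHomeomorph M Coord} (he : e ∈ charts M) :
    IsFieldOn e.target f (Q.comp e) (g.comp e) (Γ.comp e) where
  isOpen := e.open_target
  smooth_metric := g.smooth e he
  smooth_oneForm := Q.smooth e he
  symm x hx := (g.lorentzian e he x hx).symm
  det_neg x hx := (g.lorentzian e he x hx).det_neg
  smooth_lagrangian := hf
  smooth_connection := Γ.smooth e he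
  symm_connection := Γ.symm e he

/-- The field equations in the original frame. -/
theorem isStationaryPoint_iff (hf : ContDiff ℝ ∞ f) : IsStationaryPoint f Q g Γ Λ ↔
    WeylConstraint Q g Γ ∧ MultiplierEq f Q g Γ Λ ∧
      TensorEq₂ (M := M) (fun e => fieldOperator f (g.comp e) (Γ.comp e))
        (fun e => weylSource f (Q.comp e) (g.comp e) (Γ.comp e)) := by
  have key : ∀ e ∈ charts M, _ := fun e he => (isFieldOn hf Q g Γ he).isStationaryOn_iff
    (Λ.smooth e he) (Λ.symm e he)
  constructor
  · intro h
    have h' := fun e he => (key e he).1 (h e he)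
    exact ⟨fun e he => (h' e he).1, fun e he => (h' e he).2.1, fun e he => (h' e he).2.2⟩
  · rintro ⟨h1, h2, h3⟩ e he
    exact (key e he).2 ⟨h1 e he, h2 e he, h3 e he⟩

/-- Two tensor equations are equivalent when the differences of their sides are proportional with
a nowhere vanishing factor. -/
theorem tensorEq₂_iff_of_eq_mul {lhs rhs lhs' rhs' : OpenPartialHomeomorph M Coord → Comp₂}
    {u : OpenPartialHomeomorph M Coord → Coord → ℝ}
    (hu : ∀ e ∈ charts M, ∀ x ∈ e.target, u e x ≠ 0)
    (h : ∀ e ∈ charts M, ∀ x ∈ e.target, ∀ a b,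
      lhs e x a b - rhs e x a b = u e x * (lhs' e x a b - rhs' e x a b)) :
    TensorEq₂ lhs rhs ↔ TensorEq₂ lhs' rhs' := by
  refine forall_congr' fun e => forall_congr' fun he => forall_congr' fun x =>
    forall_congr' fun hx => forall_congr' fun a => forall_congr' fun b => ?_
  rw [← sub_eq_zero, h e he x hx, mul_eq_zero, or_iff_right (hu e he x hx), sub_eq_zero]

theorem tensorEq₃_congr_right {lhs rhs rhs' : OpenPartialHomeomorph M Coord → Comp₃}
    (h : ∀ e ∈ charts M, ∀ x ∈ e.target, ∀ c a b, rhs e x c a b = rhs' e x c a b) :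
    TensorEq₃ lhs rhs ↔ TensorEq₃ lhs rhs' := by
  refine forall_congr' fun e => forall_congr' fun he => forall_congr' fun x =>
    forall_congr' fun hx => forall_congr' fun c => forall_congr' fun a => forall_congr' fun b => ?_
  rw [h e he x hx]

theorem tensorEq₂_congr {lhs rhs lhs' rhs' : OpenPartialHomeomorph M Coord → Comp₂}
    (h : ∀ e ∈ charts M, ∀ x ∈ e.target, ∀ a b, lhs e x a b = lhs' e x a b)
    (h' : ∀ e ∈ charts M, ∀ x ∈ e.target, ∀ a b, rhs e x a b = rhs' e x a b) :
    TensorEq₂ lhs rhs ↔ TensorEq₂ lhs' rhs' := by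
  refine forall_congr' fun e => forall_congr' fun he => forall_congr' fun x =>
    forall_congr' fun hx => forall_congr' fun a => forall_congr' fun b => ?_
  rw [h e he x hx, h' e he x hx]

/-- The connection is unchanged by the passage to the conformal frame. -/
theorem connectionT_eq (hf : ContDiff ℝ ∞ f)
    (hpos : ∀ e ∈ charts M, ∀ x ∈ e.target, 0 < fPrime f (g.comp e) (Γ.comp e) x)
    (hW : WeylConstraint Q g Γ) : TensorEq₃ (connectionT f Q g Γ) Γ.comp :=
  fun e he x hx c a b => by
    rw [hW e he x hx]
    exact (isFieldOn hf Q g Γ he).weylConnection_conformal (hpos e he) hx c a b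

/-- The field equations in the conformal frame. -/
theorem isStationaryPoint_iff_conformal (hf : ContDiff ℝ ∞ f)
    (hpos : ∀ e ∈ charts M, ∀ x ∈ e.target, 0 < fPrime f (g.comp e) (Γ.comp e) x) :
    IsStationaryPoint f Q g Γ Λ ↔
    WeylConstraint Q g Γ ∧ MultiplierEq f Q g Γ Λ ∧
      TensorEq₂ (M := M) (fun e => einstein (metricT f g Γ e) (connectionT f Q g Γ e))
        (fun e x a b =>
          conformalSource (metricT f g Γ e) (connectionT f Q g Γ e) (oneFormT f Q g Γ e) x a b
            - metricT f g Γ e x a b * potentialT f g Γ e x) := by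
  rw [isStationaryPoint_iff hf]
  refine and_congr_right fun hW => and_congr_right fun _ => ?_
  exact tensorEq₂_iff_of_eq_mul (fun e he x hx => (hpos e he x hx).ne') fun e he x hx a b =>
    (isFieldOn hf Q g Γ he).fieldOperator_sub_weylSource_conformal (hpos e he)
      (connectionT_eq hf hpos hW e he) hx a b

/-- If the Weyl one-form of the conformal frame vanishes, the geometry of that frame is
Riemannian and the multipliers vanish. -/
theorem isStationaryPoint_iff_of_oneFormT_eq_zero (hf : ContDiff ℝ ∞ f)
    (hpos : ∀ e ∈ charts M, ∀ x ∈ e.target, 0 < fPrime f (g.comp e) (Γ.comp e) x)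
    (h0 : TensorEq₁ (oneFormT f Q g Γ) (fun _ _ _ => 0)) : IsStationaryPoint f Q g Γ Λ ↔
      TensorEq₃ Γ.comp (leviCivita (metricT f g Γ)) ∧
      TensorEq₃ Λ.comp (fun _ _ _ _ _ => 0) ∧
      TensorEq₂ (M := M)
        (fun e => einstein (metricT f g Γ e) (leviCivita (metricT f g Γ) e))
        (fun e x a b => -(metricT f g Γ e x a b * potentialT f g Γ e x)) := by
  have hLC : ∀ e ∈ charts M, ∀ x ∈ e.target, ∀ c a b,
      connectionT f Q g Γ e x c a b = leviCivita (metricT f g Γ) e x c a b :=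
    fun e he x hx c a b => weylConnection_eq_christoffel (h0 e he x hx) c a b
  have hWLC : ∀ e ∈ charts M, ∀ x ∈ e.target, ∀ c a b, weylConnection (g.comp e) (Q.comp e) x c a b
      = leviCivita (metricT f g Γ) e x c a b := fun e he x hx c a b => by
    rw [← hLC e he x hx]
    exact ((isFieldOn hf Q g Γ he).weylConnection_conformal (hpos e he) hx c a b).symm
  -- `P_a = f' Q̃_a`
  have hP : ∀ e ∈ charts M, ∀ x ∈ e.target, ∀ a,
      momentum f (Q.comp e) (g.comp e) (Γ.comp e) x a = 0 := fun e he x hx a => by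
    have h := h0 e he x hx a
    simp only [oneFormT, conformalOneForm] at h
    rw [momentum, (isFieldOn hf Q g Γ he).grad_fPrime (hpos e he) hx]
    linear_combination fPrime f (g.comp e) (Γ.comp e) x * h
  have hM : ∀ e ∈ charts M, ∀ x ∈ e.target, ∀ c a b,
      multiplierValue f (Q.comp e) (g.comp e) (Γ.comp e) x c a b = 0 := fun e he x hx c a b => by
    simp [multiplierValue_eq, momentumUp, hP e he x hx]
  rw [isStationaryPoint_iff_conformal hf hpos]
  refine and_congr (tensorEq₃_congr_right hWLC) (and_congr (tensorEq₃_congr_right hM)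
    (tensorEq₂_congr (fun e he x hx a b => ?_) fun e he x hx a b => ?_))
  · simp only [einstein, symPart, scalarCurvature,
      ricci_congr e.open_target (hLC e he) hx]
  · have hc : ∀ a b, covDeriv (connectionT f Q g Γ e) (oneFormT f Q g Γ e) x a b = 0 :=
      fun a b => by
        rw [covDeriv, pd_congr_on e.open_target (fun y hy => h0 e he y hy b) hx]
        simp [h0 e he x hx]
    simp [conformalSource, symPart, contract, inner₁, hc, h0 e he x hx]

/-- The field equations for vanishing Weyl one-form. -/
theorem isStationaryPoint_iff_of_oneForm_eq_zero (hf : ContDiff ℝ ∞ f)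
    (h0 : TensorEq₁ Q.comp (fun _ _ _ => 0)) : IsStationaryPoint f Q g Γ Λ ↔
      TensorEq₃ Γ.comp (leviCivita g.comp) ∧ MultiplierEq f Q g Γ Λ ∧
      TensorEq₂ (M := M) (fun e => fieldOperator f (g.comp e) (Γ.comp e))
        (fun _ _ _ _ => 0) := by
  rw [isStationaryPoint_iff hf]
  refine and_congr (tensorEq₃_congr_right fun e he x hx c a b =>
    weylConnection_eq_christoffel (h0 e he x hx) c a b) (and_congr_right fun _ =>
    tensorEq₂_congr (fun _ _ _ _ _ _ => rfl) fun e he x hx a b => ?_)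
  have hc : ∀ a b, covDeriv (Γ.comp e) (Q.comp e) x a b = 0 := fun a b => by
    rw [covDeriv, pd_congr_on e.open_target (fun y hy => h0 e he y hy b) hx]
    simp [h0 e he x hx]
  simp [weylSource, symPart, contract, inner₁, hc, h0 e he x hx]

/-- The standard conformal equivalence: for vanishing Weyl one-form, Einstein's equations with the
scalar field `φ = ln f'` as source. -/
theorem isStationaryPoint_iff_kinetic (hf : ContDiff ℝ ∞ f)
    (hpos : ∀ e ∈ charts M, ∀ x ∈ e.target, 0 < fPrime f (g.comp e) (Γ.comp e) x)
    (h0 : TensorEq₁ Q.comp (fun _ _ _ => 0)) : IsStationaryPoint f Q g Γ Λ ↔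
      TensorEq₃ Γ.comp (leviCivita g.comp) ∧ MultiplierEq f Q g Γ Λ ∧
      TensorEq₂ (M := M)
        (fun e => einstein (metricT f g Γ e) (leviCivita (metricT f g Γ) e))
        (fun e x a b => kineticSource (metricT f g Γ e) (scalarT f g Γ e) x a b
          - metricT f g Γ e x a b * potentialT f g Γ e x) := by
  rw [isStationaryPoint_iff_of_oneForm_eq_zero hf h0]
  refine and_congr_right fun hΓ => and_congr_right fun _ => ?_
  exact tensorEq₂_iff_of_eq_mul (fun e he x hx => (hpos e he x hx).ne') fun e he x hx a b => by
    rw [sub_zero]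
    exact (isFieldOn hf Q g Γ he).fieldOperator_kinetic (hpos e he) (hΓ e he) hx a b

end Global

end WeylFR

theorem mainTheorem1 {M : Type*} [TopologicalSpace M] [ChartedSpace Coord M]
    [IsManifold (𝓡 4) ∞ M] (f : ℝ → ℝ) (hf : ContDiff ℝ ∞ f)
    (Q : OneForm M) (g : LorentzMetric M) (Γ : SymmetricConnection M) (Λ : Multiplier M)
    (hpos : ∀ e ∈ charts M, ∀ x ∈ e.target, 0 < fPrime f (g.comp e) (Γ.comp e) x) :
    -- the field equations in the original frame
    (IsStationaryPoint f Q g Γ Λ ↔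
      WeylConstraint Q g Γ ∧ MultiplierEq f Q g Γ Λ ∧
        TensorEq₂ (M := M) (fun e => fieldOperator f (g.comp e) (Γ.comp e))
          (fun e => weylSource f (Q.comp e) (g.comp e) (Γ.comp e))) ∧
    -- the field equations in the conformal frame
    (IsStationaryPoint f Q g Γ Λ ↔
      WeylConstraint Q g Γ ∧ MultiplierEq f Q g Γ Λ ∧
        TensorEq₂ (M := M) (fun e => einstein (metricT f g Γ e) (connectionT f Q g Γ e))
          (fun e x a b =>
            conformalSource (metricT f g Γ e) (connectionT f Q g Γ e) (oneFormT f Q g Γ e) x a b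
              - metricT f g Γ e x a b * potentialT f g Γ e x)) ∧
    -- the connection is unchanged by the conformal transformation
    (WeylConstraint Q g Γ → TensorEq₃ (connectionT f Q g Γ) Γ.comp) ∧
    -- the potential is a function of the scalar field
    ((∀ r, deriv (deriv f) r ≠ 0) →
      ∀ e ∈ charts M, ∀ x ∈ e.target, potentialT f g Γ e x = scalarPotential f (scalarT f g Γ e x)) ∧
    -- vanishing transformed one-form: Riemannian geometry in the conformal frame
    (TensorEq₁ (oneFormT f Q g Γ) (fun _ _ _ => 0) →
      (IsStationaryPoint f Q g Γ Λ ↔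
        TensorEq₃ Γ.comp (leviCivita (metricT f g Γ)) ∧
        TensorEq₃ Λ.comp (fun _ _ _ _ _ => 0) ∧
        TensorEq₂ (M := M)
          (fun e => einstein (metricT f g Γ e) (leviCivita (metricT f g Γ) e))
          (fun e x a b => -(metricT f g Γ e x a b * potentialT f g Γ e x)))) ∧
    -- vanishing original one-form: the standard conformal equivalence
    (TensorEq₁ Q.comp (fun _ _ _ => 0) →
      (IsStationaryPoint f Q g Γ Λ ↔
        TensorEq₃ Γ.comp (leviCivita g.comp) ∧ MultiplierEq f Q g Γ Λ ∧
        TensorEq₂ (M := M) (fun e => fieldOperator f (g.comp e) (Γ.comp e))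
          (fun _ _ _ _ => 0)) ∧
      (IsStationaryPoint f Q g Γ Λ ↔
        TensorEq₃ Γ.comp (leviCivita g.comp) ∧ MultiplierEq f Q g Γ Λ ∧
        TensorEq₂ (M := M)
          (fun e => einstein (metricT f g Γ e) (leviCivita (metricT f g Γ) e))
          (fun e x a b => kineticSource (metricT f g Γ e) (scalarT f g Γ e) x a b
            - metricT f g Γ e x a b * potentialT f g Γ e x))) := by
  exact ⟨isStationaryPoint_iff hf, isStationaryPoint_iff_conformal hf hpos, connectionT_eq hf hpos,
    fun h2 e he x hx => potential_eq_scalarPotential hf h2 (hpos e he x hx),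
    isStationaryPoint_iff_of_oneFormT_eq_zero hf hpos,
    fun h0 => ⟨isStationaryPoint_iff_of_oneForm_eq_zero hf h0,
      isStationaryPoint_iff_kinetic hf hpos h0⟩⟩
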